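/- Let $R$ be a principal ideal domain. For a simple graph $G$ on a totally ordered vertex set $V$, let $\mathrm{Ind}(G)$ be the simplicial complex of all nonempty finite independent sets of $G$, and let $\overrightarrow{\mathrm{Ind}}(G)$ be the directed simplicial complex of all nonempty finite sequences of distinct, mutually non-adjacent vertices. If $V'$ is another totally ordered set, disjoint from $V$, then $V\sqcup V'$ is ordered with $V$ before $V'$; the join $\mathcal K*\mathcal K'$ of (directed) simplicial complexes on $V$ and $V'$ consists of the simplices of $\mathcal K$, those of $\mathcal K'$, and all $\sigma*\sigma'$ with $\sigma\in\mathcal K$, $\sigma'\in\mathcal K'$, where $\sigma*\sigma'$ is the disjoint union (in the directed case, the concatenation). Let $\tilde C_\bullet$ denote the augmented chain complex with coefficients in $R$ ($\tilde C_{-1}=R$) and $\tilde H_m$, $m\ge -1$, its homology (reduced homology). The boundary is the alternating sum of the faces obtained by omitting one vertex, where in the undirected case the vertices of a simplex are listed in increasing order. Let $\pi$ denote the chain maps from directed complexes to their underlying simplicial complexes, $(v_{s(0)},\dots,v_{s(k)})\mapsto \mathrm{sgn}(s)\{v_0,\dots,v_k\}$ for $v_0<\dots<v_k$ and $s$ a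 permutation; the underlying simplicial complex of $\overrightarrow{\mathrm{Ind}}(G)$ is $\mathrm{Ind}(G)$. **Theorem.** Let $G$ be a graph on $V$ and $G'$ a graph on $V'$, with $V,V'$ disjoint. Then $\mathrm{Ind}(G\sqcup G')=\mathrm{Ind}(G)*\mathrm{Ind}(G')$, this is the underlying simplicial complex of $\overrightarrow{\mathrm{Ind}}(G)*\overrightarrow{\mathrm{Ind}}(G')$, and for every integer $n\ge -1$ there is a commutative diagram whose two rows are short exact sequences $$0\to\bigoplus_{p+q=n-1}\tilde H_p(\overrightarrow{\mathrm{Ind}}(G))\otimes_R\tilde H_q(\overrightarrow{\mathrm{Ind}}(G'))\to\tilde H_n(\overrightarrow{\mathrm{Ind}}(G)*\overrightarrow{\mathrm{Ind}}(G'))\to\bigoplus_{p+q=n-2}\mathrm{Tor}_1^R(\tilde H_p(\overrightarrow{\mathrm{Ind}}(G)),\tilde H_q(\overrightarrow{\mathrm{Ind}}(G')))\to 0,$$ $$0\to\bigoplus_{p+q=n-1}\tilde H_p(\mathrm{Ind}(G))\otimes_R\tilde H_q(\mathrm{Ind}(G'))\to\tilde H_n(\mathrm{Ind}(G\sqcup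 G'))\to\bigoplus_{p+q=n-2}\mathrm{Tor}_1^R(\tilde H_p(\mathrm{Ind}(G)),\tilde H_q(\mathrm{Ind}(G')))\to 0$$ (with $p,q\ge -1$) and whose vertical maps, from the first row to the second, are $\bigoplus\pi_*\otimes\pi_*$, $\pi_*$ and $\bigoplus\mathrm{Tor}_1^R(\pi_*,\pi_*)$. The first map of each row sends $[x]\otimes[y]$ to $[x*y]$, where $*$ on chains is the bilinear extension of the join of simplices. Moreover these diagrams can be chosen for all pairs of graphs (on vertex sets as above) at once so that they are functorial with respect to filtrations of the vertices: if $\{V_t\}_{t\in\mathbb Z}$ and $\{V'_t\}_{t\in\mathbb Z}$ are increasing families of subsets of $V$ and $V'$ with unions $V$ and $V'$, and $G_t$, $G'_t$ are the subgraphs of $G$, $G'$ induced on $V_t$, $V'_t$, then for all $s\le t$ the maps induced by the inclusions $G_s\subseteq G_t$, $G'_s\subseteq G'_t$ form a morphism from the diagram of $(G_s,G'_s)$ to that of $(G_t,G'_t)$, and for all $t$ the maps induced by $G_t\subseteq G$, $G'_t\subseteq G'$ form a morphism from the diagram of $(G_t,G'_t)$ to that of $(G,G')$. -/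

import Mathlib

open CategoryTheory
open scoped TensorProduct DirectSum

universe u

noncomputable section

namespace IndKunneth

/-! ### Directed and undirected simplicial complexes -/

/-- A directed simplicial complex on `V`: a collection of nonempty finite sequences of pairwise
distinct vertices which is closed under passing to nonempty subsequences. -/
@[ext]
structure DirectedComplex (V : Type u) where
  faces : Set (List V)
  ne_nil : ∀ σ ∈ faces, σ ≠ []
  nodup : ∀ σ ∈ faces, σ.Nodup
  down_closed : ∀ σ ∈ faces, ∀ τ : List V, τ.Sublist σ → τ ≠ [] → τ ∈ faces

/-- The underlying simplicial complex: forget the order of the vertices in every sequence. -/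
def DirectedComplex.underlying {V : Type u} [DecidableEq V] (K : DirectedComplex V) :
    PreAbstractSimplicialComplex V where
  faces := {s | ∃ σ ∈ K.faces, σ.toFinset = s}
  isRelLowerSet_faces := by
    rintro s ⟨σ, hσ, rfl⟩
    refine ⟨?_, ?_⟩
    · rw [List.toFinset_nonempty_iff]
      exact K.ne_nil σ hσ
    · intro t ht hne
      have key : (σ.filter (fun v => v ∈ t)).toFinset = t := by
        ext v
        simp only [List.mem_toFinset, List.mem_filter, decide_eq_true_eq]
        exact ⟨fun h => h.2, fun h => ⟨List.mem_toFinset.1 (ht h), h⟩⟩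
      refine ⟨_, K.down_closed σ hσ (σ.filter (fun v => v ∈ t)) List.filter_sublist ?_, key⟩
      rw [← List.toFinset_nonempty_iff, key]
      exact hne

/-- Concatenation of a sequence in `V` and a sequence in `V'`, as a sequence in the disjoint union
`V ⊕ₗ V'` (ordered so that all of `V` precedes all of `V'`). -/
def joinList {V V' : Type u} (σ : List V) (τ : List V') : List (V ⊕ₗ V') :=
  σ.map Sum.inlₗ ++ τ.map Sum.inrₗ

/-- The disjoint union of a finite subset of `V` and one of `V'`, as a subset of `V ⊕ₗ V'`. -/
def joinFinset {V V' : Type u} (σ : Finset V) (τ : Finset V') : Finset (V ⊕ₗ V') :=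
  (σ.disjSum τ).map toLex.toEmbedding

theorem inl_mem_joinFinset {V V' : Type u} {σ : Finset V} {τ : Finset V'} {v : V} :
    toLex (Sum.inl v) ∈ joinFinset σ τ ↔ v ∈ σ := by
  simp [joinFinset]

theorem inr_mem_joinFinset {V V' : Type u} {σ : Finset V} {τ : Finset V'} {v : V'} :
    toLex (Sum.inr v) ∈ joinFinset σ τ ↔ v ∈ τ := by
  simp [joinFinset]

theorem exists_joinFinset {V V' : Type u} (s : Finset (V ⊕ₗ V')) :
    ∃ (σ : Finset V) (τ : Finset V'), s = joinFinset σ τ := by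
  classical
  refine ⟨(s.map ofLex.toEmbedding).toLeft, (s.map ofLex.toEmbedding).toRight, ?_⟩
  ext x
  induction x using Lex.rec with | h x => ?_
  rcases x with v | v <;> simp [joinFinset]

/-- The join of directed simplicial complexes on disjoint vertex sets. -/
def DirectedComplex.join {V V' : Type u} (K : DirectedComplex V) (K' : DirectedComplex V') :
    DirectedComplex (V ⊕ₗ V') where
  faces := {ρ | (∃ σ ∈ K.faces, ρ = joinList σ []) ∨ (∃ τ ∈ K'.faces, ρ = joinList [] τ) ∨
    ∃ σ ∈ K.faces, ∃ τ ∈ K'.faces, ρ = joinList σ τ}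
  ne_nil := by
    rintro ρ (⟨σ, hσ, rfl⟩ | ⟨τ, hτ, rfl⟩ | ⟨σ, hσ, τ, hτ, rfl⟩)
    · simpa [joinList] using K.ne_nil σ hσ
    · simpa [joinList] using K'.ne_nil τ hτ
    · intro h
      simp only [joinList, List.append_eq_nil_iff, List.map_eq_nil_iff] at h
      exact K.ne_nil σ hσ h.1
  nodup := by
    have h1 : Function.Injective (Sum.inlₗ : V → V ⊕ₗ V') := fun a b h => by
      simpa [Sum.inlₗ] using h
    have h2 : Function.Injective (Sum.inrₗ : V' → V ⊕ₗ V') := fun a b h => by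
      simpa [Sum.inrₗ] using h
    have key : ∀ (σ : List V) (τ : List V'), σ.Nodup → τ.Nodup → (joinList σ τ).Nodup := by
      intro σ τ hσ hτ
      refine List.Nodup.append (hσ.map h1) (hτ.map h2) ?_
      intro x hx hy
      obtain ⟨v, -, rfl⟩ := List.mem_map.1 hx
      obtain ⟨w, -, hw⟩ := List.mem_map.1 hy
      simp [Sum.inlₗ, Sum.inrₗ] at hw
    rintro ρ (⟨σ, hσ, rfl⟩ | ⟨τ, hτ, rfl⟩ | ⟨σ, hσ, τ, hτ, rfl⟩)
    · exact key _ _ (K.nodup σ hσ) List.nodup_nil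
    · exact key _ _ List.nodup_nil (K'.nodup τ hτ)
    · exact key _ _ (K.nodup σ hσ) (K'.nodup τ hτ)
  down_closed := by
    have key : ∀ (σ : List V) (τ : List V') (ρ : List (V ⊕ₗ V')), ρ.Sublist (joinList σ τ) →
        ∃ σ' τ', σ'.Sublist σ ∧ τ'.Sublist τ ∧ ρ = joinList σ' τ' := by
      intro σ τ ρ h
      obtain ⟨a, b, rfl, ha, hb⟩ := List.sublist_append_iff.1 h
      obtain ⟨σ', h1, rfl⟩ := List.sublist_map_iff.1 ha
      obtain ⟨τ', h2, rfl⟩ := List.sublist_map_iff.1 hb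
      exact ⟨σ', τ', h1, h2, rfl⟩
    rintro ρ (⟨σ, hσ, rfl⟩ | ⟨τ, hτ, rfl⟩ | ⟨σ, hσ, τ, hτ, rfl⟩) ρ' hs hne <;>
      obtain ⟨σ', τ', h1, h2, rfl⟩ := key _ _ _ hs
    · obtain rfl := List.sublist_nil.1 h2
      refine Or.inl ⟨σ', K.down_closed σ hσ σ' h1 ?_, rfl⟩
      rintro rfl
      exact hne rfl
    · obtain rfl := List.sublist_nil.1 h1
      refine Or.inr (Or.inl ⟨τ', K'.down_closed τ hτ τ' h2 ?_, rfl⟩)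
      rintro rfl
      exact hne rfl
    · by_cases hσ' : σ' = []
      · subst hσ'
        refine Or.inr (Or.inl ⟨τ', K'.down_closed τ hτ τ' h2 ?_, rfl⟩)
        rintro rfl
        exact hne rfl
      · by_cases hτ' : τ' = []
        · subst hτ'
          exact Or.inl ⟨σ', K.down_closed σ hσ σ' h1 hσ', rfl⟩
        · exact Or.inr (Or.inr ⟨σ', K.down_closed σ hσ σ' h1 hσ', τ',
            K'.down_closed τ hτ τ' h2 hτ', rfl⟩)

/-- The join of simplicial complexes on disjoint vertex sets. -/
def simplicialJoin {V V' : Type u} (K : PreAbstractSimplicialComplex V)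
    (K' : PreAbstractSimplicialComplex V') : PreAbstractSimplicialComplex (V ⊕ₗ V') where
  faces := {ρ | (∃ σ ∈ K.faces, ρ = joinFinset σ ∅) ∨ (∃ τ ∈ K'.faces, ρ = joinFinset ∅ τ) ∨
    ∃ σ ∈ K.faces, ∃ τ ∈ K'.faces, ρ = joinFinset σ τ}
  isRelLowerSet_faces := by
    have hle : ∀ {σ σ' : Finset V} {τ τ' : Finset V'}, joinFinset σ' τ' ≤ joinFinset σ τ →
        σ' ⊆ σ ∧ τ' ⊆ τ := fun h =>
      ⟨fun v hv => inl_mem_joinFinset.1 (h (inl_mem_joinFinset.2 hv)),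
        fun v hv => inr_mem_joinFinset.1 (h (inr_mem_joinFinset.2 hv))⟩
    have hne : ∀ {σ : Finset V} {τ : Finset V'}, (joinFinset σ τ).Nonempty ↔
        (σ.Nonempty ∨ τ.Nonempty) := by
      intro σ τ
      simp only [joinFinset, Finset.map_nonempty]
      rw [Finset.nonempty_iff_ne_empty, Ne, Finset.disjSum_eq_empty, not_and_or,
        Finset.nonempty_iff_ne_empty, Finset.nonempty_iff_ne_empty]
    have hK : ∀ {σ σ'}, σ ∈ K.faces → σ' ⊆ σ → σ'.Nonempty → σ' ∈ K.faces :=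
      fun h h1 h2 => (K.isRelLowerSet_faces h).2 h1 h2
    have hK' : ∀ {σ σ'}, σ ∈ K'.faces → σ' ⊆ σ → σ'.Nonempty → σ' ∈ K'.faces :=
      fun h h1 h2 => (K'.isRelLowerSet_faces h).2 h1 h2
    rintro ρ (⟨σ, hσ, rfl⟩ | ⟨τ, hτ, rfl⟩ | ⟨σ, hσ, τ, hτ, rfl⟩)
    · refine ⟨hne.2 (Or.inl (K.isRelLowerSet_faces hσ).1), fun ρ' h h' => ?_⟩
      obtain ⟨σ', τ', rfl⟩ := exists_joinFinset ρ'
      obtain ⟨h1, h2⟩ := hle h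
      obtain rfl := Finset.subset_empty.1 h2
      exact Or.inl ⟨σ', hK hσ h1 ((hne.1 h').resolve_right (by simp)), rfl⟩
    · refine ⟨hne.2 (Or.inr (K'.isRelLowerSet_faces hτ).1), fun ρ' h h' => ?_⟩
      obtain ⟨σ', τ', rfl⟩ := exists_joinFinset ρ'
      obtain ⟨h1, h2⟩ := hle h
      obtain rfl := Finset.subset_empty.1 h1
      exact Or.inr (Or.inl ⟨τ', hK' hτ h2 ((hne.1 h').resolve_left (by simp)), rfl⟩)
    · refine ⟨hne.2 (Or.inl (K.isRelLowerSet_faces hσ).1), fun ρ' h h' => ?_⟩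
      obtain ⟨σ', τ', rfl⟩ := exists_joinFinset ρ'
      obtain ⟨h1, h2⟩ := hle h
      rcases σ'.eq_empty_or_nonempty with rfl | hs
      · exact Or.inr (Or.inl ⟨τ', hK' hτ h2 ((hne.1 h').resolve_left (by simp)), rfl⟩)
      · rcases τ'.eq_empty_or_nonempty with rfl | ht
        · exact Or.inl ⟨σ', hK hσ h1 hs, rfl⟩
        · exact Or.inr (Or.inr ⟨σ', hK hσ h1 hs, τ', hK' hτ h2 ht, rfl⟩)

/-! ### Independence complexes of graphs -/

/-- The directed independence complex: all nonempty finite sequences of distinct, mutually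
non-adjacent vertices. -/
def directedInd {V : Type u} (G : SimpleGraph V) : DirectedComplex V where
  faces := {σ | σ ≠ [] ∧ σ.Pairwise (fun u v => u ≠ v ∧ ¬ G.Adj u v)}
  ne_nil := fun _ h => h.1
  nodup := fun _ h => h.2.imp fun h => h.1
  down_closed := fun _ h _ hs hne => ⟨hne, h.2.sublist hs⟩

/-- The independence complex: all nonempty finite independent sets of vertices. -/
def ind {V : Type u} (G : SimpleGraph V) : PreAbstractSimplicialComplex V where
  faces := {s | s.Nonempty ∧ G.IsIndepSet (s : Set V)}
  isRelLowerSet_faces := fun _ h =>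
    ⟨h.1, fun _ hb hne => ⟨hne, h.2.mono (Finset.coe_subset.2 hb)⟩⟩

/-- The disjoint union of two graphs, on the ordered disjoint union of the vertex sets. -/
def disjointUnion {V V' : Type u} (G : SimpleGraph V) (G' : SimpleGraph V') :
    SimpleGraph (V ⊕ₗ V') :=
  (G ⊕g G').comap ofLex

theorem underlying_directedInd {V : Type u} [DecidableEq V] (G : SimpleGraph V) :
    (directedInd G).underlying = ind G := by
  ext s
  constructor
  · rintro ⟨σ, ⟨hne, hσ⟩, rfl⟩
    refine ⟨List.toFinset_nonempty_iff σ |>.2 hne, ?_⟩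
    have h2 : σ.Pairwise (fun u v => ¬ G.Adj u v) := hσ.imp fun h => h.2
    intro u hu v hv huv
    have hu' : u ∈ σ := by simpa using hu
    have hv' : v ∈ σ := by simpa using hv
    have : Std.Symm (fun u v => ¬ G.Adj u v) := ⟨fun _ _ h h' => h h'.symm⟩
    exact h2.forall hu' hv' huv
  · rintro ⟨hne, hs⟩
    refine ⟨s.toList, ⟨by simpa using hne.ne_empty, ?_⟩, by simp⟩
    refine s.nodup_toList.imp_of_mem ?_
    intro u v hu hv huv
    exact ⟨huv, hs (by simpa using hu) (by simpa using hv) huv⟩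

theorem ind_disjointUnion {V V' : Type u} (G : SimpleGraph V) (G' : SimpleGraph V') :
    ind (disjointUnion G G') = simplicialJoin (ind G) (ind G') := by
  have key : ∀ (σ : Finset V) (τ : Finset V'),
      (disjointUnion G G').IsIndepSet (joinFinset σ τ : Set (V ⊕ₗ V')) ↔
        G.IsIndepSet (σ : Set V) ∧ G'.IsIndepSet (τ : Set V') := by
    intro σ τ
    constructor
    · intro h
      refine ⟨fun u hu v hv huv hadj => ?_, fun u hu v hv huv hadj => ?_⟩
      · exact h (inl_mem_joinFinset.2 hu) (inl_mem_joinFinset.2 hv) (by simpa using huv)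
          (by simpa [disjointUnion] using hadj)
      · exact h (inr_mem_joinFinset.2 hu) (inr_mem_joinFinset.2 hv) (by simpa using huv)
          (by simpa [disjointUnion] using hadj)
    · rintro ⟨h1, h2⟩ x hx y hy hxy hadj
      induction x using Lex.rec with | h x => ?_
      induction y using Lex.rec with | h y => ?_
      rcases x with u | u <;> rcases y with v | v
      · exact h1 (inl_mem_joinFinset.1 hx) (inl_mem_joinFinset.1 hy) (by simpa using hxy)
          (by simpa [disjointUnion] using hadj)
      · simp [disjointUnion] at hadj
      · simp [disjointUnion] at hadj
      · exact h2 (inr_mem_joinFinset.1 hx) (inr_mem_joinFinset.1 hy) (by simpa using hxy)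
          (by simpa [disjointUnion] using hadj)
  have e1 : G.IsIndepSet ((∅ : Finset V) : Set V) := by simp [SimpleGraph.IsIndepSet]
  have e2 : G'.IsIndepSet ((∅ : Finset V') : Set V') := by simp [SimpleGraph.IsIndepSet]
  have hne : ∀ {σ : Finset V} {τ : Finset V'}, (joinFinset σ τ).Nonempty ↔
      (σ.Nonempty ∨ τ.Nonempty) := by
    intro σ τ
    simp only [joinFinset, Finset.map_nonempty]
    rw [Finset.nonempty_iff_ne_empty, Ne, Finset.disjSum_eq_empty, not_and_or,
      Finset.nonempty_iff_ne_empty, Finset.nonempty_iff_ne_empty]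
  ext s
  constructor
  · rintro ⟨hs, hi⟩
    obtain ⟨σ, τ, rfl⟩ := exists_joinFinset s
    obtain ⟨h1, h2⟩ := (key _ _).1 hi
    rcases σ.eq_empty_or_nonempty with rfl | hσ
    · exact Or.inr (Or.inl ⟨τ, ⟨(hne.1 hs).resolve_left (by simp), h2⟩, rfl⟩)
    · rcases τ.eq_empty_or_nonempty with rfl | hτ
      · exact Or.inl ⟨σ, ⟨hσ, h1⟩, rfl⟩
      · exact Or.inr (Or.inr ⟨σ, ⟨hσ, h1⟩, τ, ⟨hτ, h2⟩, rfl⟩)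
  · rintro (⟨σ, hσ, rfl⟩ | ⟨τ, hτ, rfl⟩ | ⟨σ, hσ, τ, hτ, rfl⟩)
    · exact ⟨hne.2 (Or.inl hσ.1), (key _ _).2 ⟨hσ.2, e2⟩⟩
    · exact ⟨hne.2 (Or.inr hτ.1), (key _ _).2 ⟨e1, hτ.2⟩⟩
    · exact ⟨hne.2 (Or.inl hσ.1), (key _ _).2 ⟨hσ.2, hτ.2⟩⟩

theorem toFinset_joinList {V V' : Type u} [DecidableEq V] [DecidableEq V']
    [DecidableEq (V ⊕ₗ V')] (σ : List V) (τ : List V') :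
    (joinList σ τ).toFinset = joinFinset σ.toFinset τ.toFinset := by
  ext x
  induction x using Lex.rec with | h x => ?_
  rcases x with v | v <;> simp [joinList, joinFinset, Sum.inlₗ, Sum.inrₗ]

/-- The underlying complex of the join of the directed independence complexes is the
independence complex of the disjoint union. -/
theorem underlying_join_directedInd {V V' : Type u} [DecidableEq V] [DecidableEq V']
    [DecidableEq (V ⊕ₗ V')] (G : SimpleGraph V) (G' : SimpleGraph V') :
    ((directedInd G).join (directedInd G')).underlying = ind (disjointUnion G G') := by
  rw [ind_disjointUnion, ← underlying_directedInd G, ← underlying_directedInd G']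
  ext s
  constructor
  · rintro ⟨ρ, ⟨σ, hσ, rfl⟩ | ⟨τ, hτ, rfl⟩ | ⟨σ, hσ, τ, hτ, rfl⟩, rfl⟩
    · exact Or.inl ⟨_, ⟨σ, hσ, rfl⟩, by simp [toFinset_joinList]⟩
    · exact Or.inr (Or.inl ⟨_, ⟨τ, hτ, rfl⟩, by simp [toFinset_joinList]⟩)
    · exact Or.inr (Or.inr ⟨_, ⟨σ, hσ, rfl⟩, _, ⟨τ, hτ, rfl⟩, by simp [toFinset_joinList]⟩)
  · rintro (⟨-, ⟨σ, hσ, rfl⟩, rfl⟩ | ⟨-, ⟨τ, hτ, rfl⟩, rfl⟩ |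
      ⟨-, ⟨σ, hσ, rfl⟩, -, ⟨τ, hτ, rfl⟩, rfl⟩)
    · exact ⟨_, Or.inl ⟨σ, hσ, rfl⟩, by simp [toFinset_joinList]⟩
    · exact ⟨_, Or.inr (Or.inl ⟨τ, hτ, rfl⟩), by simp [toFinset_joinList]⟩
    · exact ⟨_, Or.inr (Or.inr ⟨σ, hσ, τ, hτ, rfl⟩), by simp [toFinset_joinList]⟩

/-! ### Augmented chain complexes -/

/-- The chain complex given by submodules `C k` of a module `A` that are respected by an
endomorphism `D` of `A` with `D ∘ D = 0` lowering the index by one. -/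
def gradedComplex (R : Type u) [CommRing R] {A : Type u} [AddCommGroup A] [Module R A]
    (C : ℕ → Submodule R A) (D : A →ₗ[R] A) (hC : ∀ k, ∀ x ∈ C (k + 1), D x ∈ C k)
    (hD : ∀ x, D (D x) = 0) : ChainComplex (ModuleCat.{u} R) ℕ :=
  ChainComplex.of (fun k => ModuleCat.of R (C k))
    (fun k => ModuleCat.ofHom (D.restrict (hC k))) (by
      intro k
      exact ModuleCat.hom_ext (LinearMap.ext fun x => Subtype.ext (hD x.1)))

/-- The chain map between two such complexes obtained by restricting a linear map `f`. -/
def gradedMap {R : Type u} [CommRing R] {A B : Type u} [AddCommGroup A] [Module R A]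
    [AddCommGroup B] [Module R B] {C : ℕ → Submodule R A} {D : A →ₗ[R] A}
    {hC : ∀ k, ∀ x ∈ C (k + 1), D x ∈ C k} {hD : ∀ x, D (D x) = 0}
    {C' : ℕ → Submodule R B} {D' : B →ₗ[R] B}
    {hC' : ∀ k, ∀ x ∈ C' (k + 1), D' x ∈ C' k} {hD' : ∀ x, D' (D' x) = 0}
    (f : A →ₗ[R] B) (hf : ∀ k, ∀ x ∈ C k, f x ∈ C' k)
    (hcomm : ∀ k, ∀ x ∈ C (k + 1), D' (f x) = f (D x)) :
    gradedComplex R C D hC hD ⟶ gradedComplex R C' D' hC' hD' :=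
  ChainComplex.ofHom (fun k => ModuleCat.ofHom (f.restrict (hf k))) (by
    intro k
    simp only [gradedComplex, ChainComplex.of_d]
    exact ModuleCat.hom_ext (LinearMap.ext fun x => Subtype.ext (hcomm k x.1 x.2)))

/-- To map chains supported on `s` into a submodule, it suffices to map the basis into it. -/
theorem map_mem_of_supported {R : Type u} [CommRing R] {X M : Type u} [AddCommGroup M]
    [Module R M] (f : (X →₀ R) →ₗ[R] M) (s : Set X) (N : Submodule R M)
    (h : ∀ a ∈ s, f (Finsupp.single a 1) ∈ N) :
    ∀ x ∈ Finsupp.supported R R s, f x ∈ N := by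
  rw [Finsupp.supported_eq_span_single]
  change Submodule.span R _ ≤ N.comap f
  rw [Submodule.span_le]
  rintro _ ⟨a, ha, rfl⟩
  exact h a ha

theorem eq_of_supported {R : Type u} [CommRing R] {X M : Type u} [AddCommGroup M]
    [Module R M] (f g : (X →₀ R) →ₗ[R] M) (s : Set X)
    (h : ∀ a ∈ s, f (Finsupp.single a 1) = g (Finsupp.single a 1)) :
    ∀ x ∈ Finsupp.supported R R s, f x = g x := by
  intro x hx
  have := map_mem_of_supported (f - g) s ⊥ (fun a ha => by simp [h a ha]) x hx
  simpa [sub_eq_zero] using this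

section Directed

variable {V : Type u} (R : Type u) [CommRing R]

/-- `(v_0, …, v_k) ↦ ∑ i, (-1) ^ i (v_0, …, v_i omitted, …, v_k)`. -/
def directedBoundary : (List V →₀ R) →ₗ[R] (List V →₀ R) :=
  Finsupp.linearCombination R fun σ =>
    ∑ i ∈ Finset.range σ.length, (-1 : R) ^ i • Finsupp.single (σ.eraseIdx i) 1

theorem directedBoundary_single (σ : List V) :
    directedBoundary R (Finsupp.single σ 1) =
      ∑ i ∈ Finset.range σ.length, (-1 : R) ^ i • Finsupp.single (σ.eraseIdx i) 1 := by
  simp [directedBoundary]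

theorem directedBoundary_cons (v : V) (x : List V →₀ R) :
    directedBoundary R (Finsupp.lmapDomain R R (List.cons v) x) =
      x - Finsupp.lmapDomain R R (List.cons v) (directedBoundary R x) := by
  have : directedBoundary R ∘ₗ Finsupp.lmapDomain R R (List.cons v) =
      LinearMap.id - Finsupp.lmapDomain R R (List.cons v) ∘ₗ directedBoundary R := by
    ext1 σ
    ext1
    simp only [LinearMap.comp_apply, Finsupp.lsingle_apply, Finsupp.lmapDomain_apply,
      Finsupp.mapDomain_single, LinearMap.sub_apply, LinearMap.id_apply]
    rw [directedBoundary_single, directedBoundary_single, List.length_cons,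
      Finset.sum_range_succ']
    simp only [List.eraseIdx_cons_succ, List.eraseIdx_cons_zero, pow_zero, one_smul]
    rw [add_comm, sub_eq_add_neg, ← Finsupp.lmapDomain_apply R R, map_sum,
      ← Finset.sum_neg_distrib]
    simp [pow_succ, Finsupp.mapDomain_single]
  exact LinearMap.congr_fun this x

theorem directedBoundary_sq (x : List V →₀ R) :
    directedBoundary R (directedBoundary R x) = 0 := by
  have : directedBoundary R ∘ₗ directedBoundary R = (0 : (List V →₀ R) →ₗ[R] _) := by
    ext1 σ
    ext1
    simp only [LinearMap.comp_apply, Finsupp.lsingle_apply, LinearMap.zero_apply]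
    induction σ with
    | nil => simp [directedBoundary_single]
    | cons v l ih =>
      have h : (Finsupp.single (v :: l) 1 : List V →₀ R) =
          Finsupp.lmapDomain R R (List.cons v) (Finsupp.single l 1) := by
        simp [Finsupp.mapDomain_single]
      rw [h, directedBoundary_cons, map_sub, directedBoundary_cons, ih]
      simp
  exact LinearMap.congr_fun this x

/-- The free module on the sequences with exactly `k` vertices in `K`, where the empty sequence is
admitted for `k = 0`. -/
def DirectedComplex.chainModule (K : DirectedComplex V) (k : ℕ) : Submodule R (List V →₀ R) :=
  Finsupp.supported R R {σ | σ.length = k ∧ (σ = [] ∨ σ ∈ K.faces)}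

theorem DirectedComplex.boundary_mem (K : DirectedComplex V) (k : ℕ) :
    ∀ x ∈ K.chainModule R (k + 1), directedBoundary R x ∈ K.chainModule R k := by
  refine map_mem_of_supported _ _ _ ?_
  rintro σ ⟨hl, hσ⟩
  rw [directedBoundary_single]
  refine Submodule.sum_mem _ fun i hi => Submodule.smul_mem _ _ ?_
  have hi' : i < σ.length := Finset.mem_range.1 hi
  refine Finsupp.single_mem_supported R 1 ⟨?_, ?_⟩
  · rw [List.length_eraseIdx_of_lt hi', hl]
    rfl
  · rcases hσ with rfl | hσ
    · simp at hl
    · by_cases h : σ.eraseIdx i = []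
      · exact Or.inl h
      · exact Or.inr (K.down_closed σ hσ _ (List.eraseIdx_sublist σ i) h)

/-- The augmented chain complex of a directed simplicial complex, indexed by the number of vertices:
the `(k - 1)`-simplices span degree `k` and degree `0` is `R`, spanned by the empty sequence. Hence
its homology in degree `k` is the reduced homology in degree `k - 1`. -/
def DirectedComplex.chains (K : DirectedComplex V) : ChainComplex (ModuleCat.{u} R) ℕ :=
  gradedComplex R (K.chainModule R) (directedBoundary R) (K.boundary_mem R)
    (directedBoundary_sq R)

variable {R} {W : Type u}

/-- The chain map induced by a vertex map that carries the sequences in `K` to sequences in `L`. -/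
def DirectedComplex.chainMap {K : DirectedComplex V} {L : DirectedComplex W} (φ : V → W)
    (h : ∀ σ ∈ K.faces, σ.map φ ∈ L.faces) : K.chains R ⟶ L.chains R :=
  gradedMap (Finsupp.lmapDomain R R (List.map φ))
    (fun k => map_mem_of_supported _ _ _ (by
      rintro σ ⟨hl, hσ⟩
      rw [Finsupp.lmapDomain_apply, Finsupp.mapDomain_single]
      refine Finsupp.single_mem_supported R 1 ⟨by simpa using hl, ?_⟩
      rcases hσ with rfl | hσ
      · exact Or.inl rfl
      · exact Or.inr (h σ hσ)))
    (fun k => eq_of_supported (directedBoundary R ∘ₗ Finsupp.lmapDomain R R (List.map φ))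
      (Finsupp.lmapDomain R R (List.map φ) ∘ₗ directedBoundary R) _ (by
      rintro σ -
      simp only [LinearMap.comp_apply]
      rw [Finsupp.lmapDomain_apply, Finsupp.mapDomain_single, directedBoundary_single,
        directedBoundary_single, map_sum]
      simp [Finsupp.mapDomain_single, List.eraseIdx_map]))

end Directed

section Undirected

variable {V : Type u} [LinearOrder V] (R : Type u) [CommRing R]

/-- `{v_0 < ⋯ < v_k} ↦ ∑ i, (-1) ^ i {v_0, …, v_i omitted, …, v_k}`; the index `i` of a vertex
is the number of vertices that precede it. -/
def boundary : (Finset V →₀ R) →ₗ[R] (Finset V →₀ R) :=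
  Finsupp.linearCombination R fun s =>
    ∑ v ∈ s, (-1 : R) ^ (s.filter (· < v)).card • Finsupp.single (s.erase v) 1

theorem boundary_single (s : Finset V) :
    boundary R (Finsupp.single s 1) =
      ∑ v ∈ s, (-1 : R) ^ (s.filter (· < v)).card • Finsupp.single (s.erase v) 1 := by
  simp [boundary]

theorem boundary_sq (x : Finset V →₀ R) : boundary R (boundary R x) = 0 := by
  have : boundary R ∘ₗ boundary R = (0 : (Finset V →₀ R) →ₗ[R] _) := by
    ext1 s
    ext1
    simp only [LinearMap.comp_apply, Finsupp.lsingle_apply, LinearMap.zero_apply]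
    rw [boundary_single, map_sum]
    simp only [map_smul, boundary_single, Finset.smul_sum, smul_smul, ← pow_add]
    rw [Finset.sum_sigma']
    refine Finset.sum_involution (fun p _ => ⟨p.2, p.1⟩) ?_ ?_ ?_ ?_
    · rintro ⟨v, w⟩ h
      simp only [Finset.mem_sigma, Finset.mem_erase] at h
      obtain ⟨hv, hwv, hw⟩ := h
      have key : ∀ a b : V, a ∈ s → b ∈ s → a < b →
          (((s.erase a).filter (· < b)).card + 1 = (s.filter (· < b)).card) ∧
          (((s.erase b).filter (· < a)).card = (s.filter (· < a)).card) := by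
        intro a b ha hb hab
        constructor
        · rw [Finset.filter_erase]
          exact Finset.card_erase_add_one (by simp [ha, hab])
        · rw [Finset.filter_erase, Finset.erase_eq_of_notMem (by simp [hab.le])]
      simp only [Finset.erase_right_comm (a := w) (b := v)]
      rw [← add_smul]
      rcases lt_or_gt_of_ne hwv with h | h
      · obtain ⟨h1, h2⟩ := key w v hw hv h
        rw [← h1, h2, pow_add, pow_add, pow_add]
        ring_nf
        simp
      · obtain ⟨h1, h2⟩ := key v w hv hw h
        rw [← h1, h2, pow_add, pow_add, pow_add]
        ring_nf
        simp
    · rintro ⟨v, w⟩ h - heq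
      simp only [Finset.mem_sigma, Finset.mem_erase] at h
      exact h.2.1 (by simpa using congrArg Sigma.fst heq)
    · rintro ⟨v, w⟩ h
      simp only [Finset.mem_sigma, Finset.mem_erase] at h ⊢
      exact ⟨h.2.2, Ne.symm h.2.1, h.1⟩
    · rintro ⟨v, w⟩ h
      rfl
  exact LinearMap.congr_fun this x

/-- The free module on the simplices with exactly `k` vertices in `K`, where the empty set is
admitted for `k = 0`. -/
def chainModule (K : PreAbstractSimplicialComplex V) (k : ℕ) : Submodule R (Finset V →₀ R) :=
  Finsupp.supported R R {s | s.card = k ∧ (s = ∅ ∨ s ∈ K.faces)}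

theorem boundary_mem (K : PreAbstractSimplicialComplex V) (k : ℕ) :
    ∀ x ∈ chainModule R K (k + 1), boundary R x ∈ chainModule R K k := by
  refine map_mem_of_supported _ _ _ ?_
  rintro s ⟨hl, hs⟩
  rw [boundary_single]
  refine Submodule.sum_mem _ fun v hv => Submodule.smul_mem _ _ ?_
  refine Finsupp.single_mem_supported R 1 ⟨?_, ?_⟩
  · rw [Finset.card_erase_of_mem hv, hl]
    rfl
  · rcases hs with rfl | hs
    · simp at hl
    · rcases (s.erase v).eq_empty_or_nonempty with h | h
      · exact Or.inl h
      · exact Or.inr ((K.isRelLowerSet_faces hs).2 (Finset.erase_subset v s) h)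

/-- The augmented chain complex of a simplicial complex on an ordered vertex set, indexed by the
number of vertices (so that homology in degree `k` is reduced homology in degree `k - 1`). -/
def chains (K : PreAbstractSimplicialComplex V) : ChainComplex (ModuleCat.{u} R) ℕ :=
  gradedComplex R (chainModule R K) (boundary R) (boundary_mem R K) (boundary_sq R)

variable {R} {W : Type u} [LinearOrder W]

/-- The chain map induced by an order embedding of the vertices carrying the simplices of `K` to
simplices of `L`. -/
def chainMap {K : PreAbstractSimplicialComplex V} {L : PreAbstractSimplicialComplex W}
    (φ : V ↪o W) (h : ∀ s ∈ K.faces, s.map φ.toEmbedding ∈ L.faces) :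
    chains R K ⟶ chains R L :=
  gradedMap (Finsupp.lmapDomain R R (Finset.map φ.toEmbedding))
    (fun k => map_mem_of_supported _ _ _ (by
      rintro s ⟨hl, hs⟩
      rw [Finsupp.lmapDomain_apply, Finsupp.mapDomain_single]
      refine Finsupp.single_mem_supported R 1 ⟨by simpa using hl, ?_⟩
      rcases hs with rfl | hs
      · exact Or.inl (by simp)
      · exact Or.inr (h s hs)))
    (fun k => eq_of_supported (boundary R ∘ₗ Finsupp.lmapDomain R R (Finset.map φ.toEmbedding))
      (Finsupp.lmapDomain R R (Finset.map φ.toEmbedding) ∘ₗ boundary R) _ (by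
      rintro s -
      simp only [LinearMap.comp_apply]
      rw [Finsupp.lmapDomain_apply, Finsupp.mapDomain_single, boundary_single,
        boundary_single, map_sum, Finset.sum_map]
      refine Finset.sum_congr rfl fun v hv => ?_
      rw [Finset.filter_map, Finset.card_map, map_smul, Finsupp.lmapDomain_apply,
        Finsupp.mapDomain_single, Finset.map_erase]
      congr 4
      ext w
      simp))

end Undirected

section Projection

variable {V : Type u} [LinearOrder V]

/-- The number of inversions of a sequence. -/
def inversions : List V → ℕ
  | [] => 0
  | v :: l => l.countP (· < v) + inversions l

theorem inversions_eraseIdx (σ : List V) (hσ : σ.Nodup) (i : ℕ) (hi : i < σ.length) :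
    ∃ m : ℕ, inversions σ + σ.countP (· < σ[i]) = i + inversions (σ.eraseIdx i) + 2 * m := by
  induction σ generalizing i with
  | nil => simp at hi
  | cons a l ih =>
    cases i with
    | zero =>
      refine ⟨l.countP (· < a), ?_⟩
      simp [inversions]
      ring
    | succ j =>
      have hj : j < l.length := by simpa using hi
      obtain ⟨m, hm⟩ := ih (List.nodup_cons.1 hσ).2 j hj
      have hne : a ≠ l[j] := fun h => (List.nodup_cons.1 hσ).1 (h ▸ List.getElem_mem hj)
      have hc : l.countP (· < a) = (l.eraseIdx j).countP (· < a) + if l[j] < a then 1 else 0 := by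
        have := (List.getElem_cons_eraseIdx_perm hj).countP_eq (fun x => decide (x < a))
        rw [← this, List.countP_cons]
        simp
      simp only [List.eraseIdx_cons_succ, inversions, List.getElem_cons_succ, List.countP_cons,
        decide_eq_true_eq]
      rcases lt_or_gt_of_ne hne with h | h
      · refine ⟨m, ?_⟩
        simp only [h, h.not_gt, if_true, if_false] at hc ⊢
        omega
      · refine ⟨m, ?_⟩
        simp only [h, h.not_gt, if_true, if_false] at hc ⊢
        omega

variable (R : Type u) [CommRing R]

/-- The projection sending a sequence to the sign of the permutation that sorts it, times its
underlying set. -/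
def projection : (List V →₀ R) →ₗ[R] (Finset V →₀ R) :=
  Finsupp.linearCombination R fun σ => (-1 : R) ^ inversions σ • Finsupp.single σ.toFinset 1

theorem projection_single (σ : List V) :
    projection R (Finsupp.single σ 1) =
      (-1 : R) ^ inversions σ • Finsupp.single σ.toFinset 1 := by
  simp [projection]

theorem boundary_projection (σ : List V) (hσ : σ.Nodup) :
    boundary R (projection R (Finsupp.single σ 1)) =
      projection R (directedBoundary R (Finsupp.single σ 1)) := by
  rw [projection_single, map_smul, boundary_single, directedBoundary_single, map_sum,
    Finset.smul_sum]
  have hsum : ∀ f : V → (Finset V →₀ R), ∑ v ∈ σ.toFinset, f v =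
      ∑ i : Fin σ.length, f σ[i] := by
    intro f
    rw [List.sum_toFinset f hσ, ← List.sum_ofFn]
    exact congrArg List.sum (List.ofFn_getElem_eq_map σ f).symm
  rw [hsum, Finset.sum_range]
  refine Finset.sum_congr rfl fun i _ => ?_
  rw [map_smul, projection_single, smul_smul, smul_smul, ← pow_add, ← pow_add]
  have h1 : (σ.toFinset.filter (· < σ[i])).card = σ.countP (· < σ[i]) := by
    rw [List.countP_eq_length_filter, ← List.toFinset_card_of_nodup (hσ.filter _),
      List.toFinset_filter]
    simp
  have h2 : σ.toFinset.erase σ[i] = (σ.eraseIdx i).toFinset := by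
    ext w
    rw [Finset.mem_erase, List.mem_toFinset, List.mem_toFinset,
      ← hσ.erase_getElem i.1 i.2, hσ.mem_erase_iff]
    rfl
  obtain ⟨m, hm⟩ := inversions_eraseIdx σ hσ i.1 i.2
  rw [h1, h2]
  congr 1
  have hm' : inversions σ + σ.countP (fun x => decide (x < σ[i])) =
      i + inversions (σ.eraseIdx i) + 2 * m := hm
  rw [hm', pow_add _ _ (2 * m), pow_mul]
  simp

variable {R}

/-- The chain map from a directed simplicial complex onto its underlying simplicial complex. -/
def projectionMap {K : DirectedComplex V} {L : PreAbstractSimplicialComplex V}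
    (h : K.underlying = L) : K.chains R ⟶ chains R L :=
  gradedMap (projection R)
    (fun k => map_mem_of_supported _ _ _ (by
      rintro σ ⟨hl, hσ⟩
      rw [projection_single]
      refine Submodule.smul_mem _ _ (Finsupp.single_mem_supported R 1 ?_)
      rcases hσ with rfl | hσ
      · exact ⟨by simpa using hl, Or.inl rfl⟩
      · refine ⟨by rw [List.toFinset_card_of_nodup (K.nodup σ hσ), hl], Or.inr ?_⟩
        rw [← h]
        exact ⟨σ, hσ, rfl⟩))
    (fun k => eq_of_supported (boundary R ∘ₗ projection R) (projection R ∘ₗ directedBoundary R) _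
      (by
        rintro σ ⟨hl, hσ⟩
        refine boundary_projection R σ ?_
        rcases hσ with rfl | hσ
        · exact List.nodup_nil
        · exact K.nodup σ hσ))

end Projection

/-! ### Cross products and Künneth sequences -/

section Represents

variable {R : Type u} [CommRing R] {A : Type u} [AddCommGroup A] [Module R A]
  {C : ℕ → Submodule R A} {D : A →ₗ[R] A} {hC : ∀ k, ∀ x ∈ C (k + 1), D x ∈ C k}
  {hD : ∀ x, D (D x) = 0}

/-- The chain underlying an element of a graded piece of the complex. -/
def gradedVal (n : ℕ) (x : (gradedComplex R C D hC hD).X n) : A :=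
  Subtype.val (p := fun a => a ∈ C n) x

/-- The chain `z` is a cycle of degree `n` in the complex and its homology class is `c`. -/
def GradedRepresents (n : ℕ) (z : A) (c : (gradedComplex R C D hC hD).homology n) : Prop :=
  ∃ w : (gradedComplex R C D hC hD).cycles n,
    gradedVal n (((gradedComplex R C D hC hD).iCycles n).hom w) = z ∧
      ((gradedComplex R C D hC hD).homologyπ n).hom w = c

end Represents

section Representing

variable {R : Type u} [CommRing R] {V : Type u}

/-- `z` is a cycle of the directed complex `K` with homology class `c`. -/
def DirectedComplex.Represents (K : DirectedComplex V) (n : ℕ) (z : List V →₀ R)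
    (c : (K.chains R).homology n) : Prop :=
  GradedRepresents (C := K.chainModule R) n z c

/-- `z` is a cycle of the simplicial complex `K` with homology class `c`. -/
def Represents [LinearOrder V] (K : PreAbstractSimplicialComplex V) (n : ℕ) (z : Finset V →₀ R)
    (c : (chains R K).homology n) : Prop :=
  GradedRepresents (C := chainModule R K) n z c

/-- The bilinear extension of the concatenation of sequences. -/
def listProduct {V' : Type u} (x : List V →₀ R) (y : List V' →₀ R) : List (V ⊕ₗ V') →₀ R :=
  x.sum fun σ a => y.sum fun τ b => Finsupp.single (joinList σ τ) (a * b)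

/-- The bilinear extension of the disjoint union of finite sets. -/
def finsetProduct {V' : Type u} (x : Finset V →₀ R) (y : Finset V' →₀ R) :
    Finset (V ⊕ₗ V') →₀ R :=
  x.sum fun σ a => y.sum fun τ b => Finsupp.single (joinFinset σ τ) (a * b)

end Representing

section Kunneth

variable {R : Type u} [CommRing R]

/-- `⨁_{p + q = n} H_p(C) ⊗ H_q(D)`. -/
abbrev TensorPart (C D : ChainComplex (ModuleCat.{u} R) ℕ) (n : ℕ) : Type u :=
  ⨁ p : {p : ℕ × ℕ // p.1 + p.2 = n}, (C.homology p.1.1 ⊗[R] D.homology p.1.2)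

/-- `⨁_{p + q + 1 = n} Tor_1(H_p(C), H_q(D))`. -/
abbrev TorPart (C D : ChainComplex (ModuleCat.{u} R) ℕ) (n : ℕ) : Type u :=
  ⨁ p : {p : ℕ × ℕ // p.1 + p.2 + 1 = n},
    ((Tor (ModuleCat.{u} R) 1).obj (C.homology p.1.1)).obj (D.homology p.1.2)

/-- The map `⨁ f_* ⊗ g_*` induced by chain maps `f` and `g`. -/
def tensorPartMap {C C' D D' : ChainComplex (ModuleCat.{u} R) ℕ} (f : C ⟶ C') (g : D ⟶ D')
    (n : ℕ) : TensorPart C D n →ₗ[R] TensorPart C' D' n :=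
  DirectSum.lmap fun p => TensorProduct.map (HomologicalComplex.homologyMap f p.1.1).hom
    (HomologicalComplex.homologyMap g p.1.2).hom

/-- The map `⨁ Tor_1(f_*, g_*)` induced by chain maps `f` and `g`. -/
def torPartMap {C C' D D' : ChainComplex (ModuleCat.{u} R) ℕ} (f : C ⟶ C') (g : D ⟶ D')
    (n : ℕ) : TorPart C D n →ₗ[R] TorPart C' D' n :=
  DirectSum.lmap fun p =>
    (((Tor (ModuleCat.{u} R) 1).map (HomologicalComplex.homologyMap f p.1.1)).app _ ≫
      ((Tor (ModuleCat.{u} R) 1).obj _).map (HomologicalComplex.homologyMap g p.1.2)).hom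

/-- The map `f_*` on degree `n` homology. -/
def hMap {C D : ChainComplex (ModuleCat.{u} R) ℕ} (f : C ⟶ D) (n : ℕ) :
    C.homology n →ₗ[R] D.homology n :=
  (HomologicalComplex.homologyMap f n).hom

/-- A short exact sequence
`0 → ⨁_{p+q=n} H_p(C) ⊗ H_q(D) → H_n(E) → ⨁_{p+q+1=n} Tor_1(H_p(C), H_q(D)) → 0`. -/
structure KunnethSequence (C D E : ChainComplex (ModuleCat.{u} R) ℕ) (n : ℕ) where
  cross : TensorPart C D n →ₗ[R] E.homology n
  toTor : E.homology n →ₗ[R] TorPart C D n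
  injective : Function.Injective cross
  exact : Function.Exact cross toTor
  surjective : Function.Surjective toTor

/-- The chain map `π` from the directed independence complex to the independence complex. -/
def indProjection (R : Type u) [CommRing R] {V : Type u} [LinearOrder V] (G : SimpleGraph V) :
    (directedInd G).chains R ⟶ chains R (ind G) :=
  projectionMap (underlying_directedInd G)

/-- The chain map `π` from the join of the directed independence complexes to the independence
complex of the disjoint union. -/
def joinProjection (R : Type u) [CommRing R] {V V' : Type u} [LinearOrder V] [LinearOrder V']
    (G : SimpleGraph V) (G' : SimpleGraph V') :
    ((directedInd G).join (directedInd G')).chains R ⟶ chains R (ind (disjointUnion G G')) :=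
  projectionMap (underlying_join_directedInd G G')

/-- A commutative diagram whose rows are Künneth short exact sequences, for the directed and the
undirected independence complexes, and whose vertical maps are induced by the projections `π`. The
first map of each row sends `[x] ⊗ [y]` to the class of the join `x * y`. Degree `n` of the
complexes below is the span of the simplices with `n` vertices. -/
structure KunnethDiagram (R : Type u) [CommRing R] {V V' : Type u} [LinearOrder V] [LinearOrder V']
    (G : SimpleGraph V) (G' : SimpleGraph V') (n : ℕ) where
  top : KunnethSequence ((directedInd G).chains R) ((directedInd G').chains R)
    (((directedInd G).join (directedInd G')).chains R) n
  bot : KunnethSequence (chains R (ind G)) (chains R (ind G'))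
    (chains R (ind (disjointUnion G G'))) n
  top_cross : ∀ (p : {p : ℕ × ℕ // p.1 + p.2 = n}) (x : List V →₀ R) (y : List V' →₀ R)
    (ξ : ((directedInd G).chains R).homology p.1.1)
    (η : ((directedInd G').chains R).homology p.1.2),
    (directedInd G).Represents p.1.1 x ξ → (directedInd G').Represents p.1.2 y η →
    ((directedInd G).join (directedInd G')).Represents n (listProduct x y)
      (top.cross (DirectSum.lof R _ _ p (ξ ⊗ₜ[R] η)))
  bot_cross : ∀ (p : {p : ℕ × ℕ // p.1 + p.2 = n}) (x : Finset V →₀ R) (y : Finset V' →₀ R)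
    (ξ : (chains R (ind G)).homology p.1.1) (η : (chains R (ind G')).homology p.1.2),
    Represents (ind G) p.1.1 x ξ → Represents (ind G') p.1.2 y η →
    Represents (ind (disjointUnion G G')) n (finsetProduct x y)
      (bot.cross (DirectSum.lof R _ _ p (ξ ⊗ₜ[R] η)))
  comm_cross : hMap (joinProjection R G G') n ∘ₗ top.cross =
    bot.cross ∘ₗ tensorPartMap (indProjection R G) (indProjection R G') n
  comm_tor : torPartMap (indProjection R G) (indProjection R G') n ∘ₗ top.toTor =
    bot.toTor ∘ₗ hMap (joinProjection R G G') n

end Kunneth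

/-! ### Vertex filtrations and functoriality -/

section Functoriality

variable {V V' W W' : Type u}

theorem directedInd_map {G : SimpleGraph V} {H : SimpleGraph W} {φ : V → W}
    (hφ : Function.Injective φ) (h : H.comap φ = G) :
    ∀ σ ∈ (directedInd G).faces, σ.map φ ∈ (directedInd H).faces := by
  rintro σ ⟨hne, hσ⟩
  refine ⟨by simpa using hne, List.pairwise_map.2 (hσ.imp ?_)⟩
  intro u v huv
  subst h
  exact ⟨fun e => huv.1 (hφ e), huv.2⟩

theorem ind_map {G : SimpleGraph V} {H : SimpleGraph W} (φ : V ↪ W) (h : H.comap φ = G) :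
    ∀ s ∈ (ind G).faces, s.map φ ∈ (ind H).faces := by
  rintro s ⟨hne, hs⟩
  refine ⟨hne.map, ?_⟩
  subst h
  intro a ha b hb hab hadj
  obtain ⟨u, hu, rfl⟩ := Finset.mem_map.1 (Finset.mem_coe.1 ha)
  obtain ⟨v, hv, rfl⟩ := Finset.mem_map.1 (Finset.mem_coe.1 hb)
  exact hs (Finset.mem_coe.2 hu) (Finset.mem_coe.2 hv) (fun e => hab (by rw [e])) hadj

variable [LinearOrder V] [LinearOrder V'] [LinearOrder W] [LinearOrder W']

/-- The map of disjoint unions given by two order embeddings. -/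
def joinEmbedding (φ : V ↪o W) (ψ : V' ↪o W') : V ⊕ₗ V' ↪o W ⊕ₗ W' :=
  OrderEmbedding.ofStrictMono (fun x => toLex (Sum.map φ ψ (ofLex x))) (by
    intro x y hxy
    induction x using Lex.rec with | h x => ?_
    induction y using Lex.rec with | h y => ?_
    rcases x with u | u <;> rcases y with v | v <;>
      simp at hxy ⊢ <;> exact hxy)

theorem joinEmbedding_inlₗ (φ : V ↪o W) (ψ : V' ↪o W') (v : V) :
    joinEmbedding φ ψ (Sum.inlₗ v) = Sum.inlₗ (φ v) := rfl

theorem joinEmbedding_inrₗ (φ : V ↪o W) (ψ : V' ↪o W') (v : V') :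
    joinEmbedding φ ψ (Sum.inrₗ v) = Sum.inrₗ (ψ v) := rfl

theorem map_joinList (φ : V ↪o W) (ψ : V' ↪o W') (σ : List V) (τ : List V') :
    (joinList σ τ).map (joinEmbedding φ ψ) = joinList (σ.map φ) (τ.map ψ) := by
  simp only [joinList, List.map_append, List.map_map]
  congr 1

theorem join_map {K : DirectedComplex V} {K' : DirectedComplex V'} {L : DirectedComplex W}
    {L' : DirectedComplex W'} (φ : V ↪o W) (ψ : V' ↪o W')
    (h : ∀ σ ∈ K.faces, σ.map φ ∈ L.faces) (h' : ∀ σ ∈ K'.faces, σ.map ψ ∈ L'.faces) :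
    ∀ ρ ∈ (K.join K').faces, ρ.map (joinEmbedding φ ψ) ∈ (L.join L').faces := by
  rintro ρ (⟨σ, hσ, rfl⟩ | ⟨τ, hτ, rfl⟩ | ⟨σ, hσ, τ, hτ, rfl⟩) <;> rw [map_joinList]
  · exact Or.inl ⟨_, h σ hσ, rfl⟩
  · exact Or.inr (Or.inl ⟨_, h' τ hτ, rfl⟩)
  · exact Or.inr (Or.inr ⟨_, h σ hσ, _, h' τ hτ, rfl⟩)

theorem comap_joinEmbedding {G : SimpleGraph V} {G' : SimpleGraph V'} {H : SimpleGraph W}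
    {H' : SimpleGraph W'} {φ : V ↪o W} {ψ : V' ↪o W'} (h : H.comap φ = G) (h' : H'.comap ψ = G') :
    (disjointUnion H H').comap (joinEmbedding φ ψ) = disjointUnion G G' := by
  subst h h'
  ext x y
  induction x using Lex.rec with | h x => ?_
  induction y using Lex.rec with | h y => ?_
  rcases x with u | u <;> rcases y with v | v <;> rfl

variable (R : Type u) [CommRing R]

/-- The chain map of directed independence complexes induced by an order-preserving embedding onto
an induced subgraph. -/
def directedIndMap {G : SimpleGraph V} {H : SimpleGraph W} (φ : V ↪o W) (h : H.comap φ = G) :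
    (directedInd G).chains R ⟶ (directedInd H).chains R :=
  DirectedComplex.chainMap φ (directedInd_map φ.injective h)

/-- The chain map of independence complexes induced by an order-preserving embedding onto an
induced subgraph. -/
def indMap {G : SimpleGraph V} {H : SimpleGraph W} (φ : V ↪o W) (h : H.comap φ = G) :
    chains R (ind G) ⟶ chains R (ind H) :=
  chainMap φ (ind_map φ.toEmbedding h)

/-- The induced chain map of joins of directed independence complexes. -/
def directedJoinMap {G : SimpleGraph V} {G' : SimpleGraph V'} {H : SimpleGraph W}
    {H' : SimpleGraph W'} (φ : V ↪o W) (ψ : V' ↪o W') (h : H.comap φ = G) (h' : H'.comap ψ = G') :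
    ((directedInd G).join (directedInd G')).chains R ⟶
      ((directedInd H).join (directedInd H')).chains R :=
  DirectedComplex.chainMap (joinEmbedding φ ψ)
    (join_map φ ψ (directedInd_map φ.injective h) (directedInd_map ψ.injective h'))

variable {R}

/-- The maps induced by inclusions of induced subgraphs `G ⊆ H` and `G' ⊆ H'` form a morphism
between the two Künneth diagrams, i.e. all squares of the resulting three-dimensional diagram
commute. -/
structure KunnethDiagram.Natural {G : SimpleGraph V} {G' : SimpleGraph V'} {H : SimpleGraph W}
    {H' : SimpleGraph W'} {n : ℕ} (D₁ : KunnethDiagram R G G' n) (D₂ : KunnethDiagram R H H' n)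
    (φ : V ↪o W) (ψ : V' ↪o W') (h : H.comap φ = G) (h' : H'.comap ψ = G') : Prop where
  top_cross : hMap (directedJoinMap R φ ψ h h') n ∘ₗ D₁.top.cross =
    D₂.top.cross ∘ₗ tensorPartMap (directedIndMap R φ h) (directedIndMap R ψ h') n
  top_tor : torPartMap (directedIndMap R φ h) (directedIndMap R ψ h') n ∘ₗ D₁.top.toTor =
    D₂.top.toTor ∘ₗ hMap (directedJoinMap R φ ψ h h') n
  bot_cross : hMap (indMap R (joinEmbedding φ ψ) (comap_joinEmbedding h h')) n ∘ₗ D₁.bot.cross =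
    D₂.bot.cross ∘ₗ tensorPartMap (indMap R φ h) (indMap R ψ h') n
  bot_tor : torPartMap (indMap R φ h) (indMap R ψ h') n ∘ₗ D₁.bot.toTor =
    D₂.bot.toTor ∘ₗ hMap (indMap R (joinEmbedding φ ψ) (comap_joinEmbedding h h')) n
  tensor_projection : tensorPartMap (indMap R φ h) (indMap R ψ h') n ∘ₗ
      tensorPartMap (indProjection R G) (indProjection R G') n =
    tensorPartMap (indProjection R H) (indProjection R H') n ∘ₗ
      tensorPartMap (directedIndMap R φ h) (directedIndMap R ψ h') n
  join_projection : hMap (indMap R (joinEmbedding φ ψ) (comap_joinEmbedding h h')) n ∘ₗ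
      hMap (joinProjection R G G') n =
    hMap (joinProjection R H H') n ∘ₗ hMap (directedJoinMap R φ ψ h h') n
  tor_projection : torPartMap (indMap R φ h) (indMap R ψ h') n ∘ₗ
      torPartMap (indProjection R G) (indProjection R G') n =
    torPartMap (indProjection R H) (indProjection R H') n ∘ₗ
      torPartMap (directedIndMap R φ h) (directedIndMap R ψ h') n

end Functoriality

/-- A filtration of the vertex set `V` indexed by the integers. -/
structure VertexFiltration (V : Type u) where
  sets : ℤ → Set V
  mono : Monotone sets
  iUnion_eq : ⋃ t, sets t = Set.univ

/-- The induced filtration of a graph: `G_t` has vertex set `V_t` and all the edges of `G` between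
vertices of `V_t`. -/
abbrev VertexFiltration.graph {V : Type u} (F : VertexFiltration V) (G : SimpleGraph V) (t : ℤ) :
    SimpleGraph (F.sets t) :=
  G.induce (F.sets t)

/-- The inclusion `V_s ⊆ V_t` for `s ≤ t`. -/
def VertexFiltration.incl {V : Type u} [LinearOrder V] (F : VertexFiltration V) {s t : ℤ}
    (h : s ≤ t) : F.sets s ↪o F.sets t :=
  Subtype.orderEmbedding fun _ hv => F.mono h hv

/-- The inclusion `V_t ⊆ V`. -/
def VertexFiltration.inclTop {V : Type u} [LinearOrder V] (F : VertexFiltration V) (t : ℤ) :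
    F.sets t ↪o V :=
  OrderEmbedding.subtype fun v => v ∈ F.sets t

theorem VertexFiltration.comap_incl {V : Type u} [LinearOrder V] (F : VertexFiltration V)
    (G : SimpleGraph V) {s t : ℤ} (h : s ≤ t) : (F.graph G t).comap (F.incl h) = F.graph G s :=
  rfl

theorem VertexFiltration.comap_inclTop {V : Type u} [LinearOrder V] (F : VertexFiltration V)
    (G : SimpleGraph V) (t : ℤ) : G.comap (F.inclTop t) = F.graph G t :=
  rfl

end IndKunneth

end

/-! Count vertices instead of dimensions and keep the empty simplex in degree 0. A simplex of a join
is then the same thing as a pair of simplices, possibly empty, one from each factor; degrees add,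
and because V precedes V' the boundary satisfies d(σ * τ) = dσ * τ + (-1)^|σ| σ * dτ. So the
augmented chains of the join are the tensor product of the augmented chains of the factors, with no
shift. This holds for sequences (`listPairing`) and for finite sets (`finsetPairing`), and
`BasisPairing.tensorModel` turns either pairing into a `TensorModel`. The shift by one in the
classical indexing by dimension comes only from the renumbering.

What remains is the algebraic Künneth theorem for complexes C, D of free modules over a principal
ideal domain. Write Z for cycles, B for boundaries and O for chains modulo boundaries. Submodules of
free modules are free (`free_submodule_finsupp`), so 0 → B_q → Z_q → H_q → 0 is a free resolution of
H_q(D), and Tor₁(H_p(C), H_q(D)) is the kernel of H_p ⊗ B_q → H_p ⊗ Z_q. By flatness it is also the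
kernel of O_p ⊗ B_q → O_p ⊗ Z_q (`mem_range_torEmbedding`). The first map of the sequence multiplies
cycles. The second takes a cycle of C ⊗ D, reads off its components in C_p ⊗ D_{q+1}, and applies
(class in O_p) ⊗ d; the result lies in the copy of Tor₁ inside O_p ⊗ B_q. Exactness is
`cross_injective`, `exact_cross_toTor` and `toTor_surjective`.

Neither map depends on a splitting: retractions of chains onto cycles occur only in proofs of
injectivity and membership. Hence every chain map compatible with the tensor decompositions commutes
with the whole sequence (`TensorModel.Compatible.cross_naturality`,
`TensorModel.Compatible.toTor_naturality`). Compatibility is checked on basis elements, by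
`BasisPairing.compatible`. For π it says that the inversions of a concatenation add up; for an
inclusion, that it acts on the two factors separately. Filtrations are the special case of
inclusions of induced subgraphs. -/

noncomputable section

namespace IndKunneth

/-! ### Submodules of free modules over a principal ideal domain -/

section PID

variable {R : Type*} [CommRing R] [IsDomain R] [IsPrincipalIdealRing R]

/-- Every submodule of a free module over a principal ideal domain is free, without any restriction
on the rank. -/
theorem free_submodule_finsupp {ι : Type*} (N : Submodule R (ι →₀ R)) : Module.Free R N := by
  classical
  -- Well-order the basis and argue with leading coefficients: I i is the ideal of i-th coefficients
  -- of the elements of N supported in indices ≤ i, and b i is an element realizing a generator of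
  -- it. The basis of N consists of those b i whose leading coefficient is nonzero.
  obtain ⟨_, _⟩ := exists_wellFoundedLT ι
  let L : ι → Submodule R (ι →₀ R) := fun i => N ⊓ Finsupp.supported R R (Set.Iic i)
  let I : ι → Ideal R := fun i => (L i).map (Finsupp.lapply i)
  have hgen : ∀ i, ∃ b ∈ L i, I i = Ideal.span {b i} := fun i => by
    obtain ⟨b, hb, hbi⟩ := Submodule.IsPrincipal.generator_mem (I i)
    refine ⟨b, hb, ?_⟩
    change Finsupp.lapply i b = _ at hbi
    rw [Finsupp.lapply_apply] at hbi
    rw [hbi, Ideal.span_singleton_generator]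
  choose b hbL hbI using hgen
  let J := {i // b i i ≠ 0}
  let v : J → N := fun j => ⟨b j.1, (hbL j.1).1⟩
  have hsupp : ∀ i k, i < k → b i k = 0 := fun i k hik => by
    by_contra h
    exact absurd ((hbL i).2 (Finsupp.mem_support_iff.2 h)) (by simpa using hik)
  have hinj : LinearIndependent R v := by
    refine (linearIndependent_iff (R := R) (v := v)).2 ?_
    intro c hc
    by_contra hne
    have hs : c.support.Nonempty := Finsupp.support_nonempty_iff.2 hne
    let m := c.support.max' hs
    have hm : m ∈ c.support := Finset.max'_mem _ _
    -- In the largest coordinate that occurs, only the term of index m contributes, since b j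
    -- vanishes beyond j.
    have h0 : ((Finsupp.linearCombination R v c : N) : ι →₀ R) m.1 = c m * b m.1 m.1 := by
      rw [Finsupp.linearCombination_apply, Finsupp.sum, Submodule.coe_sum, Finsupp.finsetSum_apply,
        Finset.sum_eq_single_of_mem m hm]
      · simp [v]
      · intro j hj hjm
        have : j.1 < m.1 := lt_of_le_of_ne (Finset.le_max' _ _ hj) (fun h => hjm (Subtype.ext h))
        simp [v, hsupp _ _ this]
    rw [hc] at h0
    exact mul_ne_zero (Finsupp.mem_support_iff.1 hm) m.2 (by simpa using h0.symm)
  -- Well-founded induction on a bound i of the support: subtracting a multiple of b i kills the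
  -- i-th coefficient, and the largest index left in the finite support is a smaller bound.
  have hspan : ∀ i, ∀ x (hx : x ∈ N), (∀ k ∈ x.support, k ≤ i) →
      (⟨x, hx⟩ : N) ∈ Submodule.span R (Set.range v) := by
    intro i
    induction i using WellFoundedLT.induction with | ind i ih => ?_
    intro x hx hxi
    have hxL : x ∈ L i := ⟨hx, fun k hk => hxi k hk⟩
    have hxI : x i ∈ I i := ⟨x, hxL, rfl⟩
    rw [hbI, Ideal.mem_span_singleton'] at hxI
    obtain ⟨r, hr⟩ := hxI
    have hy : x - r • b i ∈ N := N.sub_mem hx (N.smul_mem r (hbL i).1)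
    have hylt : ∀ k ∈ (x - r • b i).support, k < i := by
      intro k hk
      have hk' : k ≤ i := by
        by_contra hki
        rw [not_le] at hki
        have h1 : x k = 0 := by
          by_contra h
          exact absurd (hxi k (Finsupp.mem_support_iff.2 h)) (not_le.2 hki)
        simp [h1, hsupp i k hki] at hk
      refine lt_of_le_of_ne hk' ?_
      rintro rfl
      simp [hr] at hk
    have step : ∀ y (hy : y ∈ N), (∀ k ∈ y.support, k < i) →
        (⟨y, hy⟩ : N) ∈ Submodule.span R (Set.range v) := by
      intro y hy hlt
      rcases y.support.eq_empty_or_nonempty with h | h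
      · obtain rfl := Finsupp.support_eq_empty.1 h
        exact zero_mem _
      · exact ih _ (hlt _ (Finset.max'_mem _ h)) _ hy fun k hk => Finset.le_max' _ _ hk
    have hy' := step _ hy hylt
    -- If b i has leading coefficient zero it is not in the family, but then its support lies
    -- strictly below i and the induction hypothesis covers it.
    have hb : (⟨r • b i, N.smul_mem r (hbL i).1⟩ : N) ∈ Submodule.span R (Set.range v) := by
      by_cases h : b i i = 0
      · refine step _ _ fun k hk => lt_of_le_of_ne (((L i).smul_mem r (hbL i)).2 hk) ?_
        rintro rfl
        simp [h] at hk
      · exact Submodule.smul_mem _ r (Submodule.subset_span (Set.mem_range_self (⟨i, h⟩ : J)))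
    have : (⟨x, hx⟩ : N) = ⟨x - r • b i, hy⟩ + ⟨r • b i, N.smul_mem r (hbL i).1⟩ :=
      Subtype.ext (by simp)
    rw [this]
    exact add_mem hy' hb
  refine Module.Free.of_basis (Module.Basis.mk hinj ?_)
  rintro ⟨x, hx⟩ -
  rcases x.support.eq_empty_or_nonempty with h | h
  · obtain rfl := Finsupp.support_eq_empty.1 h
    exact zero_mem _
  · exact hspan (x.support.max' h) x hx fun k hk => Finset.le_max' _ _ hk

theorem free_of_injective {M N : Type*} [AddCommGroup M] [Module R M] [AddCommGroup N] [Module R N]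
    [Module.Free R M] (f : N →ₗ[R] M) (hf : Function.Injective f) : Module.Free R N := by
  let g := (Module.Free.chooseBasis R M).repr.toLinearMap ∘ₗ f
  have hg : Function.Injective g := (LinearEquiv.injective _).comp hf
  have := free_submodule_finsupp (LinearMap.range g)
  exact Module.Free.of_equiv (LinearEquiv.ofInjective g hg).symm

end PID

section TorPresentation
open Limits MonoidalCategory

/-! ### `Tor₁` from a two-term projective resolution -/

section DegreeOne

variable {A : Type*} [Category* A] [Abelian A]

/-- If the differential into degree `1` vanishes, the homology in degree `1` embeds into the chains
of degree `1`. -/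
def homologyOneι (K : ChainComplex A ℕ) (h : K.d 2 1 = 0) : K.homology 1 ⟶ K.X 1 :=
  K.homologyι 1 ≫ (K.pOpcyclesIso 2 1 (by simp) h).inv

theorem mono_homologyOneι (K : ChainComplex A ℕ) (h : K.d 2 1 = 0) : Mono (homologyOneι K h) := by
  unfold homologyOneι
  infer_instance

theorem homologyOneι_comp_d (K : ChainComplex A ℕ) (h : K.d 2 1 = 0) :
    homologyOneι K h ≫ K.d 1 0 = 0 := by
  rw [homologyOneι, ← K.p_fromOpcycles, Category.assoc, K.pOpcyclesIso_inv_hom_id_assoc,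
    K.homologyι_comp_fromOpcycles]

/-- Homology is always the kernel of the differential on chains modulo boundaries; here there are no
boundaries in degree 1 to divide by. -/
theorem homologyOneι_exact (K : ChainComplex A ℕ) (h : K.d 2 1 = 0) :
    (ShortComplex.mk _ _ (homologyOneι_comp_d K h)).Exact := by
  have h' : (ShortComplex.mk _ _ (K.homologyι_comp_fromOpcycles 1 0)).Exact :=
    ShortComplex.exact_of_f_is_kernel _ (K.homologyIsKernel 1 0 (by simp))
  refine ShortComplex.exact_of_iso ?_ h'
  exact ShortComplex.isoMk (Iso.refl _) (K.pOpcyclesIso 2 1 (by simp) h).symm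
    (Iso.refl _) (by simp [homologyOneι]) (by
      simp [Iso.inv_comp_eq])

theorem homologyOneι_naturality {K L : ChainComplex A ℕ} (hK : K.d 2 1 = 0) (hL : L.d 2 1 = 0)
    (φ : K ⟶ L) : HomologicalComplex.homologyMap φ 1 ≫ homologyOneι L hL =
      homologyOneι K hK ≫ φ.f 1 := by
  have : (K.pOpcyclesIso 2 1 (by simp) hK).inv ≫ φ.f 1 =
      HomologicalComplex.opcyclesMap φ 1 ≫ (L.pOpcyclesIso 2 1 (by simp) hL).inv := by
    rw [Iso.inv_comp_eq, ← Category.assoc, Iso.eq_comp_inv]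
    exact (HomologicalComplex.p_opcyclesMap φ 1).symm
  rw [homologyOneι, homologyOneι, Category.assoc, this,
    HomologicalComplex.homologyι_naturality_assoc]

variable {B : Type*} [Category* B] [Abelian B]

theorem map_d_two_one (F : B ⥤ A) [F.Additive] (K : ChainComplex B ℕ) (h : K.d 2 1 = 0) :
    ((F.mapHomologicalComplex _).obj K).d 2 1 = 0 :=
  (congrArg F.map h).trans (F.map_zero _ _)

variable [HasProjectiveResolutions B]

/-- The first left derived functor, as the homology of the complex obtained from a projective
resolution. -/
def leftDerivedOneIso (F : B ⥤ A) [F.Additive] {X : B} (P : ProjectiveResolution X) :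
    (F.leftDerived 1).obj X ≅ ((F.mapHomologicalComplex _).obj P.complex).homology 1 :=
  P.isoLeftDerivedObj F 1

theorem leftDerivedOneIso_naturality (F : B ⥤ A) [F.Additive] {X Y : B}
    (f : X ⟶ Y) {P : ProjectiveResolution X} {Q : ProjectiveResolution Y}
    (φ : P.complex ⟶ Q.complex) (comm : φ.f 0 ≫ Q.π.f 0 = P.π.f 0 ≫ f) :
    (F.leftDerived 1).map f ≫ (leftDerivedOneIso F Q).hom = (leftDerivedOneIso F P).hom ≫
      HomologicalComplex.homologyMap ((F.mapHomologicalComplex _).map φ) 1 :=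
  ProjectiveResolution.isoLeftDerivedObj_hom_naturality f P Q φ comm F 1

theorem leftDerivedOneIso_naturality_left {F G : B ⥤ A} [F.Additive] [G.Additive] (α : F ⟶ G)
    {X : B} (P : ProjectiveResolution X) :
    (NatTrans.leftDerived α 1).app X ≫ (leftDerivedOneIso G P).hom = (leftDerivedOneIso F P).hom ≫
      HomologicalComplex.homologyMap ((NatTrans.mapHomologicalComplex α _).app P.complex) 1 := by
  rw [← Iso.eq_comp_inv, Category.assoc]
  exact P.leftDerived_app_eq α 1

/-- The first left derived functor embeds into the chains of degree one for a projective resolution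
whose differential into degree `1` vanishes. -/
def leftDerivedOneι (F : B ⥤ A) [F.Additive] {X : B} (P : ProjectiveResolution X)
    (h : P.complex.d 2 1 = 0) :
    (F.leftDerived 1).obj X ⟶ ((F.mapHomologicalComplex _).obj P.complex).X 1 :=
  (leftDerivedOneIso F P).hom ≫ homologyOneι _ (map_d_two_one F _ h)

theorem mono_leftDerivedOneι (F : B ⥤ A) [F.Additive] {X : B} (P : ProjectiveResolution X)
    (h : P.complex.d 2 1 = 0) : Mono (leftDerivedOneι F P h) := by
  have := mono_homologyOneι _ (map_d_two_one F _ h)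
  exact mono_comp _ _

theorem leftDerivedOneι_comp_d (F : B ⥤ A) [F.Additive] {X : B} (P : ProjectiveResolution X)
    (h : P.complex.d 2 1 = 0) :
    leftDerivedOneι F P h ≫ ((F.mapHomologicalComplex _).obj P.complex).d 1 0 = 0 := by
  rw [leftDerivedOneι, Category.assoc, homologyOneι_comp_d, comp_zero]

theorem leftDerivedOneι_exact (F : B ⥤ A) [F.Additive] {X : B} (P : ProjectiveResolution X)
    (h : P.complex.d 2 1 = 0) : (ShortComplex.mk _ _ (leftDerivedOneι_comp_d F P h)).Exact := by
  refine ShortComplex.exact_of_iso ?_ (homologyOneι_exact _ (map_d_two_one F _ h))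
  refine ShortComplex.isoMk (leftDerivedOneIso F P).symm (Iso.refl _) (Iso.refl _) ?_ ?_
  · rw [Iso.symm_hom, Iso.inv_comp_eq]
    exact congrArg ((leftDerivedOneIso F P).hom ≫ ·)
      (Category.comp_id (homologyOneι _ (map_d_two_one F _ h))).symm
  · exact (Category.id_comp (((F.mapHomologicalComplex _).obj P.complex).d 1 0)).trans
      (Category.comp_id _).symm

/-- `Tor` puts its first argument into the functor X ⊗ − and derives in the second. Naturality in
both arguments therefore means naturality in the functor, through α, together with naturality in the
object, through a lift φ of f to the resolutions. -/
theorem leftDerivedOneι_naturality {F G : B ⥤ A} [F.Additive] [G.Additive] (α : F ⟶ G) {X Y : B}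
    (f : X ⟶ Y) {P : ProjectiveResolution X} {Q : ProjectiveResolution Y}
    (hP : P.complex.d 2 1 = 0) (hQ : Q.complex.d 2 1 = 0) (φ : P.complex ⟶ Q.complex)
    (comm : φ.f 0 ≫ Q.π.f 0 = P.π.f 0 ≫ f) :
    (NatTrans.leftDerived α 1).app X ≫ (G.leftDerived 1).map f ≫ leftDerivedOneι G Q hQ =
      leftDerivedOneι F P hP ≫ ((NatTrans.mapHomologicalComplex α _).app P.complex).f 1 ≫
        ((G.mapHomologicalComplex _).map φ).f 1 := by
  have h1 := leftDerivedOneIso_naturality G f φ comm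
  have h2 := leftDerivedOneIso_naturality_left α P
  have h3 := homologyOneι_naturality (map_d_two_one F _ hP) (map_d_two_one G _ hP)
    ((NatTrans.mapHomologicalComplex α _).app P.complex)
  have h4 := homologyOneι_naturality (map_d_two_one G _ hP) (map_d_two_one G _ hQ)
    ((G.mapHomologicalComplex _).map φ)
  rw [leftDerivedOneι, leftDerivedOneι, reassoc_of% h1, reassoc_of% h2, h4, reassoc_of% h3,
    Category.assoc]

end DegreeOne

/-! ### Two-term resolutions of modules and the resulting description of `Tor₁` -/

variable {R : Type u} [CommRing R]

/-- The two-term complex `X₁ ⟶ X₂` of a short complex `X₁ ⟶ X₂ ⟶ X₃`. -/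
def twoTerm (S : ShortComplex (ModuleCat.{u} R)) : ChainComplex (ModuleCat.{u} R) ℕ :=
  ((ChainComplex.single₀ _).obj S.X₁).augment S.f zero_comp

/-- The map of two-term complexes induced by a map of short complexes. -/
def twoTermMap {S T : ShortComplex (ModuleCat.{u} R)} (φ : S ⟶ T) : twoTerm S ⟶ twoTerm T where
  f
    | 0 => φ.τ₂
    | n + 1 => ((ChainComplex.single₀ _).map φ.τ₁).f n
  comm' := by
    rintro i j hij
    obtain rfl : j + 1 = i := hij
    cases j with
    | zero => exact φ.comm₁₂
    | succ j => exact ((ChainComplex.single₀ _).map φ.τ₁).comm (j + 1) j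

theorem twoTerm_isZero (S : ShortComplex (ModuleCat.{u} R)) (n : ℕ) :
    IsZero ((twoTerm S).X (n + 2)) :=
  HomologicalComplex.isZero_single_obj_X (ComplexShape.down ℕ) 0 S.X₁ (n + 1) (by simp)

theorem twoTerm_d_two_one (S : ShortComplex (ModuleCat.{u} R)) : (twoTerm S).d 2 1 = 0 := rfl

/-- Exactness in degree 1 is injectivity of `S.f`, because the incoming differential is zero; in
higher degrees the modules themselves are zero. -/
theorem twoTerm_exactAt (S : ShortComplex (ModuleCat.{u} R)) (hS : S.ShortExact) (n : ℕ) :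
    (twoTerm S).ExactAt (n + 1) := by
  cases n with
  | zero =>
    rw [HomologicalComplex.exactAt_iff' _ 2 1 0 (by simp) (by simp)]
    have := hS.mono_f
    refine (ShortComplex.exact_iff_mono _ ?_).2 ?_
    · rfl
    · exact this
  | succ n => exact HomologicalComplex.ExactAt.of_isZero (twoTerm_isZero S n)

/-- A short exact sequence `0 ⟶ X₁ ⟶ X₂ ⟶ X₃ ⟶ 0` with `X₁` and `X₂` projective, as a projective
resolution of `X₃`. -/
def twoTermResolution (S : ShortComplex (ModuleCat.{u} R)) (hS : S.ShortExact)
    [Projective S.X₁] [Projective S.X₂] : ProjectiveResolution S.X₃ where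
  complex := twoTerm S
  projective n := by
    obtain _ | _ | n := n
    · assumption
    · assumption
    · exact Projective.of_iso (twoTerm_isZero S n).isoZero.symm inferInstance
  π := (ChainComplex.toSingle₀Equiv _ _).symm ⟨S.g, S.zero⟩
  quasiIso := ⟨fun n => by
    cases n
    · rw [ChainComplex.quasiIsoAt₀_iff, ShortComplex.quasiIso_iff_of_zeros']
      · have := hS.epi_g
        refine (ShortComplex.exact_and_epi_g_iff_of_iso (S₂ := S) ?_).2 ⟨hS.exact, hS.epi_g⟩
        refine ShortComplex.isoMk (Iso.refl _) (Iso.refl _) (Iso.refl _) ?_ ?_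
        · exact (Category.id_comp _).trans (Category.comp_id _).symm
        · refine (Category.id_comp _).trans (Eq.trans ?_ (Category.comp_id _).symm)
          exact (ChainComplex.toSingle₀Equiv_symm_apply_f_zero (C := twoTerm S) S.g S.zero).symm
      all_goals rfl
    · rw [quasiIsoAt_iff_exactAt']
      · exact twoTerm_exactAt S hS _
      · apply ChainComplex.exactAt_succ_single_obj⟩

theorem twoTermResolution_π_f_zero (S : ShortComplex (ModuleCat.{u} R)) (hS : S.ShortExact)
    [Projective S.X₁] [Projective S.X₂] : (twoTermResolution S hS).π.f 0 = S.g :=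
  ChainComplex.toSingle₀Equiv_symm_apply_f_zero (C := twoTerm S) S.g S.zero

/-- The embedding of `Tor₁(X, S.X₃)` into `X ⊗ S.X₁` for a projective presentation
`0 ⟶ S.X₁ ⟶ S.X₂ ⟶ S.X₃ ⟶ 0`. -/
def torι (X : ModuleCat.{u} R) (S : ShortComplex (ModuleCat.{u} R)) (hS : S.ShortExact)
    [Projective S.X₁] [Projective S.X₂] :
    ((Tor (ModuleCat.{u} R) 1).obj X).obj S.X₃ →ₗ[R] X ⊗[R] S.X₁ :=
  (leftDerivedOneι ((tensoringLeft (ModuleCat.{u} R)).obj X) (twoTermResolution S hS)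
    (twoTerm_d_two_one S)).hom

theorem torι_injective (X : ModuleCat.{u} R) (S : ShortComplex (ModuleCat.{u} R))
    (hS : S.ShortExact) [Projective S.X₁] [Projective S.X₂] :
    Function.Injective (torι X S hS) :=
  (ModuleCat.mono_iff_injective _).1 (mono_leftDerivedOneι _ _ _)

theorem torι_exact (X : ModuleCat.{u} R) (S : ShortComplex (ModuleCat.{u} R))
    (hS : S.ShortExact) [Projective S.X₁] [Projective S.X₂] :
    Function.Exact (torι X S hS) (S.f.hom.lTensor X) :=
  (ShortComplex.ShortExact.moduleCat_exact_iff_function_exact _).1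
    (leftDerivedOneι_exact ((tensoringLeft (ModuleCat.{u} R)).obj X) (twoTermResolution S hS)
      (twoTerm_d_two_one S))

/-- The map of two-term complexes given by φ lifts `φ.τ₃` to the resolutions, and its degree 1 part
is `φ.τ₁`. -/
theorem torι_naturality {X Y : ModuleCat.{u} R} (f : X ⟶ Y)
    {S T : ShortComplex (ModuleCat.{u} R)} (φ : S ⟶ T) (hS : S.ShortExact) (hT : T.ShortExact)
    [Projective S.X₁] [Projective S.X₂] [Projective T.X₁] [Projective T.X₂] :
    torι Y T hT ∘ₗ (((Tor (ModuleCat.{u} R) 1).map f).app S.X₃ ≫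
      ((Tor (ModuleCat.{u} R) 1).obj Y).map φ.τ₃).hom =
      TensorProduct.map f.hom φ.τ₁.hom ∘ₗ torι X S hS := by
  have h := leftDerivedOneι_naturality ((tensoringLeft (ModuleCat.{u} R)).map f) φ.τ₃
    (P := twoTermResolution S hS) (Q := twoTermResolution T hT) (twoTerm_d_two_one S)
    (twoTerm_d_two_one T) (twoTermMap φ) (by
      rw [twoTermResolution_π_f_zero, twoTermResolution_π_f_zero]
      exact φ.comm₂₃)
  have h' := congrArg ModuleCat.Hom.hom h
  refine Eq.trans (Eq.trans ?_ h') ?_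
  · rfl
  -- Applying f first and `φ.τ₁` second is the tensor product of the two maps, as seen on pure
  -- tensors.
  · change (_ ∘ₗ _) ∘ₗ _ = _
    congr 1
    refine TensorProduct.ext' fun x y => ?_
    rfl

end TorPresentation

/-! ### Lifting and descending linear maps -/

section LiftDesc

variable {R A B M : Type*} [CommRing R] [AddCommGroup A] [Module R A] [AddCommGroup B] [Module R B]
  [AddCommGroup M] [Module R M]

/-- The factorization of `g` through the injective map `i`. -/
def liftInjective (i : A →ₗ[R] B) (hi : Function.Injective i) (g : M →ₗ[R] B)
    (h : ∀ m, ∃ a, i a = g m) : M →ₗ[R] A :=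
  (LinearEquiv.ofInjective i hi).symm.toLinearMap ∘ₗ g.codRestrict (LinearMap.range i) h

theorem apply_liftInjective (i : A →ₗ[R] B) (hi : Function.Injective i) (g : M →ₗ[R] B)
    (h : ∀ m, ∃ a, i a = g m) (m : M) : i (liftInjective i hi g h m) = g m := by
  have := (LinearEquiv.ofInjective i hi).apply_symm_apply (g.codRestrict (LinearMap.range i) h m)
  exact congrArg Subtype.val this

/-- The factorization of `g` through the surjective map `s`. -/
def descSurjective (s : A →ₗ[R] B) (hs : Function.Surjective s) (g : A →ₗ[R] M)
    (h : ∀ a, s a = 0 → g a = 0) : B →ₗ[R] M :=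
  (LinearMap.ker s).liftQ g h ∘ₗ (s.quotKerEquivOfSurjective hs).symm.toLinearMap

theorem descSurjective_apply (s : A →ₗ[R] B) (hs : Function.Surjective s) (g : A →ₗ[R] M)
    (h : ∀ a, s a = 0 → g a = 0) (a : A) : descSurjective s hs g h (s a) = g a := by
  have : (s.quotKerEquivOfSurjective hs).symm (s a) = (LinearMap.ker s).mkQ a := by
    rw [LinearEquiv.symm_apply_eq]
    rfl
  change (LinearMap.ker s).liftQ g h ((s.quotKerEquivOfSurjective hs).symm (s a)) = g a
  rw [this]
  exact Submodule.liftQ_apply _ _ _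

/-- Since only finitely many bidegrees have a given total degree, elements chosen separately in each
summand assemble into one element. -/
theorem exists_directSum {ι : Type*} [Finite ι] {N : ι → Type*} [∀ i, AddCommGroup (N i)]
    (F : ∀ i, N i) : ∃ x : ⨁ i, N i, ∀ i, x i = F i := by
  classical
  have := Fintype.ofFinite ι
  exact ⟨DFinsupp.equivFunOnFintype.symm F, fun i => rfl⟩

section TensorMaps

variable {A' B' M' N N' : Type*} [AddCommGroup A'] [Module R A'] [AddCommGroup B'] [Module R B']
  [AddCommGroup M'] [Module R M'] [AddCommGroup N] [Module R N] [AddCommGroup N'] [Module R N']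

theorem map_rTensor_apply (f : A →ₗ[R] B) (g : M →ₗ[R] N) (h : A' →ₗ[R] A) (x : A' ⊗[R] M) :
    TensorProduct.map f g (h.rTensor M x) = TensorProduct.map (f ∘ₗ h) g x :=
  LinearMap.congr_fun (LinearMap.map_comp_rTensor _ f g h) x

theorem map_lTensor_apply (f : A →ₗ[R] B) (g : M →ₗ[R] N) (h : M' →ₗ[R] M) (x : A ⊗[R] M') :
    TensorProduct.map f g (h.lTensor A x) = TensorProduct.map f (g ∘ₗ h) x :=
  LinearMap.congr_fun (LinearMap.map_comp_lTensor _ f g h) x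

theorem rTensor_map_apply (f : A →ₗ[R] B) (g : M →ₗ[R] N) (h : B →ₗ[R] B') (x : A ⊗[R] M) :
    h.rTensor N (TensorProduct.map f g x) = TensorProduct.map (h ∘ₗ f) g x :=
  LinearMap.congr_fun (LinearMap.rTensor_comp_map _ h f g) x

theorem lTensor_map_apply (f : A →ₗ[R] B) (g : M →ₗ[R] N) (h : N →ₗ[R] N') (x : A ⊗[R] M) :
    h.lTensor B (TensorProduct.map f g x) = TensorProduct.map f (h ∘ₗ g) x :=
  LinearMap.congr_fun (LinearMap.lTensor_comp_map _ h f g) x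

theorem map_map_apply (f : A →ₗ[R] B) (g : M →ₗ[R] N) (f' : B →ₗ[R] B') (g' : N →ₗ[R] N')
    (x : A ⊗[R] M) : TensorProduct.map f' g' (TensorProduct.map f g x) =
      TensorProduct.map (f' ∘ₗ f) (g' ∘ₗ g) x :=
  (LinearMap.congr_fun (TensorProduct.map_comp f' g' f g) x).symm

end TensorMaps

end LiftDesc

instance finite_antidiagonal_succ (k n : ℕ) : Finite {p : ℕ × ℕ // p.1 + p.2 + k = n} :=
  Finite.of_injective (β := Fin (n + 1) × Fin (n + 1))
    (fun p => (⟨p.1.1, by have := p.2; omega⟩, ⟨p.1.2, by have := p.2; omega⟩)) (by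
      rintro ⟨⟨a, b⟩, h⟩ ⟨⟨c, d⟩, h'⟩ e
      simp only [Prod.mk.injEq, Fin.mk.injEq] at e
      obtain ⟨rfl, rfl⟩ := e
      rfl)

instance finite_antidiagonal (n : ℕ) : Finite {p : ℕ × ℕ // p.1 + p.2 = n} :=
  finite_antidiagonal_succ 0 n

/-! ### Cycles, opcycles and homology of complexes of modules -/

section Elements

variable {R : Type u} [CommRing R] (K : ChainComplex (ModuleCat.{u} R) ℕ) (p : ℕ)

/-- The differential. -/
abbrev dX : K.X (p + 1) →ₗ[R] K.X p := (K.d (p + 1) p).hom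

/-- The inclusion of the cycles. -/
abbrev iZ : K.cycles p →ₗ[R] K.X p := (K.iCycles p).hom

/-- The differential as a map to the cycles. -/
abbrev tZ : K.X (p + 1) →ₗ[R] K.cycles p := (K.toCycles (p + 1) p).hom

/-- The class of a cycle. -/
abbrev πH : K.cycles p →ₗ[R] K.homology p := (K.homologyπ p).hom

/-- The projection to the chains modulo boundaries. -/
abbrev pO : K.X p →ₗ[R] K.opcycles p := (K.pOpcycles p).hom

/-- The inclusion of homology into the chains modulo boundaries. -/
abbrev ιH : K.homology p →ₗ[R] K.opcycles p := (K.homologyι p).hom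

/-- The differential on chains modulo boundaries. -/
abbrev fO : K.opcycles (p + 1) →ₗ[R] K.X p := (K.fromOpcycles (p + 1) p).hom

theorem iZ_injective : Function.Injective (iZ K p) :=
  (ModuleCat.mono_iff_injective _).1 inferInstance

theorem πH_surjective : Function.Surjective (πH K p) :=
  (ModuleCat.epi_iff_surjective _).1 inferInstance

theorem pO_surjective : Function.Surjective (pO K p) :=
  (ModuleCat.epi_iff_surjective _).1 inferInstance

theorem ιH_injective : Function.Injective (ιH K p) :=
  (ModuleCat.mono_iff_injective _).1 inferInstance

theorem iZ_comp_tZ : iZ K p ∘ₗ tZ K p = dX K p :=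
  congrArg ModuleCat.Hom.hom (K.toCycles_i (p + 1) p)

theorem iZ_tZ (x : K.X (p + 1)) : iZ K p (tZ K p x) = dX K p x :=
  LinearMap.congr_fun (iZ_comp_tZ K p) x

theorem ιH_comp_πH : ιH K p ∘ₗ πH K p = pO K p ∘ₗ iZ K p :=
  congrArg ModuleCat.Hom.hom (K.homology_π_ι p)

theorem exact_iZ_dX : Function.Exact (iZ K (p + 1)) (dX K p) :=
  (ShortComplex.ShortExact.moduleCat_exact_iff_function_exact _).1
    (ShortComplex.exact_of_f_is_kernel (.mk _ _ (K.iCycles_d (p + 1) p))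
      (K.cyclesIsKernel (p + 1) p (by simp)))

theorem exact_tZ_πH : Function.Exact (tZ K p) (πH K p) :=
  (ShortComplex.ShortExact.moduleCat_exact_iff_function_exact _).1
    (ShortComplex.exact_of_g_is_cokernel (.mk _ _ (K.toCycles_comp_homologyπ (p + 1) p))
      (K.homologyIsCokernel (p + 1) p (by simp)))

theorem exact_dX_pO : Function.Exact (dX K p) (pO K p) :=
  (ShortComplex.ShortExact.moduleCat_exact_iff_function_exact _).1
    (ShortComplex.exact_of_g_is_cokernel (.mk _ _ (K.d_pOpcycles (p + 1) p))
      (K.opcyclesIsCokernel (p + 1) p (by simp)))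

theorem exact_ιH_fO : Function.Exact (ιH K (p + 1)) (fO K p) :=
  (ShortComplex.ShortExact.moduleCat_exact_iff_function_exact _).1
    (ShortComplex.exact_of_f_is_kernel (.mk _ _ (K.homologyι_comp_fromOpcycles (p + 1) p))
      (K.homologyIsKernel (p + 1) p (by simp)))

/-- No differential leaves degree 0, so every chain there is a cycle. -/
theorem iZ_zero_surjective : Function.Surjective (iZ K 0) := by
  have := K.isIso_iCycles 0 0 (by simp) (K.shape _ _ (by simp))
  exact ((ModuleCat.epi_iff_surjective _).1 inferInstance)

/-- In degree 0 all chains are cycles, so homology is all of the chains modulo boundaries. -/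
theorem ιH_zero_surjective : Function.Surjective (ιH K 0) := by
  have := K.isIso_homologyι 0 0 (by simp) (K.shape _ _ (by simp))
  exact ((ModuleCat.epi_iff_surjective _).1 inferInstance)

theorem dX_comp_iZ : dX K p ∘ₗ iZ K (p + 1) = 0 := (exact_iZ_dX K p).linearMap_comp_eq_zero

theorem dX_iZ (x : K.cycles (p + 1)) : dX K p (iZ K (p + 1) x) = 0 :=
  LinearMap.congr_fun (dX_comp_iZ K p) x

theorem pO_comp_dX : pO K p ∘ₗ dX K p = 0 := (exact_dX_pO K p).linearMap_comp_eq_zero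

theorem πH_comp_tZ : πH K p ∘ₗ tZ K p = 0 := (exact_tZ_πH K p).linearMap_comp_eq_zero

theorem tZ_comp_iZ : tZ K p ∘ₗ iZ K (p + 1) = 0 := by
  refine LinearMap.ext fun x => iZ_injective K p ?_
  rw [LinearMap.comp_apply, LinearMap.zero_apply, map_zero, ← LinearMap.comp_apply, iZ_comp_tZ]
  exact LinearMap.congr_fun (dX_comp_iZ K p) x

/-- The boundaries, as a submodule of the cycles. -/
abbrev bdry : Submodule R (K.cycles p) := LinearMap.range (tZ K p)

/-- The differential as a map to the boundaries. -/
abbrev bB : K.X (p + 1) →ₗ[R] bdry K p := (tZ K p).rangeRestrict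

/-- The inclusion of the boundaries into the cycles. -/
abbrev jB : bdry K p →ₗ[R] K.cycles p := (bdry K p).subtype

theorem bB_surjective : Function.Surjective (bB K p) := (tZ K p).surjective_rangeRestrict

theorem jB_comp_bB : jB K p ∘ₗ bB K p = tZ K p := rfl

theorem bB_comp_iZ : bB K p ∘ₗ iZ K (p + 1) = 0 :=
  LinearMap.ext fun x => Subtype.ext (LinearMap.congr_fun (tZ_comp_iZ K p) x)

theorem exact_iZ_bB : Function.Exact (iZ K (p + 1)) (bB K p) := by
  intro x
  rw [← exact_iZ_dX K p x, ← iZ_comp_tZ, LinearMap.comp_apply, map_eq_zero_iff _ (iZ_injective K p)]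
  exact Subtype.ext_iff

/-- The presentation of homology by boundaries and cycles. -/
def bdrySequence : ShortComplex (ModuleCat.{u} R) :=
  .mk (X₁ := ModuleCat.of R (bdry K p)) (ModuleCat.ofHom (jB K p)) (K.homologyπ p) (by
    refine ModuleCat.hom_ext (LinearMap.ext ?_)
    rintro ⟨_, x, rfl⟩
    exact LinearMap.congr_fun (πH_comp_tZ K p) x)

/-- When K consists of free modules over a principal ideal domain, both left terms are free and this
is the resolution of homology from which `torBdry` reads off `Tor₁`. -/
theorem bdrySequence_shortExact : (bdrySequence K p).ShortExact where
  exact := (ShortComplex.ShortExact.moduleCat_exact_iff_function_exact _).2 (by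
    intro x
    refine (exact_tZ_πH K p x).trans ?_
    constructor
    · rintro h
      exact ⟨⟨x, h⟩, rfl⟩
    · rintro ⟨y, rfl⟩
      exact y.2)
  mono_f := (ModuleCat.mono_iff_injective _).2 (Submodule.injective_subtype _)
  epi_g := inferInstanceAs (Epi (K.homologyπ p))

variable {K} {L : ChainComplex (ModuleCat.{u} R) ℕ} (f : K ⟶ L)

/-- The map induced on boundaries. -/
def bdryMap : bdry K p →ₗ[R] bdry L p :=
  (HomologicalComplex.cyclesMap f p).hom.restrict (by
    rintro _ ⟨x, rfl⟩
    refine ⟨f.f (p + 1) x, iZ_injective L p ?_⟩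
    have h1 := LinearMap.congr_fun (iZ_comp_tZ L p) (f.f (p + 1) x)
    have h2 := LinearMap.congr_fun (iZ_comp_tZ K p) x
    have h3 := LinearMap.congr_fun (congrArg ModuleCat.Hom.hom (HomologicalComplex.cyclesMap_i f p))
      (tZ K p x)
    have h4 := LinearMap.congr_fun (congrArg ModuleCat.Hom.hom (f.comm (p + 1) p)) x
    refine h1.trans (Eq.trans ?_ h3.symm)
    exact h4.trans (congrArg (f.f p).hom h2.symm))

theorem iZ_cyclesMap (x : K.cycles p) :
    iZ L p ((HomologicalComplex.cyclesMap f p).hom x) = (f.f p).hom (iZ K p x) :=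
  LinearMap.congr_fun (congrArg ModuleCat.Hom.hom (HomologicalComplex.cyclesMap_i f p)) x

theorem iZ_comp_cyclesMap :
    iZ L p ∘ₗ (HomologicalComplex.cyclesMap f p).hom = (f.f p).hom ∘ₗ iZ K p :=
  congrArg ModuleCat.Hom.hom (HomologicalComplex.cyclesMap_i f p)

theorem homologyMap_comp_πH :
    (HomologicalComplex.homologyMap f p).hom ∘ₗ πH K p =
      πH L p ∘ₗ (HomologicalComplex.cyclesMap f p).hom :=
  congrArg ModuleCat.Hom.hom (HomologicalComplex.homologyπ_naturality f p)

theorem opcyclesMap_comp_pO :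
    (HomologicalComplex.opcyclesMap f p).hom ∘ₗ pO K p = pO L p ∘ₗ (f.f p).hom :=
  congrArg ModuleCat.Hom.hom (HomologicalComplex.p_opcyclesMap f p)

theorem ιH_comp_homologyMap :
    ιH L p ∘ₗ (HomologicalComplex.homologyMap f p).hom =
      (HomologicalComplex.opcyclesMap f p).hom ∘ₗ ιH K p :=
  congrArg ModuleCat.Hom.hom (HomologicalComplex.homologyι_naturality f p)

theorem bdryMap_comp_bB : bdryMap p f ∘ₗ bB K p = bB L p ∘ₗ (f.f (p + 1)).hom := by
  refine LinearMap.ext fun x => Subtype.ext (iZ_injective L p ?_)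
  have h1 := LinearMap.congr_fun (iZ_comp_tZ L p) (f.f (p + 1) x)
  have h2 := LinearMap.congr_fun (iZ_comp_tZ K p) x
  have h4 := LinearMap.congr_fun (congrArg ModuleCat.Hom.hom (f.comm (p + 1) p)) x
  exact (iZ_cyclesMap p f _).trans ((congrArg (f.f p).hom h2).trans (h4.symm.trans h1.symm))

/-- The map induced on the presentations of homology. -/
def bdrySequenceMap : bdrySequence K p ⟶ bdrySequence L p where
  τ₁ := ModuleCat.ofHom (bdryMap p f)
  τ₂ := HomologicalComplex.cyclesMap f p
  τ₃ := HomologicalComplex.homologyMap f p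
  comm₁₂ := rfl
  comm₂₃ := (HomologicalComplex.homologyπ_naturality f p).symm

end Elements

/-! ### Free complexes over a principal ideal domain -/

section Free

variable {R : Type u} [CommRing R] [IsDomain R] [IsPrincipalIdealRing R]
  (K : ChainComplex (ModuleCat.{u} R) ℕ) [∀ p, Module.Free R (K.X p)] (p : ℕ)

instance : Module.Free R (K.cycles p) := free_of_injective (iZ K p) (iZ_injective K p)

instance : Module.Free R (bdry K p) :=
  free_of_injective (jB K p) (Submodule.injective_subtype _)

instance : Projective (bdrySequence K p).X₁ :=
  (IsProjective.iff_projective _).1 (inferInstanceAs (Module.Projective R (bdry K p)))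

instance : Projective (bdrySequence K p).X₂ :=
  (IsProjective.iff_projective _).1 (inferInstanceAs (Module.Projective R (K.cycles p)))

/-- The cycles are a direct summand. -/
theorem exists_retraction : ∃ r : K.X p →ₗ[R] K.cycles p, r ∘ₗ iZ K p = LinearMap.id := by
  cases p with
  | zero =>
    let e := LinearEquiv.ofBijective (iZ K 0) ⟨iZ_injective K 0, iZ_zero_surjective K⟩
    exact ⟨e.symm.toLinearMap, LinearMap.ext e.symm_apply_apply⟩
  | succ p =>
    -- The boundaries are free, so the differential onto them has a section; equivalently, the
    -- inclusion of its kernel, the cycles, has a retraction.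
    obtain ⟨s, hs⟩ := (bB K p).exists_rightInverse_of_surjective
      (LinearMap.range_eq_top.2 (bB_surjective K p))
    have h : (∃ l, bB K p ∘ₗ l = LinearMap.id) ↔ ∃ l, l ∘ₗ iZ K (p + 1) = LinearMap.id :=
      ((exact_iZ_bB K p).split_tfae (iZ_injective K (p + 1)) (bB_surjective K p)).out 0 1
    exact h.1 ⟨s, hs⟩

end Free

/-! ### The Künneth sequence of a tensor product of complexes -/

section Model

variable {R : Type u} [CommRing R]

/-- An identification of the complex `E` with the tensor product of `C` and `D`, given by the
components in `C_p ⊗ D_q` of the elements of `E_{p+q}`. -/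
structure TensorModel (C D E : ChainComplex (ModuleCat.{u} R) ℕ) where
  comp : ∀ (p q : ℕ) {n : ℕ}, p + q = n → (E.X n →ₗ[R] C.X p ⊗[R] D.X q)
  ext : ∀ {n : ℕ} (x y : E.X n), (∀ p q (h : p + q = n), comp p q h x = comp p q h y) → x = y
  exists_eq : ∀ (n : ℕ) (F : ∀ p q, C.X p ⊗[R] D.X q),
    ∃ x : E.X n, ∀ p q (h : p + q = n), comp p q h x = F p q
  comp_d : ∀ (p q : ℕ) {n : ℕ} (h : p + q = n) (h₁ : p + 1 + q = n + 1) (h₂ : p + (q + 1) = n + 1)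
    (x : E.X (n + 1)), comp p q h (dX E n x) =
      (dX C p).rTensor (D.X q) (comp (p + 1) q h₁ x) +
        (-1 : R) ^ p • (dX D q).lTensor (C.X p) (comp p (q + 1) h₂ x)

namespace TensorModel

variable {C D E : ChainComplex (ModuleCat.{u} R) ℕ} (M : TensorModel C D E) (n : ℕ)

/-- All components of an element. -/
def compPi : E.X n →ₗ[R] ((p : {p : ℕ × ℕ // p.1 + p.2 = n}) → C.X p.1.1 ⊗[R] D.X p.1.2) :=
  LinearMap.pi fun p => M.comp p.1.1 p.1.2 p.2

theorem compPi_bijective : Function.Bijective (M.compPi n) := by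
  refine ⟨fun x y h => M.ext x y fun p q hpq => congrFun h ⟨(p, q), hpq⟩, fun F => ?_⟩
  -- Values must be given in all bidegrees; those of total degree other than n play no role and are
  -- set to zero.
  obtain ⟨x, hx⟩ := M.exists_eq n (fun p q => if h : p + q = n then F ⟨(p, q), h⟩ else 0)
  refine ⟨x, funext fun p => ?_⟩
  refine (hx p.1.1 p.1.2 p.2).trans ?_
  rw [dif_pos p.2]

/-- The chain with given cycle components. -/
def crossChain : (⨁ p : {p : ℕ × ℕ // p.1 + p.2 = n}, C.cycles p.1.1 ⊗[R] D.cycles p.1.2) →ₗ[R]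
    E.X n :=
  (LinearEquiv.ofBijective (M.compPi n) (M.compPi_bijective n)).symm.toLinearMap ∘ₗ
    DFinsupp.coeFnLinearMap R ∘ₗ
    DirectSum.lmap fun p => TensorProduct.map (iZ C p.1.1) (iZ D p.1.2)

theorem comp_crossChain (p q : ℕ) (h : p + q = n)
    (z : ⨁ p : {p : ℕ × ℕ // p.1 + p.2 = n}, C.cycles p.1.1 ⊗[R] D.cycles p.1.2) :
    M.comp p q h (M.crossChain n z) = TensorProduct.map (iZ C p) (iZ D q) (z ⟨(p, q), h⟩) := by
  have := (LinearEquiv.ofBijective (M.compPi n) (M.compPi_bijective n)).apply_symm_apply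
    (DFinsupp.coeFnLinearMap R (DirectSum.lmap
      (fun p : {p : ℕ × ℕ // p.1 + p.2 = n} => TensorProduct.map (iZ C p.1.1) (iZ D p.1.2)) z))
  have h' := congrFun this ⟨(p, q), h⟩
  refine h'.trans ?_
  exact DirectSum.lmap_apply
    (fun p : {p : ℕ × ℕ // p.1 + p.2 = n} => TensorProduct.map (iZ C p.1.1) (iZ D p.1.2)) z
    ⟨(p, q), h⟩

/-- A chain is a cycle when all components of its boundary vanish. Phrasing the hypothesis with n =
m + 1 leaves nothing to check in degree 0, where every chain is a cycle. -/
theorem exists_cycle (x : E.X n) (hx : ∀ m, n = m + 1 → ∀ p q (_ : p + q = m)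
    (h₁ : p + 1 + q = n) (h₂ : p + (q + 1) = n),
    (dX C p).rTensor (D.X q) (M.comp (p + 1) q h₁ x) +
        (-1 : R) ^ p • (dX D q).lTensor (C.X p) (M.comp p (q + 1) h₂ x) = 0) :
    ∃ z, iZ E n z = x := by
  cases n with
  | zero => exact iZ_zero_surjective E x
  | succ n =>
    refine (exact_iZ_dX E n x).1 (M.ext _ _ fun p q h => ?_)
    rw [M.comp_d p q h (by omega) (by omega), hx n rfl p q h, map_zero]

theorem comp_cycle (z : E.cycles (n + 1)) (p q : ℕ) (h₁ : p + 1 + q = n + 1)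
    (h₂ : p + (q + 1) = n + 1) :
    (dX C p).rTensor (D.X q) (M.comp (p + 1) q h₁ (iZ E (n + 1) z)) +
      (-1 : R) ^ p • (dX D q).lTensor (C.X p) (M.comp p (q + 1) h₂ (iZ E (n + 1) z)) = 0 := by
  rw [← M.comp_d p q (by omega : p + q = n) h₁ h₂, dX_iZ, map_zero]

/-- Both parts of the differential, d ⊗ 1 and 1 ⊗ d, kill tensors of cycles. -/
theorem exists_crossCycle
    (z : ⨁ p : {p : ℕ × ℕ // p.1 + p.2 = n}, C.cycles p.1.1 ⊗[R] D.cycles p.1.2) :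
    ∃ c, iZ E n c = M.crossChain n z := by
  refine M.exists_cycle n _ ?_
  rintro m rfl p q h h₁ h₂
  rw [comp_crossChain, comp_crossChain, rTensor_map_apply, dX_comp_iZ, lTensor_map_apply,
    dX_comp_iZ]
  simp

/-- The cycle with given cycle components. -/
def crossCycle : (⨁ p : {p : ℕ × ℕ // p.1 + p.2 = n}, C.cycles p.1.1 ⊗[R] D.cycles p.1.2) →ₗ[R]
    E.cycles n :=
  liftInjective (iZ E n) (iZ_injective E n) (M.crossChain n) (M.exists_crossCycle n)

theorem iZ_crossCycle
    (z : ⨁ p : {p : ℕ × ℕ // p.1 + p.2 = n}, C.cycles p.1.1 ⊗[R] D.cycles p.1.2) :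
    iZ E n (M.crossCycle n z) = M.crossChain n z :=
  apply_liftInjective _ _ _ _ z

/-- A chain whose boundary has prescribed components. -/
theorem exists_chain (a : ∀ p q, C.X (p + 1) ⊗[R] D.cycles q)
    (b : ∀ p q, C.cycles p ⊗[R] D.X (q + 1)) :
    ∃ e : E.X (n + 1),
      (∀ p q (h : p + q = n), M.comp p q h (dX E n e) =
        TensorProduct.map (dX C p) (iZ D q) (a p q) +
          (-1 : R) ^ p • TensorProduct.map (iZ C p) (dX D q) (b p q)) ∧
      ∀ p q (h : p + (q + 1) = n + 1), ∃ a', M.comp p (q + 1) h e =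
        (iZ C p).rTensor _ (b p q) + (iZ D (q + 1)).lTensor _ a' := by
  -- The data a and b live in positive degree of the first and of the second factor respectively; A
  -- and B extend them by zero to degree 0.
  let A : ∀ p q, C.X p ⊗[R] D.cycles q := fun p q => match p with
    | 0 => 0
    | p + 1 => a p q
  let B : ∀ p q, C.cycles p ⊗[R] D.X q := fun p q => match q with
    | 0 => 0
    | q + 1 => b p q
  obtain ⟨e, he⟩ := M.exists_eq (n + 1)
    (fun p q => (iZ C p).rTensor _ (B p q) + (iZ D q).lTensor _ (A p q))
  refine ⟨e, fun p q h => ?_, fun p q h => ⟨A p (q + 1), he _ _ h⟩⟩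
  -- Of the four terms two vanish: d ⊗ 1 kills what comes from B, whose first factor is a cycle, and
  -- 1 ⊗ d kills what comes from A, whose second factor is a cycle.
  rw [M.comp_d p q h (by omega) (by omega), he, he]
  simp only [map_add, ← LinearMap.comp_apply, LinearMap.rTensor_comp_lTensor,
    ← LinearMap.rTensor_comp, ← LinearMap.lTensor_comp, dX_comp_iZ,
    LinearMap.lTensor_comp_rTensor, LinearMap.rTensor_zero, LinearMap.lTensor_zero]
  simp [A, B]

/-- The projection from tensors of cycles to tensors of homology classes. -/
def tensorπ (C D : ChainComplex (ModuleCat.{u} R) ℕ) (n : ℕ) :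
    (⨁ p : {p : ℕ × ℕ // p.1 + p.2 = n}, C.cycles p.1.1 ⊗[R] D.cycles p.1.2) →ₗ[R]
      TensorPart C D n :=
  DirectSum.lmap fun p => TensorProduct.map (πH C p.1.1) (πH D p.1.2)

theorem tensorπ_surjective : Function.Surjective (tensorπ C D n) := by
  intro x
  choose F hF using fun p : {p : ℕ × ℕ // p.1 + p.2 = n} =>
    TensorProduct.map_surjective (πH_surjective C p.1.1) (πH_surjective D p.1.2) (x p)
  obtain ⟨z, hz⟩ := exists_directSum F
  refine ⟨z, DFinsupp.ext fun p => ?_⟩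
  exact (DirectSum.lmap_apply _ _ _).trans ((congrArg _ (hz p)).trans (hF p))

theorem tensorπ_apply
    (z : ⨁ p : {p : ℕ × ℕ // p.1 + p.2 = n}, C.cycles p.1.1 ⊗[R] D.cycles p.1.2)
    (p : {p : ℕ × ℕ // p.1 + p.2 = n}) :
    tensorπ C D n z p = TensorProduct.map (πH C p.1.1) (πH D p.1.2) (z p) :=
  DirectSum.lmap_apply _ _ _

/-- Right exactness: the kernel of a tensor product of two surjections is generated by the kernels
of the factors, here the boundaries in the cycles. -/
theorem exists_of_map_πH_eq_zero (p q : ℕ) (z : C.cycles p ⊗[R] D.cycles q)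
    (hz : TensorProduct.map (πH C p) (πH D q) z = 0) :
    ∃ a b, z = (tZ C p).rTensor _ a + (tZ D q).lTensor _ b := by
  have h := TensorProduct.map_ker (exact_tZ_πH C p) (πH_surjective C p)
    (exact_tZ_πH D q) (πH_surjective D q)
  have hz' : z ∈ LinearMap.ker (TensorProduct.map (πH C p) (πH D q)) := hz
  rw [h] at hz'
  obtain ⟨_, ⟨b, rfl⟩, _, ⟨a, rfl⟩, rfl⟩ := Submodule.mem_sup.1 hz'
  exact ⟨a, b, add_comm _ _⟩

/-- The same principle for C_p → O_p, whose kernel is the boundaries, and for D_{q+1} → B_q, whose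
kernel is the cycles. It describes the components of a cycle on which `thetaCycles` vanishes. -/
theorem exists_of_map_pO_bB_eq_zero (p q : ℕ) (x : C.X p ⊗[R] D.X (q + 1))
    (hx : TensorProduct.map (pO C p) (bB D q) x = 0) :
    ∃ a b, x = (dX C p).rTensor _ a + (iZ D (q + 1)).lTensor _ b := by
  have h := TensorProduct.map_ker (exact_dX_pO C p) (pO_surjective C p)
    (exact_iZ_bB D q) (bB_surjective D q)
  have hx' : x ∈ LinearMap.ker (TensorProduct.map (pO C p) (bB D q)) := hx
  rw [h] at hx'
  obtain ⟨_, ⟨b, rfl⟩, _, ⟨a, rfl⟩, rfl⟩ := Submodule.mem_sup.1 hx'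
  exact ⟨a, b, add_comm _ _⟩

theorem map_iZ_add (p q : ℕ) (a : C.X (p + 1) ⊗[R] D.cycles q) (b : C.cycles p ⊗[R] D.X (q + 1)) :
    TensorProduct.map (iZ C p) (iZ D q) ((tZ C p).rTensor _ a + (tZ D q).lTensor _ b) =
      TensorProduct.map (dX C p) (iZ D q) a + TensorProduct.map (iZ C p) (dX D q) b := by
  rw [map_add, map_rTensor_apply, map_lTensor_apply, iZ_comp_tZ, iZ_comp_tZ]

/-- This makes the product of classes well defined: a tensor of cycles that vanishes in homology has
boundaries in one factor or the other, and a boundary times a cycle is a boundary. -/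
theorem crossCycle_eq_zero
    (z : ⨁ p : {p : ℕ × ℕ // p.1 + p.2 = n}, C.cycles p.1.1 ⊗[R] D.cycles p.1.2)
    (hz : tensorπ C D n z = 0) : (πH E n ∘ₗ M.crossCycle n) z = 0 := by
  have h : ∀ p q, ∃ a b, ∀ h : p + q = n,
      z ⟨(p, q), h⟩ = (tZ C p).rTensor _ a + (tZ D q).lTensor _ b := by
    intro p q
    by_cases h : p + q = n
    · obtain ⟨a, b, hab⟩ := exists_of_map_πH_eq_zero p q (z ⟨(p, q), h⟩) (by
        rw [← tensorπ_apply n z ⟨(p, q), h⟩, hz]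
        rfl)
      exact ⟨a, b, fun _ => hab⟩
    · exact ⟨0, 0, fun h' => absurd h' h⟩
  choose a b hab using h
  -- The factor (-1)^p cancels the sign of 1 ⊗ d in the differential.
  obtain ⟨e, he, -⟩ := M.exists_chain n a (fun p q => (-1 : R) ^ p • b p q)
  refine (exact_tZ_πH E n _).2 ⟨e, iZ_injective E n (M.ext _ _ fun p q h => ?_)⟩
  rw [iZ_crossCycle, comp_crossChain, hab p q h, map_iZ_add, iZ_tZ,
    he p q h, map_smul, smul_smul, ← mul_pow]
  simp

/-- The cross product. -/
def cross : TensorPart C D n →ₗ[R] E.homology n :=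
  descSurjective (tensorπ C D n) (tensorπ_surjective n) (πH E n ∘ₗ M.crossCycle n)
    (M.crossCycle_eq_zero n)

theorem cross_tensorπ
    (z : ⨁ p : {p : ℕ × ℕ // p.1 + p.2 = n}, C.cycles p.1.1 ⊗[R] D.cycles p.1.2) :
    M.cross n (tensorπ C D n z) = πH E n (M.crossCycle n z) :=
  descSurjective_apply _ _ _ _ z

/-- The differential of the second factor, modulo boundaries of the first one. -/
def thetaCycles : E.cycles n →ₗ[R]
    ((p : {p : ℕ × ℕ // p.1 + p.2 + 1 = n}) → C.opcycles p.1.1 ⊗[R] bdry D p.1.2) :=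
  LinearMap.pi fun p => TensorProduct.map (pO C p.1.1) (bB D p.1.2) ∘ₗ
    M.comp p.1.1 (p.1.2 + 1) p.2 ∘ₗ iZ E n

theorem thetaCycles_apply (c : E.cycles n) (p : {p : ℕ × ℕ // p.1 + p.2 + 1 = n}) :
    M.thetaCycles n c p = TensorProduct.map (pO C p.1.1) (bB D p.1.2)
      (M.comp p.1.1 (p.1.2 + 1) p.2 (iZ E n c)) := rfl

theorem bB_comp_dX (K : ChainComplex (ModuleCat.{u} R) ℕ) (p : ℕ) : bB K p ∘ₗ dX K (p + 1) = 0 := by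
  rw [← iZ_comp_tZ, ← LinearMap.comp_assoc, bB_comp_iZ, LinearMap.zero_comp]

/-- A component of a boundary is the sum of a term in the image of d ⊗ 1, which dies modulo
boundaries of C, and one in the image of 1 ⊗ d, which dies because d² = 0 in D. -/
theorem thetaCycles_eq_zero (c : E.cycles n) (hc : πH E n c = 0) : M.thetaCycles n c = 0 := by
  obtain ⟨e, rfl⟩ := (exact_tZ_πH E n c).1 hc
  funext ⟨⟨p, q⟩, h⟩
  rw [thetaCycles_apply, iZ_tZ, M.comp_d p (q + 1) h (by omega) (by omega), map_add, map_smul,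
    map_rTensor_apply, map_lTensor_apply, bB_comp_dX, pO_comp_dX]
  simp

/-- The map induced by `thetaCycles` on homology. -/
def theta : E.homology n →ₗ[R]
    ((p : {p : ℕ × ℕ // p.1 + p.2 + 1 = n}) → C.opcycles p.1.1 ⊗[R] bdry D p.1.2) :=
  descSurjective (πH E n) (πH_surjective E n) (M.thetaCycles n) (M.thetaCycles_eq_zero n)

theorem theta_πH (c : E.cycles n) : M.theta n (πH E n c) = M.thetaCycles n c :=
  descSurjective_apply _ _ _ _ c

end TensorModel

end Model

/-! ### `Tor₁` of homology inside O_p ⊗ B_q -/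

section TorEmbedding

variable {R : Type u} [CommRing R] [IsDomain R] [IsPrincipalIdealRing R]
  (C D : ChainComplex (ModuleCat.{u} R) ℕ) [∀ p, Module.Free R (D.X p)] (p q : ℕ)

/-- `Tor₁` of homology modules as a submodule of `H_p ⊗ B_q`. -/
def torBdry : ((Tor (ModuleCat.{u} R) 1).obj (C.homology p)).obj (D.homology q) →ₗ[R]
    C.homology p ⊗[R] bdry D q :=
  torι (C.homology p) (bdrySequence D q) (bdrySequence_shortExact D q)

theorem torBdry_injective : Function.Injective (torBdry C D p q) :=
  torι_injective _ _ _

theorem torBdry_exact : Function.Exact (torBdry C D p q) ((jB D q).lTensor (C.homology p)) :=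
  torι_exact _ _ _

/-- `Tor₁` of homology modules as a submodule of `O_p ⊗ B_q`, with `O_p` the chains modulo
boundaries. -/
def torEmbedding : ((Tor (ModuleCat.{u} R) 1).obj (C.homology p)).obj (D.homology q) →ₗ[R]
    C.opcycles p ⊗[R] bdry D q :=
  (ιH C p).rTensor (bdry D q) ∘ₗ torBdry C D p q

theorem torEmbedding_injective : Function.Injective (torEmbedding C D p q) :=
  (Module.Flat.rTensor_preserves_injective_linearMap _ (ιH_injective C p)).comp
    (torBdry_injective C D p q)

/-- Replacing H_p by the larger O_p does not enlarge the kernel of − ⊗ B_q → − ⊗ Z_q: the quotient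
of O_p by H_p embeds into a free module of chains, so it contributes no torsion. -/
theorem mem_range_torEmbedding [∀ p, Module.Free R (C.X p)] (x : C.opcycles p ⊗[R] bdry D q)
    (hx : (jB D q).lTensor _ x = 0) : ∃ t, torEmbedding C D p q t = x := by
  -- In positive degree, H → O → C stays exact after tensoring with the flat module B_q. The image
  -- of x in C ⊗ B_q vanishes because it vanishes in C ⊗ Z_q, and C is flat. In degree 0, H is all
  -- of O.
  have h1 : ∃ y, (ιH C p).rTensor (bdry D q) y = x := by
    cases p with
    | zero => exact LinearMap.rTensor_surjective _ (ιH_zero_surjective C) x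
    | succ p =>
      refine (Module.Flat.rTensor_exact (bdry D q) (exact_ιH_fO C p) x).1 ?_
      refine Module.Flat.lTensor_preserves_injective_linearMap (M := C.X p) (jB D q)
        (Submodule.injective_subtype _) ?_
      have : (jB D q).lTensor (C.X p) ((fO C p).rTensor (bdry D q) x) =
          (fO C p).rTensor _ ((jB D q).lTensor _ x) :=
        LinearMap.congr_fun ((LinearMap.lTensor_comp_rTensor _ _ _).trans
          (LinearMap.rTensor_comp_lTensor _ _ _).symm) x
      rw [this, hx, map_zero, map_zero]
  obtain ⟨y, rfl⟩ := h1
  -- Flatness of Z_q makes H_p ⊗ Z_q → O_p ⊗ Z_q injective, so the kernel condition passes from x to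
  -- y.
  have h2 : (jB D q).lTensor _ y = 0 := by
    refine Module.Flat.rTensor_preserves_injective_linearMap (M := D.cycles q) (ιH C p)
      (ιH_injective C p) ?_
    have : (ιH C p).rTensor (D.cycles q) ((jB D q).lTensor _ y) =
        (jB D q).lTensor _ ((ιH C p).rTensor _ y) :=
      LinearMap.congr_fun ((LinearMap.rTensor_comp_lTensor _ _ _).trans
        (LinearMap.lTensor_comp_rTensor _ _ _).symm) y
    rw [this, hx, map_zero]
  obtain ⟨t, rfl⟩ := (torBdry_exact C D p q y).1 h2
  exact ⟨t, rfl⟩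

/-- All the embeddings `torEmbedding` of a given total degree. -/
def torPartEmbedding (n : ℕ) : TorPart C D n →ₗ[R]
    ((p : {p : ℕ × ℕ // p.1 + p.2 + 1 = n}) → C.opcycles p.1.1 ⊗[R] bdry D p.1.2) :=
  LinearMap.pi fun p => torEmbedding C D p.1.1 p.1.2 ∘ₗ DirectSum.component R _ _ p

theorem torPartEmbedding_apply (n : ℕ) (t : TorPart C D n)
    (p : {p : ℕ × ℕ // p.1 + p.2 + 1 = n}) :
    torPartEmbedding C D n t p = torEmbedding C D p.1.1 p.1.2 (t p) := rfl

theorem torPartEmbedding_injective (n : ℕ) : Function.Injective (torPartEmbedding C D n) :=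
  fun _ _ h => DFinsupp.ext fun p => torEmbedding_injective C D p.1.1 p.1.2 (congrFun h p)

end TorEmbedding

/-! ### Exactness of the Künneth sequence -/

namespace TensorModel

variable {R : Type u} [CommRing R] [IsDomain R] [IsPrincipalIdealRing R]
  {C D E : ChainComplex (ModuleCat.{u} R) ℕ} (M : TensorModel C D E) (n : ℕ)
  [∀ p, Module.Free R (C.X p)] [∀ p, Module.Free R (D.X p)]

/-- Retractions r and s of chains onto cycles extend the classes of cycles to maps on all chains
that kill boundaries. Their tensor product recovers the classes from the product cycle and kills
both parts of the differential, so a product that bounds has zero class in every H_p ⊗ H_q. -/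
theorem cross_injective : Function.Injective (M.cross n) := by
  rw [injective_iff_map_eq_zero]
  intro x hx
  obtain ⟨z, rfl⟩ := tensorπ_surjective n x
  rw [cross_tensorπ] at hx
  obtain ⟨e, he⟩ := (exact_tZ_πH E n _).1 hx
  refine DFinsupp.ext fun ⟨⟨p, q⟩, h⟩ => ?_
  rw [tensorπ_apply]
  obtain ⟨r, hr⟩ := exists_retraction C p
  obtain ⟨s, hs⟩ := exists_retraction D q
  have hrd : (πH C p ∘ₗ r) ∘ₗ dX C p = 0 := by
    rw [← iZ_comp_tZ, LinearMap.comp_assoc, ← LinearMap.comp_assoc (tZ C p), hr,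
      LinearMap.id_comp,
      πH_comp_tZ]
  have hsd : (πH D q ∘ₗ s) ∘ₗ dX D q = 0 := by
    rw [← iZ_comp_tZ, LinearMap.comp_assoc, ← LinearMap.comp_assoc (tZ D q), hs,
      LinearMap.id_comp,
      πH_comp_tZ]
  have key := congrArg (TensorProduct.map (πH C p ∘ₗ r) (πH D q ∘ₗ s))
    (congrArg (M.comp p q h) (congrArg (iZ E n) he))
  rw [iZ_tZ, iZ_crossCycle, comp_crossChain, M.comp_d p q h (by omega) (by omega), map_add,
    map_smul, map_rTensor_apply, map_lTensor_apply, hrd, hsd, map_map_apply, LinearMap.comp_assoc,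
    hr, LinearMap.comp_assoc, hs, LinearMap.comp_id, LinearMap.comp_id] at key
  simpa using key.symm

/-- By `mem_range_torEmbedding` it suffices that the image in O_p ⊗ Z_q vanishes. This is the cycle
equation in bidegree (p, q), read modulo boundaries of C. -/
theorem exists_torPartEmbedding (x : E.homology n) :
    ∃ t, torPartEmbedding C D n t = M.theta n x := by
  obtain ⟨c, rfl⟩ := πH_surjective E n x
  rw [theta_πH]
  have h : ∀ p : {p : ℕ × ℕ // p.1 + p.2 + 1 = n}, ∃ t,
      torEmbedding C D p.1.1 p.1.2 t = M.thetaCycles n c p := by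
    rintro ⟨⟨p, q⟩, h⟩
    obtain rfl : p + q + 1 = n := h
    refine mem_range_torEmbedding C D p q _ ?_
    obtain ⟨r, hr⟩ := exists_retraction D q
    -- O_p need not be flat, but Z_q is a direct summand of D_q, so the vanishing may be tested in
    -- O_p ⊗ D_q.
    have hinj : Function.Injective ((iZ D q).lTensor (C.opcycles p)) := by
      refine Function.LeftInverse.injective (g := r.lTensor _) fun x => ?_
      rw [← LinearMap.comp_apply, ← LinearMap.lTensor_comp, hr, LinearMap.lTensor_id]
      rfl
    refine hinj ?_
    have hc := congrArg ((pO C p).rTensor (D.X q))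
      (M.comp_cycle (p + q) c p q (by omega) (by omega))
    rw [map_add, map_smul, ← LinearMap.comp_apply, ← LinearMap.rTensor_comp, pO_comp_dX,
      LinearMap.rTensor_zero, LinearMap.zero_apply, zero_add, map_zero] at hc
    -- A second factor (-1)^p removes the sign of 1 ⊗ d.
    have hc' := congrArg (fun y => (-1 : R) ^ p • y) hc
    simp only [smul_smul, ← mul_pow, mul_neg, mul_one, neg_neg, one_pow, one_smul,
      smul_zero] at hc'
    rw [thetaCycles_apply, lTensor_map_apply, lTensor_map_apply, jB_comp_bB, iZ_comp_tZ, map_zero]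
    rw [← LinearMap.comp_apply, LinearMap.rTensor_comp_lTensor] at hc'
    exact hc'
  choose F hF using h
  obtain ⟨t, ht⟩ := exists_directSum F
  refine ⟨t, funext fun p => ?_⟩
  rw [torPartEmbedding_apply, ht, hF]

/-- The map from homology to `Tor₁` of the homology of the factors. -/
def toTor : E.homology n →ₗ[R] TorPart C D n :=
  liftInjective (torPartEmbedding C D n) (torPartEmbedding_injective C D n) (M.theta n)
    (M.exists_torPartEmbedding n)

theorem torPartEmbedding_toTor (x : E.homology n) :
    torPartEmbedding C D n (M.toTor n x) = M.theta n x :=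
  apply_liftInjective _ _ _ _ x

/-- The second factors of a product of cycles are cycles, and the differential of D kills them. -/
theorem toTor_cross (x : TensorPart C D n) : M.toTor n (M.cross n x) = 0 := by
  obtain ⟨z, rfl⟩ := tensorπ_surjective n x
  refine torPartEmbedding_injective C D n ?_
  rw [torPartEmbedding_toTor, cross_tensorπ, theta_πH, map_zero]
  funext ⟨⟨p, q⟩, h⟩
  rw [thetaCycles_apply, iZ_crossCycle, comp_crossChain, map_map_apply, bB_comp_iZ]
  simp

/-- A cycle all of whose components are cycles for the second factor is a cross product. -/
theorem exists_crossCycle_eq (c : E.cycles n) (hc : ∀ p q (h : p + q = n),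
    ∃ y, (iZ D q).lTensor (C.X p) y = M.comp p q h (iZ E n c)) : ∃ z, M.crossCycle n z = c := by
  have h : ∀ p : {p : ℕ × ℕ // p.1 + p.2 = n}, ∃ z,
      TensorProduct.map (iZ C p.1.1) (iZ D p.1.2) z = M.comp p.1.1 p.1.2 p.2 (iZ E n c) := by
    rintro ⟨⟨p, q⟩, h⟩
    obtain ⟨y, hy⟩ := hc p q h
    -- In the cycle equation the 1 ⊗ d term vanishes, since the neighbouring component also has
    -- cycles as second factor. So (d ⊗ 1) y = 0 in C ⊗ D, hence in C ⊗ Z because C is flat, and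
    -- flatness of Z_q gives y from cycles in both factors.
    have hz : ∃ z, (iZ C p).rTensor _ z = y := by
      cases p with
      | zero => exact LinearMap.rTensor_surjective _ (iZ_zero_surjective C) y
      | succ p =>
        refine (Module.Flat.rTensor_exact (D.cycles q) (exact_iZ_dX C p) y).1 ?_
        refine Module.Flat.lTensor_preserves_injective_linearMap (M := C.X p) (iZ D q)
          (iZ_injective D q) ?_
        obtain rfl : p + q + 1 = n := by omega
        have h1 := M.comp_cycle (p + q) c p q (by omega) (by omega)
        obtain ⟨y', hy'⟩ := hc p (q + 1) (by omega)
        rw [← hy, ← hy', ← LinearMap.comp_apply (LinearMap.lTensor _ (dX D q)),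
          ← LinearMap.lTensor_comp, dX_comp_iZ, LinearMap.lTensor_zero, LinearMap.zero_apply,
          smul_zero, add_zero] at h1
        rw [map_zero, ← h1]
        exact LinearMap.congr_fun ((LinearMap.lTensor_comp_rTensor _ _ _).trans
          (LinearMap.rTensor_comp_lTensor _ _ _).symm) y
    obtain ⟨z, rfl⟩ := hz
    refine ⟨z, ?_⟩
    rw [← hy]
    exact (LinearMap.congr_fun (LinearMap.lTensor_comp_rTensor _ _ _) z).symm
  choose F hF using h
  obtain ⟨z, hz⟩ := exists_directSum F
  refine ⟨z, iZ_injective E n (M.ext _ _ fun p q h => ?_)⟩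
  rw [iZ_crossCycle, comp_crossChain, hz]
  exact hF ⟨(p, q), h⟩

/-- If the invariant in O_p ⊗ B_q vanishes, each component of the cycle in C_p ⊗ D_{q+1} is in the
image of d ⊗ 1 up to an element of C_p ⊗ Z_{q+1}. Subtracting a suitable boundary leaves only
components in C ⊗ Z, and `exists_crossCycle_eq` applies. -/
theorem exists_cross_eq (x : E.homology n) (hx : M.toTor n x = 0) : ∃ y, M.cross n y = x := by
  obtain ⟨c, rfl⟩ := πH_surjective E n x
  have hθ : M.thetaCycles n c = 0 := by
    rw [← theta_πH, ← torPartEmbedding_toTor, hx, map_zero]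
  have h : ∀ p q, ∃ a b, ∀ h : p + (q + 1) = n, M.comp p (q + 1) h (iZ E n c) =
      (dX C p).rTensor _ a + (iZ D (q + 1)).lTensor _ b := by
    intro p q
    by_cases h : p + (q + 1) = n
    · obtain ⟨a, b, hab⟩ := exists_of_map_pO_bB_eq_zero p q (M.comp p (q + 1) h (iZ E n c))
        (congrFun hθ ⟨(p, q), h⟩)
      exact ⟨a, b, fun _ => hab⟩
    · exact ⟨0, 0, fun h' => absurd h' h⟩
  choose a b hab using h
  -- The chain to be bounded off: a p q in bidegree (p + 1, q + 1), and zero when either degree is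
  -- 0.
  let F : ∀ p q, C.X p ⊗[R] D.X q := fun p q => match p, q with
    | p + 1, q + 1 => a p q
    | 0, _ => 0
    | _ + 1, 0 => 0
  obtain ⟨e, he⟩ := M.exists_eq (n + 1) F
  obtain ⟨z, hz⟩ := M.exists_crossCycle_eq n (c - tZ E n e) (by
    intro p q h
    cases q with
    | zero => exact LinearMap.lTensor_surjective _ (iZ_zero_surjective D) _
    | succ q =>
      -- The d ⊗ 1 part of the boundary of e cancels the a-term. Its 1 ⊗ d part has boundaries as
      -- second factor, so it stays inside C ⊗ Z and is absorbed here.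
      refine ⟨b p q - (-1 : R) ^ p • (tZ D (q + 1)).lTensor _ (F p (q + 2)), ?_⟩
      rw [map_sub (iZ E n), iZ_tZ, map_sub (M.comp p (q + 1) h),
        M.comp_d p (q + 1) h (by omega) (by omega), hab p q h, he, he, map_sub, map_smul,
        ← LinearMap.comp_apply, ← LinearMap.lTensor_comp, iZ_comp_tZ]
      change _ = _ - ((dX C p).rTensor _ (a p q) + _)
      abel)
  refine ⟨tensorπ C D n z, ?_⟩
  rw [cross_tensorπ, hz, map_sub, sub_eq_self]
  exact LinearMap.congr_fun (πH_comp_tZ E n) e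

/-- Lift an element of Tor₁ inside H_p ⊗ B_q to v in Z_p ⊗ D_{q+1}. Being in the kernel over Z_q
means that (1 ⊗ d) v has first factors that bound, that is, (1 ⊗ d) v = (d ⊗ 1) w with w in C_{p+1}
⊗ Z_q. With suitable signs, v and w form a cycle that maps to the given element. -/
theorem toTor_surjective : Function.Surjective (M.toTor n) := by
  intro t
  cases n with
  | zero =>
    -- In degree 0 the Tor term is an empty sum, as p + q + 1 = 0 has no solution.
    refine ⟨0, DFinsupp.ext fun p => ?_⟩
    exact absurd p.2 (by omega)
  | succ n =>
    have h : ∀ p q, ∃ (w : C.X (p + 1) ⊗[R] D.cycles q) (v : C.cycles p ⊗[R] D.X (q + 1)),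
        (tZ C p).rTensor _ w = (tZ D q).lTensor _ v ∧ ∀ h : p + q + 1 = n + 1,
          TensorProduct.map (πH C p) (bB D q) v = torBdry C D p q (t ⟨(p, q), h⟩) := by
      intro p q
      by_cases h : p + q + 1 = n + 1
      · obtain ⟨v, hv⟩ := TensorProduct.map_surjective (πH_surjective C p) (bB_surjective D q)
          (torBdry C D p q (t ⟨(p, q), h⟩))
        have h0 := (torBdry_exact C D p q).apply_apply_eq_zero (t ⟨(p, q), h⟩)
        rw [← hv, lTensor_map_apply, jB_comp_bB] at h0
        obtain ⟨w, hw⟩ := (rTensor_exact (D.cycles q) (exact_tZ_πH C p) (πH_surjective C p)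
          ((tZ D q).lTensor _ v)).1
          ((LinearMap.congr_fun (LinearMap.rTensor_comp_lTensor _ _ _) v).trans h0)
        exact ⟨w, v, hw, fun _ => hv⟩
      · exact ⟨0, 0, by simp, fun h' => absurd h' h⟩
    choose w v hwv hv using h
    -- With this sign the component of the boundary in bidegree (p, q) is (-1)^p times the
    -- difference of (1 ⊗ d) v and (d ⊗ 1) w, which is zero.
    obtain ⟨e, he, he'⟩ := M.exists_chain n (fun p q => (-1 : R) ^ p • (-w p q)) v
    obtain ⟨c, rfl⟩ := (exact_iZ_dX E n e).1 (M.ext _ _ fun p q h => by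
      rw [he p q h, map_smul, ← smul_add, ← map_iZ_add, map_neg, hwv, neg_add_cancel, map_zero,
        smul_zero, map_zero])
    refine ⟨πH E (n + 1) c, torPartEmbedding_injective C D (n + 1) ?_⟩
    rw [torPartEmbedding_toTor, theta_πH]
    funext ⟨⟨p, q⟩, h⟩
    obtain ⟨a', ha'⟩ := he' p q h
    rw [thetaCycles_apply, ha', map_add, map_rTensor_apply, map_lTensor_apply, bB_comp_iZ,
      TensorProduct.map_zero_right, LinearMap.zero_apply, add_zero, ← ιH_comp_πH,
      ← rTensor_map_apply, hv p q h]
    rfl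

theorem exact_cross_toTor : Function.Exact (M.cross n) (M.toTor n) := by
  intro x
  refine ⟨M.exists_cross_eq n x, ?_⟩
  rintro ⟨y, rfl⟩
  exact M.toTor_cross n y

/-- The Künneth sequence. -/
def kunnethSequence : KunnethSequence C D E n where
  cross := M.cross n
  toTor := M.toTor n
  injective := M.cross_injective n
  exact := M.exact_cross_toTor n
  surjective := M.toTor_surjective n

end TensorModel

/-! ### Naturality -/

section Naturality

variable {R : Type u} [CommRing R] {C D E C' D' E' : ChainComplex (ModuleCat.{u} R) ℕ}

/-- A chain map compatible with the identifications with tensor products. -/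
def TensorModel.Compatible (M : TensorModel C D E) (M' : TensorModel C' D' E') (f : C ⟶ C')
    (g : D ⟶ D') (k : E ⟶ E') : Prop :=
  ∀ (p q n : ℕ) (h : p + q = n) (x : E.X n),
    M'.comp p q h ((k.f n).hom x) = TensorProduct.map (f.f p).hom (g.f q).hom (M.comp p q h x)

variable {M : TensorModel C D E} {M' : TensorModel C' D' E'} {f : C ⟶ C'} {g : D ⟶ D'} {k : E ⟶ E'}

theorem hMap_πH (f : C ⟶ C') (n : ℕ) (x : C.cycles n) :
    hMap f n (πH C n x) = πH C' n ((HomologicalComplex.cyclesMap f n).hom x) :=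
  LinearMap.congr_fun (homologyMap_comp_πH n f) x

theorem TensorModel.Compatible.cyclesMap_crossCycle (H : M.Compatible M' f g k) (n : ℕ)
    (z : ⨁ p : {p : ℕ × ℕ // p.1 + p.2 = n}, C.cycles p.1.1 ⊗[R] D.cycles p.1.2) :
    (HomologicalComplex.cyclesMap k n).hom (M.crossCycle n z) =
      M'.crossCycle n (DirectSum.lmap (fun p : {p : ℕ × ℕ // p.1 + p.2 = n} =>
        TensorProduct.map (HomologicalComplex.cyclesMap f p.1.1).hom
          (HomologicalComplex.cyclesMap g p.1.2).hom) z) := by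
  refine iZ_injective E' n (M'.ext _ _ fun p q h => ?_)
  rw [iZ_cyclesMap, H, iZ_crossCycle, iZ_crossCycle, comp_crossChain, comp_crossChain,
    DirectSum.lmap_apply, map_map_apply, map_map_apply, iZ_comp_cyclesMap, iZ_comp_cyclesMap]

/-- The product is determined by its values on tensors of cycles, because `tensorπ` is surjective;
there it is the chain-level compatibility. -/
theorem TensorModel.Compatible.cross_naturality (H : M.Compatible M' f g k) (n : ℕ) :
    hMap k n ∘ₗ M.cross n = M'.cross n ∘ₗ tensorPartMap f g n := by
  refine LinearMap.ext fun x => ?_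
  obtain ⟨z, rfl⟩ := tensorπ_surjective n x
  have h : tensorPartMap f g n (tensorπ C D n z) = tensorπ C' D' n
      (DirectSum.lmap (fun p : {p : ℕ × ℕ // p.1 + p.2 = n} =>
        TensorProduct.map (HomologicalComplex.cyclesMap f p.1.1).hom
          (HomologicalComplex.cyclesMap g p.1.2).hom) z) := by
    refine DFinsupp.ext fun p => ?_
    rw [tensorπ_apply, tensorPartMap, DirectSum.lmap_apply, DirectSum.lmap_apply, tensorπ_apply,
      map_map_apply, map_map_apply, homologyMap_comp_πH, homologyMap_comp_πH]
  rw [LinearMap.comp_apply, LinearMap.comp_apply, cross_tensorπ, h, cross_tensorπ, hMap_πH,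
    H.cyclesMap_crossCycle]

theorem TensorModel.Compatible.theta_naturality (H : M.Compatible M' f g k) (n : ℕ)
    (x : E.homology n) (p : {p : ℕ × ℕ // p.1 + p.2 + 1 = n}) :
    M'.theta n (hMap k n x) p = TensorProduct.map (HomologicalComplex.opcyclesMap f p.1.1).hom
      (bdryMap p.1.2 g) (M.theta n x p) := by
  obtain ⟨c, rfl⟩ := πH_surjective E n x
  rw [hMap_πH, theta_πH, theta_πH, thetaCycles_apply, thetaCycles_apply, iZ_cyclesMap, H,
    map_map_apply, map_map_apply, bdryMap_comp_bB, opcyclesMap_comp_pO]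

variable [IsDomain R] [IsPrincipalIdealRing R] [∀ p, Module.Free R (D.X p)]
  [∀ p, Module.Free R (D'.X p)]

/-- A chain map g induces a map of the resolutions by boundaries and cycles, so the embedding into
H_p ⊗ B_q is natural; passing on to O_p ⊗ B_q preserves this. -/
theorem torEmbedding_naturality (f : C ⟶ C') (g : D ⟶ D') (p q : ℕ)
    (t : ((Tor (ModuleCat.{u} R) 1).obj (C.homology p)).obj (D.homology q)) :
    torEmbedding C' D' p q
      ((((Tor (ModuleCat.{u} R) 1).map (HomologicalComplex.homologyMap f p)).app _ ≫
        ((Tor (ModuleCat.{u} R) 1).obj _).map (HomologicalComplex.homologyMap g q)).hom t) =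
      TensorProduct.map (HomologicalComplex.opcyclesMap f p).hom (bdryMap q g)
        (torEmbedding C D p q t) := by
  have h : torBdry C' D' p q
      ((((Tor (ModuleCat.{u} R) 1).map (HomologicalComplex.homologyMap f p)).app _ ≫
        ((Tor (ModuleCat.{u} R) 1).obj _).map (HomologicalComplex.homologyMap g q)).hom t) =
      TensorProduct.map (HomologicalComplex.homologyMap f p).hom (bdryMap q g)
        (torBdry C D p q t) :=
    LinearMap.congr_fun (torι_naturality (HomologicalComplex.homologyMap f p)
      (bdrySequenceMap q g) (bdrySequence_shortExact D q) (bdrySequence_shortExact D' q)) t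
  rw [torEmbedding, LinearMap.comp_apply, h, torEmbedding, LinearMap.comp_apply, rTensor_map_apply,
    map_rTensor_apply, ιH_comp_homologyMap]

variable [∀ p, Module.Free R (C.X p)] [∀ p, Module.Free R (C'.X p)]

/-- The Tor terms embed into sums of O_p ⊗ B_q naturally, so it is enough to compare there, where
`toTor` becomes the explicit and natural `theta`. -/
theorem TensorModel.Compatible.toTor_naturality (H : M.Compatible M' f g k) (n : ℕ) :
    torPartMap f g n ∘ₗ M.toTor n = M'.toTor n ∘ₗ hMap k n := by
  refine LinearMap.ext fun x => torPartEmbedding_injective C' D' n ?_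
  funext p
  rw [LinearMap.comp_apply, LinearMap.comp_apply, torPartEmbedding_toTor, H.theta_naturality,
    ← torPartEmbedding_toTor, torPartEmbedding_apply, torPartEmbedding_apply,
    ← torEmbedding_naturality, torPartMap, DirectSum.lmap_apply]

end Naturality

/-! ### Representatives of cross products -/

/-- Exposes the cycle behind the product of two classes: its only possibly nonzero component is the
tensor of the two cycles. -/
theorem TensorModel.cross_lof {R : Type u} [CommRing R] {C D E : ChainComplex (ModuleCat.{u} R) ℕ}
    (M : TensorModel C D E) (n : ℕ) (p : {p : ℕ × ℕ // p.1 + p.2 = n}) (x : C.cycles p.1.1)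
    (y : D.cycles p.1.2) :
    ∃ w : E.cycles n, πH E n w = M.cross n (DirectSum.lof R _ _ p (πH C _ x ⊗ₜ[R] πH D _ y)) ∧
      ∀ (a b : ℕ) (h : a + b = n), M.comp a b h (iZ E n w) =
        TensorProduct.map (iZ C a) (iZ D b) ((DirectSum.lof R {p : ℕ × ℕ // p.1 + p.2 = n}
          (fun p => C.cycles p.1.1 ⊗[R] D.cycles p.1.2) p (x ⊗ₜ[R] y)) ⟨(a, b), h⟩) := by
  refine ⟨M.crossCycle n (DirectSum.lof R _ _ p (x ⊗ₜ[R] y)), ?_, fun a b h => ?_⟩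
  · rw [← cross_tensorπ]
    congr 1
    exact (DirectSum.lmap_lof _ _ _).trans (by rw [TensorProduct.map_tmul])
  · rw [iZ_crossCycle, comp_crossChain]

/-! ### Complexes with bases and products of bases -/

/-- A complex given by a graded set of simplices and a boundary operator. -/
structure BasedComplex (R : Type u) [CommRing R] (X : Type u) where
  cells : ℕ → Set X
  D : (X →₀ R) →ₗ[R] (X →₀ R)
  D_mem : ∀ k, ∀ x ∈ Finsupp.supported R R (cells (k + 1)), D x ∈ Finsupp.supported R R (cells k)
  D_sq : ∀ x, D (D x) = 0
  D_zero : ∀ x ∈ cells 0, D (Finsupp.single x 1) = 0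
  eq_of_mem : ∀ x p q, x ∈ cells p → x ∈ cells q → p = q

namespace BasedComplex

variable {R : Type u} [CommRing R] {X : Type u} (B : BasedComplex R X)

/-- The chain complex. -/
abbrev complex : ChainComplex (ModuleCat.{u} R) ℕ :=
  gradedComplex R (fun k => Finsupp.supported R R (B.cells k)) B.D B.D_mem B.D_sq

/-- The inclusion of the chains of degree `p` into all chains. -/
def incl (p : ℕ) : B.complex.X p →ₗ[R] (X →₀ R) := (Finsupp.supported R R (B.cells p)).subtype

open Classical in
/-- The projection to the chains of degree `p`. -/
def proj (p : ℕ) : (X →₀ R) →ₗ[R] B.complex.X p := Finsupp.restrictDom R R (B.cells p)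

theorem incl_injective (p : ℕ) : Function.Injective (B.incl p) := Submodule.injective_subtype _

theorem incl_mem (p : ℕ) (x : B.complex.X p) : B.incl p x ∈ Finsupp.supported R R (B.cells p) :=
  x.2

theorem exists_incl {p : ℕ} {x : X →₀ R} (hx : x ∈ Finsupp.supported R R (B.cells p)) :
    ∃ y, B.incl p y = x :=
  ⟨⟨x, hx⟩, rfl⟩

theorem incl_proj_apply (p : ℕ) (x : X →₀ R) (a : X) [Decidable (a ∈ B.cells p)] :
    B.incl p (B.proj p x) a = if a ∈ B.cells p then x a else 0 := by
  classical
  change (x.filter (· ∈ B.cells p)) a = _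
  rw [Finsupp.filter_apply]
  congr

theorem proj_comp_incl (p : ℕ) : B.proj p ∘ₗ B.incl p = LinearMap.id := by
  classical
  refine LinearMap.ext fun x => B.incl_injective p (Finsupp.ext fun a => ?_)
  rw [LinearMap.comp_apply, incl_proj_apply, LinearMap.id_apply]
  split_ifs with h
  · rfl
  · by_contra h'
    exact h (B.incl_mem p x (Finsupp.mem_support_iff.2 (Ne.symm h')))

theorem proj_eq_zero {p q : ℕ} (h : p ≠ q) {x : X →₀ R}
    (hx : x ∈ Finsupp.supported R R (B.cells q)) : B.proj p x = 0 := by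
  classical
  refine B.incl_injective p (Finsupp.ext fun a => ?_)
  rw [incl_proj_apply, map_zero]
  split_ifs with ha
  · by_contra h'
    exact h (B.eq_of_mem a p q ha (hx (Finsupp.mem_support_iff.2 h')))
  · rfl

theorem proj_comp_incl_of_ne {p q : ℕ} (h : p ≠ q) : B.proj p ∘ₗ B.incl q = 0 :=
  LinearMap.ext fun x => B.proj_eq_zero h (B.incl_mem q x)

theorem incl_dX (p : ℕ) (x : B.complex.X (p + 1)) :
    B.incl p (dX B.complex p x) = B.D (B.incl (p + 1) x) := by
  have : B.complex.d (p + 1) p = ModuleCat.ofHom (B.D.restrict (B.D_mem p)) :=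
    ChainComplex.of_d (fun k => ModuleCat.of R (Finsupp.supported R R (B.cells k)))
      (fun k => ModuleCat.ofHom (B.D.restrict (B.D_mem k))) p
  rw [dX, this]
  rfl

theorem single_mem {p : ℕ} {x : X} (hx : x ∈ B.cells p) :
    Finsupp.single x (1 : R) ∈ Finsupp.supported R R (B.cells p) :=
  Finsupp.single_mem_supported R 1 hx

/-- Both sides vanish unless x has degree p + 1; for x of degree 0 this uses `D_zero`. -/
theorem proj_D (p : ℕ) {a : ℕ} {x : X} (hx : x ∈ B.cells a) :
    B.proj p (B.D (Finsupp.single x 1)) = dX B.complex p (B.proj (p + 1) (Finsupp.single x 1)) := by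
  by_cases h : p + 1 = a
  · subst h
    obtain ⟨y, hy⟩ := B.exists_incl (B.single_mem hx)
    refine B.incl_injective p ?_
    rw [incl_dX, ← hy, ← LinearMap.comp_apply (B.proj (p + 1)), proj_comp_incl, LinearMap.id_apply,
      ← incl_dX, ← LinearMap.comp_apply (B.proj p), proj_comp_incl, LinearMap.id_apply]
  · rw [B.proj_eq_zero h (B.single_mem hx), map_zero]
    cases a with
    | zero => rw [B.D_zero x hx, map_zero]
    | succ a => exact B.proj_eq_zero (by omega) (B.D_mem a _ (B.single_mem hx))

instance (p : ℕ) : Module.Free R (B.complex.X p) :=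
  Module.Free.of_equiv (Finsupp.supportedEquivFinsupp (R := R) (M := R) (B.cells p)).symm

end BasedComplex

/-- The bilinear extension of a product of simplices. -/
def pairProduct {R : Type u} [CommRing R] {X Y W : Type u} (j : X → Y → W) :
    (X →₀ R) ⊗[R] (Y →₀ R) →ₗ[R] (W →₀ R) :=
  Finsupp.lmapDomain R R (Function.uncurry j) ∘ₗ (finsuppTensorFinsupp' R X Y).toLinearMap

theorem pairProduct_single {R : Type u} [CommRing R] {X Y W : Type u} (j : X → Y → W) (x : X)
    (y : Y) (a b : R) : pairProduct j (Finsupp.single x a ⊗ₜ[R] Finsupp.single y b) =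
      Finsupp.single (j x y) (a * b) := by
  rw [pairProduct, LinearMap.comp_apply, LinearEquiv.coe_coe,
    finsuppTensorFinsupp'_single_tmul_single, Finsupp.lmapDomain_apply, Finsupp.mapDomain_single]
  rfl

theorem pairProduct_eq_sum {R : Type u} [CommRing R] {X Y W : Type u} (j : X → Y → W)
    (x : X →₀ R) (y : Y →₀ R) : pairProduct j (x ⊗ₜ[R] y) =
      x.sum fun a r => y.sum fun b s => Finsupp.single (j a b) (r * s) := by
  conv_lhs => rw [← x.sum_single, ← y.sum_single]
  simp only [Finsupp.sum, TensorProduct.sum_tmul, TensorProduct.tmul_sum, map_sum,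
    pairProduct_single]
  exact Finset.sum_comm

/-- A bijection of the simplices of `B₃` with the pairs of simplices of `B₁` and `B₂` for which the
boundary is a signed derivation. -/
structure BasisPairing {R : Type u} [CommRing R] {X Y W : Type u} (B₁ : BasedComplex R X)
    (B₂ : BasedComplex R Y) (B₃ : BasedComplex R W) where
  j : X → Y → W
  injective : Function.Injective (Function.uncurry j)
  mem : ∀ {p q x y}, x ∈ B₁.cells p → y ∈ B₂.cells q → j x y ∈ B₃.cells (p + q)
  exists_eq : ∀ {n w}, w ∈ B₃.cells n → ∃ p q x y, p + q = n ∧ x ∈ B₁.cells p ∧ y ∈ B₂.cells q ∧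
    w = j x y
  D_single : ∀ {p q x y}, x ∈ B₁.cells p → y ∈ B₂.cells q →
    B₃.D (Finsupp.single (j x y) 1) =
      pairProduct j (B₁.D (Finsupp.single x 1) ⊗ₜ Finsupp.single y 1) +
        (-1 : R) ^ p • pairProduct j (Finsupp.single x 1 ⊗ₜ B₂.D (Finsupp.single y 1))

namespace BasisPairing

variable {R : Type u} [CommRing R] {X Y W : Type u} {B₁ : BasedComplex R X}
    {B₂ : BasedComplex R Y} {B₃ : BasedComplex R W} (P : BasisPairing B₁ B₂ B₃)

/-- The pair of factors of a product. -/
def split : (W →₀ R) →ₗ[R] (X →₀ R) ⊗[R] (Y →₀ R) :=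
  (finsuppTensorFinsupp' R X Y).symm.toLinearMap ∘ₗ
    Finsupp.lcomapDomain (Function.uncurry P.j) P.injective

theorem split_pairProduct (t : (X →₀ R) ⊗[R] (Y →₀ R)) : P.split (pairProduct P.j t) = t := by
  refine ((finsuppTensorFinsupp' R X Y).symm_apply_eq).2 ?_
  exact Finsupp.comapDomain_mapDomain _ P.injective _

theorem split_single (x : X) (y : Y) :
    P.split (Finsupp.single (P.j x y) 1) = Finsupp.single x 1 ⊗ₜ Finsupp.single y 1 := by
  rw [← P.split_pairProduct (_ ⊗ₜ _), pairProduct_single, mul_one]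

theorem pairProduct_mem {p q n : ℕ} (h : p + q = n) (t : B₁.complex.X p ⊗[R] B₂.complex.X q) :
    pairProduct P.j (TensorProduct.map (B₁.incl p) (B₂.incl q) t) ∈
      Finsupp.supported R R (B₃.cells n) := by
  induction t with
  | zero => rw [map_zero, map_zero]; exact zero_mem _
  | add s t hs ht => rw [map_add, map_add]; exact add_mem hs ht
  | tmul x y =>
    rw [TensorProduct.map_tmul, pairProduct_eq_sum]
    refine Submodule.sum_mem _ fun a ha => Submodule.sum_mem _ fun b hb => ?_
    refine Finsupp.single_mem_supported R _ ?_
    rw [← h]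
    exact P.mem (B₁.incl_mem p x ha) (B₂.incl_mem q y hb)

/-- The components of a chain. -/
def comp (p q : ℕ) : (W →₀ R) →ₗ[R] B₁.complex.X p ⊗[R] B₂.complex.X q :=
  TensorProduct.map (B₁.proj p) (B₂.proj q) ∘ₗ P.split

theorem comp_single (p q : ℕ) (x : X) (y : Y) : P.comp p q (Finsupp.single (P.j x y) 1) =
    B₁.proj p (Finsupp.single x 1) ⊗ₜ B₂.proj q (Finsupp.single y 1) := by
  rw [comp, LinearMap.comp_apply, split_single, TensorProduct.map_tmul]

theorem comp_pairProduct (p q : ℕ) (t : (X →₀ R) ⊗[R] (Y →₀ R)) :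
    P.comp p q (pairProduct P.j t) = TensorProduct.map (B₁.proj p) (B₂.proj q) t := by
  rw [comp, LinearMap.comp_apply, split_pairProduct]

theorem pairProduct_comp_single {p q : ℕ} {x : X} {y : Y} (hx : x ∈ B₁.cells p)
    (hy : y ∈ B₂.cells q) : pairProduct P.j (TensorProduct.map (B₁.incl p) (B₂.incl q)
      (P.comp p q (Finsupp.single (P.j x y) 1))) = Finsupp.single (P.j x y) 1 := by
  obtain ⟨x', hx'⟩ := B₁.exists_incl (B₁.single_mem hx)
  obtain ⟨y', hy'⟩ := B₂.exists_incl (B₂.single_mem hy)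
  rw [comp_single, TensorProduct.map_tmul, ← hx', ← hy', ← LinearMap.comp_apply (B₁.proj p),
    ← LinearMap.comp_apply (B₂.proj q), B₁.proj_comp_incl, B₂.proj_comp_incl, LinearMap.id_apply,
    LinearMap.id_apply, hx', hy', pairProduct_single, mul_one]

theorem comp_single_of_ne {p q a b : ℕ} {x : X} {y : Y} (hx : x ∈ B₁.cells a)
    (hy : y ∈ B₂.cells b) (h : (p, q) ≠ (a, b)) : P.comp p q (Finsupp.single (P.j x y) 1) = 0 := by
  rw [comp_single]
  by_cases h1 : p = a
  · have h2 : q ≠ b := fun h2 => h (by rw [h1, h2])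
    rw [B₂.proj_eq_zero h2 (B₂.single_mem hy), TensorProduct.tmul_zero]
  · rw [B₁.proj_eq_zero h1 (B₁.single_mem hx), TensorProduct.zero_tmul]

/-- A chain is the sum of its components. -/
theorem sum_pairProduct_comp (n : ℕ) (w : W →₀ R) (hw : w ∈ Finsupp.supported R R (B₃.cells n)) :
    ∑ p ∈ Finset.HasAntidiagonal.antidiagonal n,
      pairProduct P.j (TensorProduct.map (B₁.incl p.1) (B₂.incl p.2) (P.comp p.1 p.2 w)) = w := by
  have := eq_of_supported (∑ p ∈ Finset.HasAntidiagonal.antidiagonal n, pairProduct P.j ∘ₗ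
    TensorProduct.map (B₁.incl p.1) (B₂.incl p.2) ∘ₗ P.comp p.1 p.2) LinearMap.id (B₃.cells n) (by
      intro w hw
      obtain ⟨p, q, x, y, h, hx, hy, rfl⟩ := P.exists_eq hw
      rw [LinearMap.sum_apply, Finset.sum_eq_single_of_mem (p, q) (by simpa using h)]
      · exact P.pairProduct_comp_single hx hy
      · intro b _ hb
        rw [LinearMap.comp_apply, LinearMap.comp_apply, P.comp_single_of_ne hx hy hb, map_zero,
          map_zero]) w hw
  rw [LinearMap.sum_apply] at this
  exact this

/-- The identification of the complex of products with the tensor product of complexes. -/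
def tensorModel : TensorModel B₁.complex B₂.complex B₃.complex where
  comp p q n _ := P.comp p q ∘ₗ B₃.incl n
  ext {n} x y h := by
    refine B₃.incl_injective n ?_
    rw [← P.sum_pairProduct_comp n _ (B₃.incl_mem n x),
      ← P.sum_pairProduct_comp n _ (B₃.incl_mem n y)]
    refine Finset.sum_congr rfl fun p hp => ?_
    have := h p.1 p.2 (by simpa using hp)
    rw [LinearMap.comp_apply, LinearMap.comp_apply] at this
    rw [this]
  exists_eq n F := by
    obtain ⟨x, hx⟩ := B₃.exists_incl (p := n) (x := ∑ p ∈ Finset.HasAntidiagonal.antidiagonal n,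
      pairProduct P.j (TensorProduct.map (B₁.incl p.1) (B₂.incl p.2) (F p.1 p.2)))
      (Submodule.sum_mem _ fun p hp => P.pairProduct_mem (by simpa using hp) _)
    refine ⟨x, fun p q h => ?_⟩
    rw [LinearMap.comp_apply, hx, map_sum, Finset.sum_eq_single_of_mem (p, q) (by simpa using h)]
    · rw [comp_pairProduct, map_map_apply, B₁.proj_comp_incl, B₂.proj_comp_incl,
        TensorProduct.map_id, LinearMap.id_apply]
    · rintro ⟨a, b⟩ _ hab
      rw [comp_pairProduct, map_map_apply]
      by_cases h1 : p = a
      · have h2 : q ≠ b := fun h2 => hab (by rw [h1, h2])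
        rw [B₂.proj_comp_incl_of_ne h2, TensorProduct.map_zero_right, LinearMap.zero_apply]
      · rw [B₁.proj_comp_incl_of_ne h1, TensorProduct.map_zero_left, LinearMap.zero_apply]
  comp_d p q n h h₁ h₂ x := by
    have := eq_of_supported (P.comp p q ∘ₗ B₃.D)
      ((dX B₁.complex p).rTensor (B₂.complex.X q) ∘ₗ P.comp (p + 1) q +
        (-1 : R) ^ p • (dX B₂.complex q).lTensor (B₁.complex.X p) ∘ₗ P.comp p (q + 1))
      (B₃.cells (n + 1)) (by
        intro w hw
        obtain ⟨a, b, x, y, -, hx, hy, rfl⟩ := P.exists_eq hw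
        rw [LinearMap.comp_apply, P.D_single hx hy, map_add, map_smul, comp_pairProduct,
          comp_pairProduct, TensorProduct.map_tmul, TensorProduct.map_tmul, B₁.proj_D p hx,
          B₂.proj_D q hy, LinearMap.add_apply, LinearMap.smul_apply, LinearMap.comp_apply,
          LinearMap.comp_apply, comp_single, comp_single, LinearMap.rTensor_tmul,
          LinearMap.lTensor_tmul]
        -- The derivation rule carries the sign of the degree a of x, the tensor differential that
        -- of p. They agree where it matters: for p ≠ a the projection of x to degree p is zero.
        by_cases hp : p = a
        · rw [hp]
        · rw [B₁.proj_eq_zero hp (B₁.single_mem hx), TensorProduct.zero_tmul, smul_zero,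
            smul_zero]) _ (B₃.incl_mem (n + 1) x)
    rw [LinearMap.comp_apply, BasedComplex.incl_dX]
    exact this

/-- A chain is the sum of its components, and the representing cycle from `cross_lof` has a single
one, so it is literally the product chain. -/
theorem incl_iZ_cross {n : ℕ} (p : {p : ℕ × ℕ // p.1 + p.2 = n})
    (x : B₁.complex.cycles p.1.1) (y : B₂.complex.cycles p.1.2) :
    ∃ w : B₃.complex.cycles n,
      B₃.incl n (iZ _ n w) = pairProduct P.j
        (B₁.incl p.1.1 (iZ _ p.1.1 x) ⊗ₜ[R] B₂.incl p.1.2 (iZ _ p.1.2 y)) ∧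
      πH _ n w = P.tensorModel.cross n (DirectSum.lof R _ _ p (πH _ _ x ⊗ₜ[R] πH _ _ y)) := by
  obtain ⟨w, hw, hw'⟩ := P.tensorModel.cross_lof n p x y
  refine ⟨w, ?_, hw⟩
  obtain ⟨⟨a, b⟩, h⟩ := p
  rw [← P.sum_pairProduct_comp n _ (B₃.incl_mem n _),
    Finset.sum_eq_single_of_mem (a, b) (by simpa using h)]
  · refine (congrArg _ (congrArg _ (hw' a b h))).trans ?_
    rw [DirectSum.lof_eq_of, DirectSum.of_eq_same, map_map_apply, TensorProduct.map_tmul]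
    rfl
  · rintro ⟨a', b'⟩ hab' hne
    have h' : a' + b' = n := by simpa using hab'
    refine (congrArg _ (congrArg _ (hw' a' b' h'))).trans ?_
    rw [DirectSum.lof_eq_of, DirectSum.of_eq_of_ne, map_zero, map_zero, map_zero]
    intro e
    exact hne (congrArg Subtype.val e)

end BasisPairing

/-- Linear maps compatible with two pairings of bases. -/
theorem BasisPairing.compatible {R : Type u} [CommRing R] {X Y W X' Y' W' : Type u}
    {B₁ : BasedComplex R X} {B₂ : BasedComplex R Y} {B₃ : BasedComplex R W}
    {B₁' : BasedComplex R X'} {B₂' : BasedComplex R Y'} {B₃' : BasedComplex R W'}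
    (P : BasisPairing B₁ B₂ B₃) (P' : BasisPairing B₁' B₂' B₃')
    (f : B₁.complex ⟶ B₁'.complex) (g : B₂.complex ⟶ B₂'.complex) (k : B₃.complex ⟶ B₃'.complex)
    (fX : (X →₀ R) →ₗ[R] (X' →₀ R)) (gY : (Y →₀ R) →ₗ[R] (Y' →₀ R))
    (kW : (W →₀ R) →ₗ[R] (W' →₀ R))
    (hf : ∀ p x, B₁'.incl p ((f.f p).hom x) = fX (B₁.incl p x))
    (hg : ∀ p x, B₂'.incl p ((g.f p).hom x) = gY (B₂.incl p x))
    (hk : ∀ p x, B₃'.incl p ((k.f p).hom x) = kW (B₃.incl p x))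
    (hfg : ∀ p q x y, x ∈ B₁.cells p → y ∈ B₂.cells q → kW (Finsupp.single (P.j x y) 1) =
      pairProduct P'.j (fX (Finsupp.single x 1) ⊗ₜ gY (Finsupp.single y 1))) :
    P.tensorModel.Compatible P'.tensorModel f g k := by
  -- The linear map on all chains commutes with projection to a degree, because on each cell it is
  -- given by the degree-preserving chain map.
  have key : ∀ {X X' : Type u} {B : BasedComplex R X} {B' : BasedComplex R X'}
      (f : B.complex ⟶ B'.complex) (fX : (X →₀ R) →ₗ[R] (X' →₀ R))
      (_ : ∀ p x, B'.incl p ((f.f p).hom x) = fX (B.incl p x)) (p a : ℕ) (x : X)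
      (_ : x ∈ B.cells a), B'.proj p (fX (Finsupp.single x 1)) =
        (f.f p).hom (B.proj p (Finsupp.single x 1)) := by
    intro X X' B B' f fX hf p a x hx
    obtain ⟨y, hy⟩ := B.exists_incl (B.single_mem hx)
    by_cases h : p = a
    · subst h
      rw [← hy, ← hf, ← LinearMap.comp_apply (B'.proj p), B'.proj_comp_incl,
        ← LinearMap.comp_apply (B.proj p), B.proj_comp_incl, LinearMap.id_apply, LinearMap.id_apply]
    · rw [B.proj_eq_zero h (B.single_mem hx), map_zero, ← hy, ← hf]
      exact B'.proj_eq_zero h (B'.incl_mem a _)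
  intro p q n h x
  have := eq_of_supported (P'.comp p q ∘ₗ kW)
    (TensorProduct.map (f.f p).hom (g.f q).hom ∘ₗ P.comp p q) (B₃.cells n) (by
      intro w hw
      obtain ⟨a, b, x, y, -, hx, hy, rfl⟩ := P.exists_eq hw
      rw [LinearMap.comp_apply, hfg a b x y hx hy, P'.comp_pairProduct, LinearMap.comp_apply,
        P.comp_single, TensorProduct.map_tmul, TensorProduct.map_tmul, key f fX hf p a x hx,
        key g gY hg q b y hy]) _ (B₃.incl_mem n x)
  refine Eq.trans ?_ this
  exact congrArg (P'.comp p q) (hk n x)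

/-! ### Joins of directed complexes -/

section DirectedJoin

variable (R : Type u) [CommRing R] {V V' : Type u}

/-- The augmented chain complex of a directed complex with its basis of sequences. -/
def DirectedComplex.based (K : DirectedComplex V) : BasedComplex R (List V) where
  cells k := {σ | σ.length = k ∧ (σ = [] ∨ σ ∈ K.faces)}
  D := directedBoundary R
  D_mem := K.boundary_mem R
  D_sq := directedBoundary_sq R
  D_zero σ hσ := by
    rw [directedBoundary_single, hσ.1, Finset.sum_range_zero]
  eq_of_mem _ _ _ h h' := h.1.symm.trans h'.1

instance (K : DirectedComplex V) (p : ℕ) : Module.Free R ((K.chains R).X p) :=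
  inferInstanceAs (Module.Free R ((K.based R).complex.X p))

/-- The two factors are recovered by keeping the vertices of V, respectively of V'. -/
theorem joinList_injective : Function.Injective (Function.uncurry (joinList (V := V) (V' := V'))) := by
  have h1 : ∀ (σ : List V) (τ : List V'),
      (joinList σ τ).filterMap (fun x => (ofLex x).getLeft?) = σ := by
    intro σ τ
    simp [joinList, List.filterMap_append, List.filterMap_map, Function.comp_def, Sum.inlₗ,
      Sum.inrₗ]
  have h2 : ∀ (σ : List V) (τ : List V'),
      (joinList σ τ).filterMap (fun x => (ofLex x).getRight?) = τ := by
    intro σ τ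
    simp [joinList, List.filterMap_append, List.filterMap_map, Function.comp_def, Sum.inlₗ,
      Sum.inrₗ]
  rintro ⟨σ, τ⟩ ⟨σ', τ'⟩ h
  change joinList σ τ = joinList σ' τ' at h
  exact Prod.ext ((h1 σ τ).symm.trans (h ▸ h1 σ' τ')) ((h2 σ τ).symm.trans (h ▸ h2 σ' τ'))

/-- The omitted vertex lies in σ or in τ; in the second case its position is shifted by the length
of σ, which is the sign. -/
theorem directedBoundary_joinList (σ : List V) (τ : List V') :
    directedBoundary R (Finsupp.single (joinList σ τ) 1) =
      pairProduct joinList (directedBoundary R (Finsupp.single σ 1) ⊗ₜ Finsupp.single τ 1) +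
        (-1 : R) ^ σ.length •
          pairProduct joinList (Finsupp.single σ 1 ⊗ₜ directedBoundary R (Finsupp.single τ 1)) := by
  rw [directedBoundary_single, directedBoundary_single, directedBoundary_single,
    TensorProduct.sum_tmul, TensorProduct.tmul_sum, map_sum, map_sum, joinList, List.length_append,
    Finset.sum_range_add, Finset.smul_sum, List.length_map, List.length_map]
  congr 1
  · refine Finset.sum_congr rfl fun i hi => ?_
    rw [← TensorProduct.smul_tmul', map_smul, pairProduct_single, mul_one,
      List.eraseIdx_append_of_lt_length (by simpa using hi), joinList, List.eraseIdx_map]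
  · refine Finset.sum_congr rfl fun i hi => ?_
    rw [TensorProduct.tmul_smul, map_smul, pairProduct_single, mul_one, smul_smul, ← pow_add,
      List.eraseIdx_append_of_length_le (by simp), List.length_map, Nat.add_sub_cancel_left,
      joinList, List.eraseIdx_map]

/-- Concatenation of sequences as a pairing of bases. -/
def listPairing (K : DirectedComplex V) (K' : DirectedComplex V') :
    BasisPairing (K.based R) (K'.based R) ((K.join K').based R) where
  j := joinList
  injective := joinList_injective
  mem := by
    rintro p q σ τ ⟨hl, hσ⟩ ⟨hl', hτ⟩
    refine ⟨by simp [joinList, hl, hl'], ?_⟩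
    -- With empty sequences admitted on both sides, the three kinds of simplices of the join and its
    -- own empty sequence are exactly the four cases of a pair.
    rcases hσ with rfl | hσ <;> rcases hτ with rfl | hτ
    · exact Or.inl rfl
    · exact Or.inr (Or.inr (Or.inl ⟨τ, hτ, rfl⟩))
    · exact Or.inr (Or.inl ⟨σ, hσ, rfl⟩)
    · exact Or.inr (Or.inr (Or.inr ⟨σ, hσ, τ, hτ, rfl⟩))
  exists_eq := by
    have key : ∀ (n : ℕ) (σ : List V) (τ : List V'), (joinList σ τ).length = n →
        (σ = [] ∨ σ ∈ K.faces) → (τ = [] ∨ τ ∈ K'.faces) → ∃ p q x y, p + q = n ∧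
          x ∈ (K.based R).cells p ∧ y ∈ (K'.based R).cells q ∧ joinList σ τ = joinList x y := by
      intro n σ τ h hσ hτ
      exact ⟨σ.length, τ.length, σ, τ, by simpa [joinList] using h, ⟨rfl, hσ⟩, ⟨rfl, hτ⟩, rfl⟩
    rintro n w ⟨hl, rfl | ⟨σ, hσ, rfl⟩ | ⟨τ, hτ, rfl⟩ | ⟨σ, hσ, τ, hτ, rfl⟩⟩
    · exact key n [] [] hl (Or.inl rfl) (Or.inl rfl)
    · exact key n σ [] hl (Or.inr hσ) (Or.inl rfl)
    · exact key n [] τ hl (Or.inl rfl) (Or.inr hτ)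
    · exact key n σ τ hl (Or.inr hσ) (Or.inr hτ)
  D_single := by
    rintro p q σ τ ⟨rfl, -⟩ -
    exact directedBoundary_joinList R σ τ

/-- The chains of a join of directed complexes as a tensor product. -/
def listModel (K : DirectedComplex V) (K' : DirectedComplex V') :
    TensorModel (K.chains R) (K'.chains R) ((K.join K').chains R) :=
  (listPairing R K K').tensorModel

variable {R}

theorem listModel_represents (K : DirectedComplex V) (K' : DirectedComplex V') (n : ℕ)
    (p : {p : ℕ × ℕ // p.1 + p.2 = n}) (x : List V →₀ R) (y : List V' →₀ R)
    (ξ : (K.chains R).homology p.1.1) (η : (K'.chains R).homology p.1.2)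
    (hx : K.Represents p.1.1 x ξ) (hy : K'.Represents p.1.2 y η) :
    (K.join K').Represents n (listProduct x y)
      ((listModel R K K').cross n (DirectSum.lof R _ _ p (ξ ⊗ₜ[R] η))) := by
  obtain ⟨a, rfl, rfl⟩ := hx
  obtain ⟨b, rfl, rfl⟩ := hy
  obtain ⟨w, hw, hw'⟩ := (listPairing R K K').incl_iZ_cross p a b
  exact ⟨w, hw.trans (pairProduct_eq_sum _ _ _), hw'⟩

end DirectedJoin

/-! ### Joins of simplicial complexes -/

section SimplicialJoin

variable (R : Type u) [CommRing R] {V V' : Type u} [LinearOrder V] [LinearOrder V']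

/-- The augmented chain complex of a simplicial complex with its basis of simplices. -/
def based (K : PreAbstractSimplicialComplex V) : BasedComplex R (Finset V) where
  cells k := {s | s.card = k ∧ (s = ∅ ∨ s ∈ K.faces)}
  D := boundary R
  D_mem := boundary_mem R K
  D_sq := boundary_sq R
  D_zero s hs := by
    rw [boundary_single, Finset.card_eq_zero.1 hs.1, Finset.sum_empty]
  eq_of_mem _ _ _ h h' := h.1.symm.trans h'.1

instance (K : PreAbstractSimplicialComplex V) (p : ℕ) : Module.Free R ((chains R K).X p) :=
  inferInstanceAs (Module.Free R ((based R K).complex.X p))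

theorem joinFinset_injective {V V' : Type u} :
    Function.Injective (Function.uncurry (joinFinset (V := V) (V' := V'))) := by
  rintro ⟨σ, τ⟩ ⟨σ', τ'⟩ h
  change joinFinset σ τ = joinFinset σ' τ' at h
  refine Prod.ext (Finset.ext fun v => ?_) (Finset.ext fun v => ?_)
  · rw [← inl_mem_joinFinset (τ := τ), h, inl_mem_joinFinset]
  · rw [← inr_mem_joinFinset (σ := σ), h, inr_mem_joinFinset]

theorem card_joinFinset {V V' : Type u} (σ : Finset V) (τ : Finset V') :
    (joinFinset σ τ).card = σ.card + τ.card := by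
  rw [joinFinset, Finset.card_map, Finset.card_disjSum]

/-- All of V precedes V': a vertex of σ has the same predecessors in the join as in σ, while a
vertex of τ has all of σ before it, which gives the sign. -/
theorem boundary_joinFinset (σ : Finset V) (τ : Finset V') :
    boundary R (Finsupp.single (joinFinset σ τ) 1) =
      pairProduct joinFinset (boundary R (Finsupp.single σ 1) ⊗ₜ Finsupp.single τ 1) +
        (-1 : R) ^ σ.card •
          pairProduct joinFinset (Finsupp.single σ 1 ⊗ₜ boundary R (Finsupp.single τ 1)) := by
  have e1 : ∀ v, (joinFinset σ τ).filter (· < toLex (Sum.inl v)) =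
      joinFinset (σ.filter (· < v)) ∅ := by
    intro v
    ext x
    induction x using Lex.rec with | h x => ?_
    rcases x with w | w <;> simp [joinFinset]
  have e2 : ∀ v, (joinFinset σ τ).filter (· < toLex (Sum.inr v)) =
      joinFinset σ (τ.filter (· < v)) := by
    intro v
    ext x
    induction x using Lex.rec with | h x => ?_
    rcases x with w | w <;> simp [joinFinset]
  have e3 : ∀ (_ : DecidableEq V) (_ : DecidableEq (V ⊕ₗ V')) (v : V),
      (joinFinset σ τ).erase (toLex (Sum.inl v)) = joinFinset (σ.erase v) τ := by
    intro _ _ v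
    ext x
    induction x using Lex.rec with | h x => ?_
    rcases x with w | w <;> simp [joinFinset]
  have e4 : ∀ (_ : DecidableEq V') (_ : DecidableEq (V ⊕ₗ V')) (v : V'),
      (joinFinset σ τ).erase (toLex (Sum.inr v)) = joinFinset σ (τ.erase v) := by
    intro _ _ v
    ext x
    induction x using Lex.rec with | h x => ?_
    rcases x with w | w <;> simp [joinFinset]
  have hsum : ∀ f : V ⊕ₗ V' → (Finset (V ⊕ₗ V') →₀ R), ∑ v ∈ joinFinset σ τ, f v =
      ∑ v ∈ σ, f (toLex (Sum.inl v)) + ∑ v ∈ τ, f (toLex (Sum.inr v)) := by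
    intro f
    rw [joinFinset, Finset.sum_map, Finset.sum_disjSum]
    rfl
  rw [boundary_single, boundary_single, boundary_single, hsum, TensorProduct.sum_tmul,
    TensorProduct.tmul_sum, map_sum, map_sum, Finset.smul_sum]
  congr 1
  · refine Finset.sum_congr rfl fun v _ => ?_
    rw [← TensorProduct.smul_tmul', map_smul, pairProduct_single, mul_one, e1, e3, card_joinFinset,
      Finset.card_empty, add_zero]
  · refine Finset.sum_congr rfl fun v _ => ?_
    rw [TensorProduct.tmul_smul, map_smul, pairProduct_single, mul_one, smul_smul, ← pow_add, e2,
      e4, card_joinFinset]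

/-- Disjoint union of simplices as a pairing of bases. -/
def finsetPairing (K : PreAbstractSimplicialComplex V) (K' : PreAbstractSimplicialComplex V')
    (L : PreAbstractSimplicialComplex (V ⊕ₗ V')) (hL : L = simplicialJoin K K') :
    BasisPairing (based R K) (based R K') (based R L) where
  j := joinFinset
  injective := joinFinset_injective
  mem := by
    subst hL
    rintro p q σ τ ⟨hl, hσ⟩ ⟨hl', hτ⟩
    refine ⟨by rw [card_joinFinset, hl, hl'], ?_⟩
    rcases hσ with rfl | hσ <;> rcases hτ with rfl | hτ
    · exact Or.inl rfl
    · exact Or.inr (Or.inr (Or.inl ⟨τ, hτ, rfl⟩))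
    · exact Or.inr (Or.inl ⟨σ, hσ, rfl⟩)
    · exact Or.inr (Or.inr (Or.inr ⟨σ, hσ, τ, hτ, rfl⟩))
  exists_eq := by
    subst hL
    have key : ∀ (n : ℕ) (σ : Finset V) (τ : Finset V'), (joinFinset σ τ).card = n →
        (σ = ∅ ∨ σ ∈ K.faces) → (τ = ∅ ∨ τ ∈ K'.faces) → ∃ p q x y, p + q = n ∧
          x ∈ (based R K).cells p ∧ y ∈ (based R K').cells q ∧ joinFinset σ τ = joinFinset x y := by
      intro n σ τ h hσ hτ
      exact ⟨σ.card, τ.card, σ, τ, by rw [← h, card_joinFinset], ⟨rfl, hσ⟩, ⟨rfl, hτ⟩, rfl⟩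
    rintro n w ⟨hl, rfl | ⟨σ, hσ, rfl⟩ | ⟨τ, hτ, rfl⟩ | ⟨σ, hσ, τ, hτ, rfl⟩⟩
    · exact key n ∅ ∅ hl (Or.inl rfl) (Or.inl rfl)
    · exact key n σ ∅ hl (Or.inr hσ) (Or.inl rfl)
    · exact key n ∅ τ hl (Or.inl rfl) (Or.inr hτ)
    · exact key n σ τ hl (Or.inr hσ) (Or.inr hτ)
  D_single := by
    rintro p q σ τ ⟨rfl, -⟩ -
    exact boundary_joinFinset R σ τ

/-- The chains of the independence complex of a disjoint union as a tensor product. -/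
def finsetModel (G : SimpleGraph V) (G' : SimpleGraph V') :
    TensorModel (chains R (ind G)) (chains R (ind G')) (chains R (ind (disjointUnion G G'))) :=
  (finsetPairing R (ind G) (ind G') _ (ind_disjointUnion G G')).tensorModel

variable {R}

theorem finsetModel_represents (G : SimpleGraph V) (G' : SimpleGraph V') (n : ℕ)
    (p : {p : ℕ × ℕ // p.1 + p.2 = n}) (x : Finset V →₀ R) (y : Finset V' →₀ R)
    (ξ : (chains R (ind G)).homology p.1.1) (η : (chains R (ind G')).homology p.1.2)
    (hx : Represents (ind G) p.1.1 x ξ) (hy : Represents (ind G') p.1.2 y η) :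
    Represents (ind (disjointUnion G G')) n (finsetProduct x y)
      ((finsetModel R G G').cross n (DirectSum.lof R _ _ p (ξ ⊗ₜ[R] η))) := by
  obtain ⟨a, rfl, rfl⟩ := hx
  obtain ⟨b, rfl, rfl⟩ := hy
  obtain ⟨w, hw, hw'⟩ :=
    (finsetPairing R (ind G) (ind G') _ (ind_disjointUnion G G')).incl_iZ_cross p a b
  exact ⟨w, hw.trans (pairProduct_eq_sum _ _ _), hw'⟩

end SimplicialJoin

/-! ### Compatible chain maps -/

section Compatible

variable {R : Type u} [CommRing R] {V V' W W' : Type u} [LinearOrder V] [LinearOrder V']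
  [LinearOrder W] [LinearOrder W']

theorem inversions_map_of_strictMono {φ : V → W} (hφ : StrictMono φ) (σ : List V) :
    inversions (σ.map φ) = inversions σ := by
  induction σ with
  | nil => rfl
  | cons v l ih =>
    rw [List.map_cons, inversions, inversions, ih, List.countP_map]
    congr 2
    funext w
    simp [hφ.lt_iff_lt]

/-- No inversion involves a vertex from each side, since V comes before V' both in the sequence and
in the order. Hence the sign in π is multiplicative under joins. -/
theorem inversions_joinList (σ : List V) (τ : List V') :
    inversions (joinList σ τ) = inversions σ + inversions τ := by
  induction σ with
  | nil =>
    rw [joinList, List.map_nil, List.nil_append, inversions, zero_add]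
    exact inversions_map_of_strictMono (fun a b h => by simpa [Sum.inrₗ] using h) τ
  | cons v l ih =>
    have h1 : (joinList l τ).countP (· < Sum.inlₗ v) = l.countP (· < v) := by
      rw [joinList, List.countP_append, List.countP_map, List.countP_map]
      simp [Function.comp_def, Sum.inlₗ, Sum.inrₗ]
    change (joinList l τ).countP (· < Sum.inlₗ v) + inversions (joinList l τ) = _
    rw [h1, ih, inversions, add_assoc]

/-- On basis elements, π(σ * τ) = π(σ) * π(τ): underlying sets go to disjoint unions and signs
multiply. This gives the squares between the two rows. -/
theorem projection_compatible (G : SimpleGraph V) (G' : SimpleGraph V') :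
    (listModel R (directedInd G) (directedInd G')).Compatible (finsetModel R G G')
      (indProjection R G) (indProjection R G') (joinProjection R G G') := by
  refine BasisPairing.compatible _ _ _ _ _ (projection R) (projection R) (projection R)
    (fun _ _ => rfl) (fun _ _ => rfl) (fun _ _ => rfl) ?_
  intro p q σ τ _ _
  change projection R (Finsupp.single (joinList σ τ) 1) = pairProduct joinFinset _
  rw [projection_single, projection_single, projection_single, TensorProduct.smul_tmul_smul,
    map_smul, pairProduct_single, inversions_joinList, toFinset_joinList, pow_add, mul_one]

theorem directedMap_compatible {G : SimpleGraph V} {G' : SimpleGraph V'} {H : SimpleGraph W}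
    {H' : SimpleGraph W'} (φ : V ↪o W) (ψ : V' ↪o W') (h : H.comap φ = G) (h' : H'.comap ψ = G') :
    (listModel R (directedInd G) (directedInd G')).Compatible
      (listModel R (directedInd H) (directedInd H'))
      (directedIndMap R φ h) (directedIndMap R ψ h') (directedJoinMap R φ ψ h h') := by
  refine BasisPairing.compatible _ _ _ _ _ (Finsupp.lmapDomain R R (List.map φ))
    (Finsupp.lmapDomain R R (List.map ψ)) (Finsupp.lmapDomain R R (List.map (joinEmbedding φ ψ)))
    (fun _ _ => rfl) (fun _ _ => rfl) (fun _ _ => rfl) ?_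
  intro p q σ τ _ _
  change Finsupp.mapDomain _ (Finsupp.single (joinList σ τ) 1) =
    pairProduct joinList (Finsupp.mapDomain _ _ ⊗ₜ Finsupp.mapDomain _ _)
  rw [Finsupp.mapDomain_single, Finsupp.mapDomain_single, Finsupp.mapDomain_single,
    pairProduct_single, map_joinList, mul_one]

theorem map_joinFinset (φ : V ↪o W) (ψ : V' ↪o W') (σ : Finset V) (τ : Finset V') :
    (joinFinset σ τ).map (joinEmbedding φ ψ).toEmbedding =
      joinFinset (σ.map φ.toEmbedding) (τ.map ψ.toEmbedding) := by
  have h1 : ∀ v, joinEmbedding φ ψ (toLex (Sum.inl v)) = toLex (Sum.inl (φ v)) := fun _ => rfl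
  have h2 : ∀ v, joinEmbedding φ ψ (toLex (Sum.inr v)) = toLex (Sum.inr (ψ v)) := fun _ => rfl
  ext x
  induction x using Lex.rec with | h x => ?_
  rcases x with w | w <;> simp [joinFinset, h1, h2]

theorem map_compatible {G : SimpleGraph V} {G' : SimpleGraph V'} {H : SimpleGraph W}
    {H' : SimpleGraph W'} (φ : V ↪o W) (ψ : V' ↪o W') (h : H.comap φ = G) (h' : H'.comap ψ = G') :
    (finsetModel R G G').Compatible (finsetModel R H H') (indMap R φ h) (indMap R ψ h')
      (indMap R (joinEmbedding φ ψ) (comap_joinEmbedding h h')) := by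
  refine BasisPairing.compatible _ _ _ _ _ (Finsupp.lmapDomain R R (Finset.map φ.toEmbedding))
    (Finsupp.lmapDomain R R (Finset.map ψ.toEmbedding))
    (Finsupp.lmapDomain R R (Finset.map (joinEmbedding φ ψ).toEmbedding))
    (fun _ _ => rfl) (fun _ _ => rfl) (fun _ _ => rfl) ?_
  intro p q σ τ _ _
  change Finsupp.mapDomain _ (Finsupp.single (joinFinset σ τ) 1) =
    pairProduct joinFinset (Finsupp.mapDomain _ _ ⊗ₜ Finsupp.mapDomain _ _)
  rw [Finsupp.mapDomain_single, Finsupp.mapDomain_single, Finsupp.mapDomain_single,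
    pairProduct_single, map_joinFinset, mul_one]

/-- The projection to the underlying complex is natural for order embeddings. -/
theorem projectionMap_naturality {K : DirectedComplex V} {L : PreAbstractSimplicialComplex V}
    {K' : DirectedComplex W} {L' : PreAbstractSimplicialComplex W} (φ : V ↪o W)
    (hK : K.underlying = L) (hK' : K'.underlying = L') (h : ∀ σ ∈ K.faces, σ.map φ ∈ K'.faces)
    (h' : ∀ s ∈ L.faces, s.map φ.toEmbedding ∈ L'.faces) :
    projectionMap (R := R) hK ≫ chainMap φ h' =
      DirectedComplex.chainMap φ h ≫ projectionMap hK' := by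
  -- The identity holds for every sequence, with no condition of membership in K: an order embedding
  -- preserves inversions and commutes with taking underlying sets.
  have key := eq_of_supported
    (Finsupp.lmapDomain R R (Finset.map φ.toEmbedding) ∘ₗ projection R)
    (projection R ∘ₗ Finsupp.lmapDomain R R (List.map φ)) Set.univ (by
      intro σ _
      rw [LinearMap.comp_apply, LinearMap.comp_apply, projection_single, map_smul,
        Finsupp.lmapDomain_apply, Finsupp.lmapDomain_apply, Finsupp.mapDomain_single,
        Finsupp.mapDomain_single, projection_single, inversions_map_of_strictMono φ.strictMono]
      congr 2
      ext w
      simp)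
  refine HomologicalComplex.hom_ext _ _ fun n => ModuleCat.hom_ext (LinearMap.ext fun x => ?_)
  exact Subtype.ext (key x.1 (by simp))

end Compatible

/-! ### The Künneth diagrams -/

section Diagram

variable (R : Type u) [CommRing R]

theorem tensorPartMap_comp {C C' C'' D D' D'' : ChainComplex (ModuleCat.{u} R) ℕ} (f : C ⟶ C')
    (f' : C' ⟶ C'') (g : D ⟶ D') (g' : D' ⟶ D'') (n : ℕ) :
    tensorPartMap f' g' n ∘ₗ tensorPartMap f g n = tensorPartMap (f ≫ f') (g ≫ g') n := by
  refine LinearMap.ext fun x => DFinsupp.ext fun p => ?_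
  rw [LinearMap.comp_apply, tensorPartMap, tensorPartMap, tensorPartMap, DirectSum.lmap_apply,
    DirectSum.lmap_apply, DirectSum.lmap_apply, map_map_apply, HomologicalComplex.homologyMap_comp,
    HomologicalComplex.homologyMap_comp]
  rfl

theorem hMap_comp {C C' C'' : ChainComplex (ModuleCat.{u} R) ℕ} (f : C ⟶ C') (f' : C' ⟶ C'')
    (n : ℕ) : hMap f' n ∘ₗ hMap f n = hMap (f ≫ f') n := by
  rw [hMap, hMap, hMap, HomologicalComplex.homologyMap_comp]
  rfl

/-- Functoriality in both variables at once: the maps in the two arguments of `Tor` can be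
interchanged because each `Tor` map in the first argument is a natural transformation. -/
theorem torPartMap_comp {C C' C'' D D' D'' : ChainComplex (ModuleCat.{u} R) ℕ} (f : C ⟶ C')
    (f' : C' ⟶ C'') (g : D ⟶ D') (g' : D' ⟶ D'') (n : ℕ) :
    torPartMap f' g' n ∘ₗ torPartMap f g n = torPartMap (f ≫ f') (g ≫ g') n := by
  refine LinearMap.ext fun x => DFinsupp.ext fun p => ?_
  rw [LinearMap.comp_apply, torPartMap, torPartMap, torPartMap, DirectSum.lmap_apply,
    DirectSum.lmap_apply, DirectSum.lmap_apply, ← LinearMap.comp_apply, ← ModuleCat.hom_comp]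
  congr 2
  rw [HomologicalComplex.homologyMap_comp, HomologicalComplex.homologyMap_comp, Functor.map_comp,
    Functor.map_comp, NatTrans.comp_app]
  simp only [Category.assoc, NatTrans.naturality_assoc]

variable [IsDomain R] [IsPrincipalIdealRing R] {V V' W W' : Type u} [LinearOrder V]
  [LinearOrder V'] [LinearOrder W] [LinearOrder W']

/-- The Künneth diagram of a pair of graphs. -/
def kunnethDiagram (G : SimpleGraph V) (G' : SimpleGraph V') (n : ℕ) : KunnethDiagram R G G' n where
  top := (listModel R (directedInd G) (directedInd G')).kunnethSequence n
  bot := (finsetModel R G G').kunnethSequence n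
  top_cross := listModel_represents _ _ n
  bot_cross := finsetModel_represents G G' n
  comm_cross := (projection_compatible G G').cross_naturality n
  comm_tor := (projection_compatible G G').toTor_naturality n

/-- The squares within each row come from compatibility of inclusions with the tensor
decompositions; the squares relating the vertical maps come from π commuting with inclusions on
chains. -/
theorem kunnethDiagram_natural {G : SimpleGraph V} {G' : SimpleGraph V'} {H : SimpleGraph W}
    {H' : SimpleGraph W'} (φ : V ↪o W) (ψ : V' ↪o W') (h : H.comap φ = G) (h' : H'.comap ψ = G')
    (n : ℕ) :
    (kunnethDiagram R G G' n).Natural (kunnethDiagram R H H' n) φ ψ h h' := by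
  have e1 : indProjection R G ≫ indMap R φ h = directedIndMap R φ h ≫ indProjection R H :=
    projectionMap_naturality φ _ _ _ _
  have e2 : indProjection R G' ≫ indMap R ψ h' = directedIndMap R ψ h' ≫ indProjection R H' :=
    projectionMap_naturality ψ _ _ _ _
  have e3 : joinProjection R G G' ≫ indMap R (joinEmbedding φ ψ) (comap_joinEmbedding h h') =
      directedJoinMap R φ ψ h h' ≫ joinProjection R H H' :=
    projectionMap_naturality (joinEmbedding φ ψ) _ _ _ _
  exact
    { top_cross := (directedMap_compatible φ ψ h h').cross_naturality n
      top_tor := (directedMap_compatible φ ψ h h').toTor_naturality n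
      bot_cross := (map_compatible φ ψ h h').cross_naturality n
      bot_tor := (map_compatible φ ψ h h').toTor_naturality n
      tensor_projection := by rw [tensorPartMap_comp, tensorPartMap_comp, e1, e2]
      join_projection := by rw [hMap_comp, hMap_comp, e3]
      tor_projection := by rw [torPartMap_comp, torPartMap_comp, e1, e2] }

end Diagram

end IndKunneth

end

/-- One uniform construction serves all pairs of graphs and is natural for every order embedding
onto an induced subgraph; the inclusions V_s ⊆ V_t and V_t ⊆ V are instances. -/
theorem theorem6p8 (R : Type u) [CommRing R] [IsDomain R] [IsPrincipalIdealRing R] :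
    (∀ (V V' : Type u) (G : SimpleGraph V) (G' : SimpleGraph V'),
      IndKunneth.ind (IndKunneth.disjointUnion G G') =
        IndKunneth.simplicialJoin (IndKunneth.ind G) (IndKunneth.ind G')) ∧
    ∃ KU : ∀ (V V' : Type u) [LinearOrder V] [LinearOrder V'] (G : SimpleGraph V)
        (G' : SimpleGraph V') (n : ℕ), IndKunneth.KunnethDiagram R G G' n,
      ∀ (V V' : Type u) [LinearOrder V] [LinearOrder V'] (G : SimpleGraph V)
        (G' : SimpleGraph V') (F : IndKunneth.VertexFiltration V)
        (F' : IndKunneth.VertexFiltration V') (n : ℕ),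
        (∀ (s t : ℤ) (h : s ≤ t),
          (KU _ _ (F.graph G s) (F'.graph G' s) n).Natural (KU _ _ (F.graph G t) (F'.graph G' t) n)
            (F.incl h) (F'.incl h) (F.comap_incl G h) (F'.comap_incl G' h)) ∧
        (∀ t : ℤ,
          (KU _ _ (F.graph G t) (F'.graph G' t) n).Natural (KU _ _ G G' n)
            (F.inclTop t) (F'.inclTop t) (F.comap_inclTop G t) (F'.comap_inclTop G' t)) := by
  refine ⟨fun V V' G G' => IndKunneth.ind_disjointUnion G G',
    fun V V' _ _ G G' n => IndKunneth.kunnethDiagram R G G' n,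
    fun V V' _ _ G G' F F' n => ⟨fun s t h => ?_, fun t => ?_⟩⟩
  · exact IndKunneth.kunnethDiagram_natural R _ _ _ _ n
  · exact IndKunneth.kunnethDiagram_natural R _ _ _ _ n
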